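/- Let $n\ge 3$ and let $Cl_n$ be the real Clifford algebra generated by an orthonormal basis $e_1,\dots,e_n$ of $\mathbb R^n$ with $e_ie_j+e_je_i=-2\delta_{ij}$, so that every nonzero vector $v\in\mathbb R^n\subset Cl_n$ has the inverse $v^{-1}=-v/\|v\|^2$. Let $Cl_{n-1}$ be the subalgebra generated by $e_1,\dots,e_{n-1}$. Every $A\in Cl_n$ is $A=B+Ce_n$ for unique $B,C\in Cl_{n-1}$; put $P(A)=B$, $Q(A)=C$, $\hat A=B-Ce_n$ and $Q'(A)=-e_nQ(A)e_n$. For $x\in\mathbb R^n$ this gives $\hat x=x_1e_1+\dots+x_{n-1}e_{n-1}-x_ne_n$. Let $D=\sum_{j=1}^n e_j\,\partial/\partial x_j$ and $Mf=Df+\frac{n-2}{x_n}Q'(f)$. Let $\mathbb R^{n,+}=\{x\in\mathbb R^n:x_n>0\}$, let $\omega_n=2\pi^{n/2}/\Gamma(n/2)$ be the surface area of the unit sphere in $\mathbb R^n$, and for $x\ne y$ in $\mathbb R^{n,+}$ let $$E(x,y)=\frac{(x-y)^{-1}}{\|x-y\|^{n-2}\|x-\hat y\|^{n-2}},\qquad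 F(x,y)=\frac{(\hat x-y)^{-1}}{\|x-y\|^{n-2}\|\hat x-y\|^{n-2}},$$ $$p(x,y)=D_x\int_{\|x-y\|/\|x-\hat y\|}^{1}\frac{(1-t^2)^{n-2}}{t^{n-1}}\,dt,\qquad q(x,y)=\frac1{2(n-2)}\,D_x\frac{1}{\|x-y\|^{n-2}\|x-\hat y\|^{n-2}}.$$ **Theorem (Borel-Pompeiu formula).** Let $K$ be a bounded open set with smooth (it is enough: $C^1$) boundary, lying locally on one side of its boundary, and with $\overline K\subset\mathbb R^{n,+}$. Let $n(x)$ be the outer unit normal and $\sigma$ the surface measure of $\partial K$. Let $f:K\to Cl_n$ be $C^1$ with a continuous extension to $\overline K$, and suppose that $Mf$ is integrable over $K$, so that the volume integrals below make sense. Then for every $y\in K$ all of the following integrals converge absolutely, $$\begin{aligned}f(y)={}&\frac{1}{2^{n-2}\omega_n}\left(\int_{\partial K}P\Big(p(x,y)\frac{n(x)}{x_n^{n-2}}f(x)\Big)d\sigma(x)-\int_K P\big(p(x,y)Mf(x)\big)\frac{dx}{x_n^{n-2}}\right)\\&+\frac{(2y_n)^{n-1}}{\omega_n}\,\frac1{y_n}\left(\int_{\partial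 K}Q\big(q(x,y)n(x)f(x)\big)d\sigma(x)-\int_KQ\big(q(x,y)Mf(x)\big)dx\right)e_n,\end{aligned}$$ and $$\begin{aligned}f(y)={}&\frac{(2y_n)^{n-2}}{\omega_n}\left(\int_{\partial K}E(x,y)n(x)f(x)\,d\sigma(x)-\int_{\partial K}F(x,y)\hat n(x)\hat f(x)\,d\sigma(x)\right)\\&-\frac{(2y_n)^{n-2}}{\omega_n}\int_K\Big(E(x,y)Mf(x)-F(x,y)\widehat{Mf}(x)\Big)dx.\end{aligned}$$ -/

import Mathlib

open MeasureTheory Topology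
open scoped Gradient

noncomputable section

namespace HyperbolicClifford

/-! ### Euclidean space, upper half space and the reflection `x ↦ x̂` -/

/-- Euclidean space `ℝⁿ`. -/
abbrev Vec (n : ℕ) := EuclideanSpace ℝ (Fin n)

/-- The index of the last coordinate `x_n`. -/
def lastIdx (n : ℕ) [NeZero n] : Fin n := ⟨n - 1, Nat.sub_lt (NeZero.pos n) one_pos⟩

/-- The standard basis vector `e_j` of `ℝⁿ`. -/
def basisVec (n : ℕ) (j : Fin n) : Vec n := EuclideanSpace.single j 1

/-- Upper half space `{x : x_n > 0}`. -/
def upperHalfSpace (n : ℕ) [NeZero n] : Set (Vec n) := {x | 0 < x (lastIdx n)}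

/-- The reflection `x̂ = x_1 e_1 + ⋯ + x_{n-1} e_{n-1} - x_n e_n`. -/
def reflect (n : ℕ) [NeZero n] : Vec n →ₗ[ℝ] Vec n where
  toFun x := x - (2 * x (lastIdx n)) • basisVec n (lastIdx n)
  map_add' x y := by
    simp only [PiLp.add_apply, mul_add, add_smul]; abel
  map_smul' c x := by
    simp only [PiLp.smul_apply, smul_eq_mul, RingHom.id_apply, smul_sub, smul_smul]
    congr 2; ring

theorem reflect_apply (n : ℕ) [NeZero n] (x : Vec n) (i : Fin n) :
    reflect n x i = if i = lastIdx n then -x i else x i := by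
  by_cases h : i = lastIdx n
  · subst h; simp [reflect, basisVec]; ring
  · simp [reflect, basisVec, h]

theorem norm_reflect (n : ℕ) [NeZero n] (x : Vec n) : ‖reflect n x‖ = ‖x‖ := by
  rw [EuclideanSpace.norm_eq, EuclideanSpace.norm_eq]
  congr 1
  refine Finset.sum_congr rfl fun i _ => ?_
  rw [reflect_apply]
  split_ifs <;> simp

/-! ### The Clifford algebra `Cl_n` -/

/-- The negative definite quadratic form `x ↦ -‖x‖²`. -/
def negSq (n : ℕ) : QuadraticForm ℝ (Vec n) :=
  -LinearMap.BilinMap.toQuadraticMap (innerₗ (Vec n))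

theorem negSq_apply (n : ℕ) (x : Vec n) : negSq n x = -‖x‖ ^ 2 := by
  simp [negSq]

/-- The real Clifford algebra `Cl_n`, in which `x * x = -‖x‖²` for `x ∈ ℝⁿ`. -/
abbrev Cl (n : ℕ) := CliffordAlgebra (negSq n)

/-- The inclusion `ℝⁿ ⊆ Cl_n`. -/
abbrev vec {n : ℕ} : Vec n →ₗ[ℝ] Cl n := CliffordAlgebra.ι (negSq n)

/-- The generator `e_j` of `Cl_n`. -/
def e (n : ℕ) (j : Fin n) : Cl n := vec (basisVec n j)

/-- The basis of `Cl_n` indexed by subsets `A` of `{1, …, n}`; the element of index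
`A = {α_1 < ⋯ < α_h}` corresponds to `e_{α_1} ∧ ⋯ ∧ e_{α_h}` in the exterior algebra. -/
def clBasis (n : ℕ) : Module.Basis (Finset (Fin n)) ℝ (Cl n) :=
  ((EuclideanSpace.basisFun (Fin n) ℝ).toBasis.ExteriorAlgebra).map
    (CliffordAlgebra.equivExterior (negSq n)).symm

instance (n : ℕ) : FiniteDimensional ℝ (Cl n) := (clBasis n).finiteDimensional_of_finite

/-- Coordinates in `clBasis`. -/
def clCoord (n : ℕ) : Cl n ≃ₗ[ℝ] EuclideanSpace ℝ (Finset (Fin n)) :=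
  (clBasis n).equivFun.trans (WithLp.linearEquiv 2 ℝ (Finset (Fin n) → ℝ)).symm

/-- `Cl_n` is normed by `‖A‖² = ∑ a_A²`. Continuity, differentiability and integrals do not depend
on the choice of a norm, as `Cl_n` has finite dimension. -/
instance (n : ℕ) : NormedAddCommGroup (Cl n) :=
  NormedAddCommGroup.induced (Cl n) (EuclideanSpace ℝ (Finset (Fin n))) (clCoord n)
    (clCoord n).injective

instance (n : ℕ) : NormedSpace ℝ (Cl n) :=
  NormedSpace.induced ℝ (Cl n) (EuclideanSpace ℝ (Finset (Fin n))) (clCoord n)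

/-- The inverse `v⁻¹ = -v / ‖v‖²` in `Cl_n` of a vector `v ≠ 0`. -/
def vecInv {n : ℕ} (v : Vec n) : Cl n := -((‖v‖ ^ 2)⁻¹ • vec v)

theorem vec_mul_vecInv {n : ℕ} {v : Vec n} (hv : v ≠ 0) : vec v * vecInv v = 1 := by
  have h : ‖v‖ ^ 2 ≠ 0 := by simpa using hv
  simp only [vecInv, mul_neg, mul_smul_comm, CliffordAlgebra.ι_sq_scalar, negSq_apply, map_neg,
    smul_neg, neg_neg, Algebra.algebraMap_eq_smul_one, smul_smul, inv_mul_cancel₀ h, one_smul]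

theorem vecInv_mul_vec {n : ℕ} {v : Vec n} (hv : v ≠ 0) : vecInv v * vec v = 1 := by
  rw [← vec_mul_vecInv hv]
  simp only [vecInv, mul_neg, neg_mul, mul_smul_comm, smul_mul_assoc]

theorem negSq_reflect (n : ℕ) [NeZero n] (x : Vec n) : negSq n (reflect n x) = negSq n x := by
  rw [negSq_apply, negSq_apply, norm_reflect]

/-- The automorphism `A ↦ Â` of `Cl_n` with `ê_j = e_j` for `j < n` and `ê_n = -e_n`. -/
def hat {n : ℕ} [NeZero n] : Cl n →ₐ[ℝ] Cl n :=
  CliffordAlgebra.map { reflect n with map_app' := negSq_reflect n }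

theorem hat_vec {n : ℕ} [NeZero n] (x : Vec n) : hat (vec x) = vec (reflect n x) :=
  CliffordAlgebra.map_apply_ι _ _

/-- The subalgebra `Cl_{n-1}` of `Cl_n` generated by `e_1, …, e_{n-1}`. -/
def clSub (n : ℕ) [NeZero n] : Subalgebra ℝ (Cl n) :=
  Algebra.adjoin ℝ {a | ∃ j : Fin n, j ≠ lastIdx n ∧ a = e n j}

/-- The projection `P`: `P A = B` if `A = B + C e_n` with `B, C ∈ Cl_{n-1}`. -/
def P {n : ℕ} [NeZero n] (A : Cl n) : Cl n := (1 / 2 : ℝ) • (A + hat A)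

/-- The projection `Q`: `Q A = C` if `A = B + C e_n` with `B, C ∈ Cl_{n-1}`. -/
def Q {n : ℕ} [NeZero n] (A : Cl n) : Cl n := -((1 / 2 : ℝ) • ((A - hat A) * e n (lastIdx n)))

/-- `Q' A = -e_n (Q A) e_n`. -/
def Q' {n : ℕ} [NeZero n] (A : Cl n) : Cl n := -(e n (lastIdx n) * Q A * e n (lastIdx n))

theorem e_mul_self (n : ℕ) (j : Fin n) : e n j * e n j = -1 := by
  simp [e, basisVec, negSq_apply]

theorem hat_e_last (n : ℕ) [NeZero n] : hat (e n (lastIdx n)) = -e n (lastIdx n) := by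
  rw [e, hat_vec, ← map_neg]
  congr 1
  ext i
  rw [reflect_apply]
  by_cases h : i = lastIdx n <;> simp [h, basisVec]

theorem hat_e_of_ne (n : ℕ) [NeZero n] {j : Fin n} (hj : j ≠ lastIdx n) :
    hat (e n j) = e n j := by
  rw [e, hat_vec]
  congr 1
  ext i
  rw [reflect_apply]
  by_cases h : i = lastIdx n
  · subst h; simp [basisVec, hj.symm]
  · simp [h]

theorem hat_of_mem_clSub {n : ℕ} [NeZero n] {B : Cl n} (hB : B ∈ clSub n) : hat B = B := by
  have h : clSub n ≤ AlgHom.equalizer (hat (n := n)) (AlgHom.id ℝ (Cl n)) := by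
    refine Algebra.adjoin_le ?_
    rintro _ ⟨j, hj, rfl⟩
    exact hat_e_of_ne n hj
  exact h hB

theorem e_mul_e_of_ne (n : ℕ) {i j : Fin n} (h : i ≠ j) : e n i * e n j = -(e n j * e n i) := by
  refine CliffordAlgebra.ι_mul_ι_comm_of_isOrtho ?_
  rw [QuadraticMap.isOrtho_def]
  have : inner ℝ (basisVec n i) (basisVec n j) = (0 : ℝ) := by
    simp [basisVec, EuclideanSpace.inner_single_left, h]
  simp only [negSq_apply]
  rw [norm_add_sq_real, this]; ring

theorem vec_eq_sum {n : ℕ} (v : Vec n) : vec v = ∑ j, v j • e n j := by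
  have h : v = ∑ j, v j • basisVec n j := by
    ext i
    simp [basisVec, Pi.single_apply]
  conv_lhs => rw [h]
  simp [e]

theorem last_comm_clSub {n : ℕ} [NeZero n] {B : Cl n} (hB : B ∈ clSub n) :
    ∃ B' ∈ clSub n, e n (lastIdx n) * B = B' * e n (lastIdx n) := by
  refine Algebra.adjoin_induction (p := fun B _ => ∃ B' ∈ clSub n,
    e n (lastIdx n) * B = B' * e n (lastIdx n)) ?_ ?_ ?_ ?_ hB
  · rintro _ ⟨j, hj, rfl⟩
    refine ⟨-e n j, neg_mem (Algebra.subset_adjoin ⟨j, hj, rfl⟩), ?_⟩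
    rw [e_mul_e_of_ne n hj.symm, neg_mul]
  · intro r
    exact ⟨algebraMap ℝ _ r, Subalgebra.algebraMap_mem _ r, (Algebra.commutes r _).symm⟩
  · rintro x y _ _ ⟨x', hx, hx'⟩ ⟨y', hy, hy'⟩
    exact ⟨x' + y', add_mem hx hy, by rw [mul_add, hx', hy', add_mul]⟩
  · rintro x y _ _ ⟨x', hx, hx'⟩ ⟨y', hy, hy'⟩
    exact ⟨x' * y', mul_mem hx hy, by rw [← mul_assoc, hx', mul_assoc, hy', mul_assoc]⟩

theorem exists_decomp {n : ℕ} [NeZero n] (A : Cl n) :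
    ∃ B ∈ clSub n, ∃ C ∈ clSub n, A = B + C * e n (lastIdx n) := by
  induction A using CliffordAlgebra.left_induction with
  | algebraMap r =>
    exact ⟨_, Subalgebra.algebraMap_mem _ r, 0, zero_mem _, by simp⟩
  | add x y hx hy =>
    obtain ⟨B, hB, C, hC, rfl⟩ := hx
    obtain ⟨B', hB', C', hC', rfl⟩ := hy
    exact ⟨B + B', add_mem hB hB', C + C', add_mem hC hC', by rw [add_mul]; abel⟩
  | ι_mul x m hx =>
    obtain ⟨B, hB, C, hC, rfl⟩ := hx
    have key : ∀ j : Fin n, ∃ B' ∈ clSub n, ∃ C' ∈ clSub n,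
        e n j * (B + C * e n (lastIdx n)) = B' + C' * e n (lastIdx n) := by
      intro j
      by_cases hj : j = lastIdx n
      · subst hj
        obtain ⟨B', hB', h1⟩ := last_comm_clSub hB
        obtain ⟨C', hC', h2⟩ := last_comm_clSub hC
        refine ⟨-C', neg_mem hC', B', hB', ?_⟩
        rw [mul_add, h1, ← mul_assoc, h2, mul_assoc, e_mul_self, mul_neg, mul_one, add_comm]
      · have hm : e n j ∈ clSub n := Algebra.subset_adjoin ⟨j, hj, rfl⟩
        exact ⟨_, mul_mem hm hB, _, mul_mem hm hC, by rw [mul_add, mul_assoc (e n j) C]⟩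
    choose B' hB' C' hC' h using key
    refine ⟨∑ j, m j • B' j, sum_mem fun j _ => Subalgebra.smul_mem _ (hB' j) _,
      ∑ j, m j • C' j, sum_mem fun j _ => Subalgebra.smul_mem _ (hC' j) _, ?_⟩
    change vec m * _ = _
    rw [vec_eq_sum, Finset.sum_mul, Finset.sum_mul, ← Finset.sum_add_distrib]
    refine Finset.sum_congr rfl fun j _ => ?_
    rw [smul_mul_assoc, h, smul_add, smul_mul_assoc]

/-- `P` and `Q` are the components of the decomposition `Cl_n = Cl_{n-1} + Cl_{n-1} e_n`. -/
theorem P_add_Q {n : ℕ} [NeZero n] {B C : Cl n} (hB : B ∈ clSub n) (hC : C ∈ clSub n) :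
    P (B + C * e n (lastIdx n)) = B ∧ Q (B + C * e n (lastIdx n)) = C := by
  constructor
  · rw [P, map_add, map_mul, hat_of_mem_clSub hB, hat_of_mem_clSub hC, hat_e_last, mul_neg]
    rw [show B + C * e n (lastIdx n) + (B + -(C * e n (lastIdx n))) = (2 : ℝ) • B by
      rw [two_smul]; abel, smul_smul]
    norm_num
  · rw [Q, map_add, map_mul, hat_of_mem_clSub hB, hat_of_mem_clSub hC, hat_e_last, mul_neg]
    rw [show B + C * e n (lastIdx n) - (B + -(C * e n (lastIdx n)))
      = (2 : ℝ) • (C * e n (lastIdx n)) by rw [two_smul]; abel, smul_mul_assoc, smul_smul,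
      mul_assoc, e_mul_self]
    norm_num

/-- Every `A ∈ Cl_n` is `B + C e_n` for a unique pair `(B, C) = (P A, Q A)` in `Cl_{n-1}`. -/
theorem P_Q_spec {n : ℕ} [NeZero n] (A : Cl n) :
    P A ∈ clSub n ∧ Q A ∈ clSub n ∧ A = P A + Q A * e n (lastIdx n) := by
  obtain ⟨B, hB, C, hC, rfl⟩ := exists_decomp A
  obtain ⟨h1, h2⟩ := P_add_Q hB hC
  rw [h1, h2]
  exact ⟨hB, hC, rfl⟩

/-! ### Differential operators and kernels -/

/-- The Euclidean Dirac operator `D f = ∑ e_j ∂f/∂x_j`. -/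
def diracD {n : ℕ} (f : Vec n → Cl n) (x : Vec n) : Cl n :=
  ∑ j, e n j * fderiv ℝ f x (basisVec n j)

/-- The Dirac-Hodge operator `M f = D f + ((n - 2) / x_n) Q' f`. -/
def diracHodge {n : ℕ} [NeZero n] (f : Vec n → Cl n) (x : Vec n) : Cl n :=
  diracD f x + (((n : ℝ) - 2) / x (lastIdx n)) • Q' (f x)

/-- `G(x,y) = ∫_{‖x-y‖/‖x-ŷ‖}^1 (1-t²)^{n-2} / t^{n-1} dt`. -/
def G {n : ℕ} [NeZero n] (x y : Vec n) : ℝ :=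
  ∫ t in (‖x - y‖ / ‖x - reflect n y‖)..1, (1 - t ^ 2) ^ (n - 2) / t ^ (n - 1)

/-- `p(x,y) = D G(x,y)`, where `D` acts in `x`. -/
def p {n : ℕ} [NeZero n] (x y : Vec n) : Cl n :=
  diracD (fun z => algebraMap ℝ (Cl n) (G z y)) x

/-- `q(x,y) = (1 / (2(n-2))) D (1 / (‖x-y‖^{n-2} ‖x-ŷ‖^{n-2}))`, where `D` acts in `x`. -/
def q {n : ℕ} [NeZero n] (x y : Vec n) : Cl n :=
  (1 / (2 * ((n : ℝ) - 2))) • diracD (fun z => algebraMap ℝ (Cl n)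
    (1 / (‖z - y‖ ^ (n - 2) * ‖z - reflect n y‖ ^ (n - 2)))) x

/-- `E(x,y) = (x-y)⁻¹ / (‖x-y‖^{n-2} ‖x-ŷ‖^{n-2})`. -/
def E {n : ℕ} [NeZero n] (x y : Vec n) : Cl n :=
  (1 / (‖x - y‖ ^ (n - 2) * ‖x - reflect n y‖ ^ (n - 2))) • vecInv (x - y)

/-- `F(x,y) = (x̂-y)⁻¹ / (‖x-y‖^{n-2} ‖x̂-y‖^{n-2})`. -/
def F {n : ℕ} [NeZero n] (x y : Vec n) : Cl n :=
  (1 / (‖x - y‖ ^ (n - 2) * ‖reflect n x - y‖ ^ (n - 2))) • vecInv (reflect n x - y)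

/-- The surface area `ω_n` of the unit sphere in `ℝⁿ`. -/
def sphereArea (n : ℕ) : ℝ := 2 * Real.pi ^ ((n : ℝ) / 2) / Real.Gamma ((n : ℝ) / 2)

/-! ### Domains with smooth boundary -/

/-- `ρ` is a `C¹` local defining function of `K` at the point `x`: near `x`, `K = {ρ < 0}`, and
`ρ` vanishes at `x` with nonzero gradient. -/
def IsDefiningFunctionAt {n : ℕ} (K : Set (Vec n)) (ρ : Vec n → ℝ) (x : Vec n) : Prop :=
  ContDiffAt ℝ 1 ρ x ∧ ρ x = 0 ∧ ∇ ρ x ≠ 0 ∧ ∀ᶠ z in 𝓝 x, (z ∈ K ↔ ρ z < 0)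

/-- `K` has `C¹` boundary, and lies locally on one side of it. -/
def HasC1Boundary {n : ℕ} (K : Set (Vec n)) : Prop :=
  ∀ x ∈ frontier K, ∃ ρ, IsDefiningFunctionAt K ρ x

open Classical in
/-- The outer unit normal `∇ρ(x) / ‖∇ρ(x)‖` of `K` at a boundary point `x`, where `ρ` is a local
defining function of `K` at `x`. -/
def outerNormal {n : ℕ} (K : Set (Vec n)) (x : Vec n) : Vec n :=
  if h : ∃ ρ, IsDefiningFunctionAt K ρ x then ‖∇ h.choose x‖⁻¹ • ∇ h.choose x else 0

/-- The Lebesgue surface measure `σ` of the boundary of `K ⊆ ℝⁿ`: the `(n-1)`-dimensional Hausdorff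
measure, normalised so as to agree with Lebesgue measure on hyperplanes. -/
def surfaceMeasure {n : ℕ} (K : Set (Vec n)) : Measure (Vec n) := μHE[n - 1].restrict (frontier K)

theorem eventually_pos_of_inner_pos {n : ℕ} {ρ : Vec n → ℝ} {x v : Vec n}
    (hd : DifferentiableAt ℝ ρ x) (h0 : ρ x = 0) (hv : 0 < inner ℝ (∇ ρ x) v) :
    ∀ᶠ t : ℝ in 𝓝[>] 0, 0 < ρ (x + t • v) := by
  have h1 : HasDerivAt (fun t : ℝ => ρ (x + t • v)) (inner ℝ (∇ ρ x) v) 0 := by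
    have hg := hd.hasGradientAt.hasFDerivAt
    have hl : HasDerivAt (fun t : ℝ => x + t • v) v 0 := by
      simpa using ((hasDerivAt_id (0 : ℝ)).smul_const v).const_add x
    have hg' : HasFDerivAt ρ (InnerProductSpace.toDual ℝ (Vec n) (∇ ρ x)) (x + (0 : ℝ) • v) := by
      simpa using hg
    have h := hg'.comp_hasDerivAt (0 : ℝ) hl
    rwa [InnerProductSpace.toDual_apply_apply] at h
  have h2 := (hasDerivAt_iff_tendsto_slope.1 h1).eventually (lt_mem_nhds hv)
  have h3 : ∀ᶠ t : ℝ in 𝓝[>] 0, 0 < slope (fun t : ℝ => ρ (x + t • v)) 0 t :=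
    h2.filter_mono (nhdsWithin_mono _ fun t ht => ne_of_gt ht)
  filter_upwards [h3, self_mem_nhdsWithin] with t ht ht0
  have ht0' : (0 : ℝ) < t := ht0
  rw [slope_def_field] at ht
  simp only [zero_smul, add_zero, h0, sub_zero] at ht
  exact (div_pos_iff_of_pos_right ht0').1 ht

/-- The outer unit normal does not depend on the choice of a defining function. -/
theorem outerNormal_eq {n : ℕ} {K : Set (Vec n)} {ρ : Vec n → ℝ} {x : Vec n}
    (hρ : IsDefiningFunctionAt K ρ x) : outerNormal K x = ‖∇ ρ x‖⁻¹ • ∇ ρ x := by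
  have h : ∃ ρ, IsDefiningFunctionAt K ρ x := ⟨ρ, hρ⟩
  rw [outerNormal, dif_pos h]
  set η := h.choose
  have hη : IsDefiningFunctionAt K η x := h.choose_spec
  by_contra hne
  set a := ‖∇ η x‖⁻¹ • ∇ η x with ha
  set b := ‖∇ ρ x‖⁻¹ • ∇ ρ x with hb
  have hη0 : 0 < ‖∇ η x‖ := norm_pos_iff.2 hη.2.2.1
  have hρ0 : 0 < ‖∇ ρ x‖ := norm_pos_iff.2 hρ.2.2.1
  have na : ‖a‖ = 1 := by rw [ha, norm_smul, norm_inv, norm_norm, inv_mul_cancel₀ hη0.ne']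
  have nb : ‖b‖ = 1 := by rw [hb, norm_smul, norm_inv, norm_norm, inv_mul_cancel₀ hρ0.ne']
  have hlt : inner ℝ a b < (1 : ℝ) := (inner_lt_one_iff_real_of_norm_eq_one na nb).2 hne
  have ea : ∇ η x = ‖∇ η x‖ • a := by rw [ha, smul_smul, mul_inv_cancel₀ hη0.ne', one_smul]
  have eb : ∇ ρ x = ‖∇ ρ x‖ • b := by rw [hb, smul_smul, mul_inv_cancel₀ hρ0.ne', one_smul]
  have h1 : 0 < inner ℝ (∇ ρ x) (b - a) := by
    rw [eb, real_inner_smul_left, inner_sub_right, real_inner_self_eq_norm_sq, nb,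
      real_inner_comm a b]
    exact mul_pos hρ0 (by linarith)
  have hneg : ∇ (fun z => -η z) x = -∇ η x := by
    rw [gradient, gradient, fderiv_fun_neg, map_neg]
  have h2 : 0 < inner ℝ (∇ (fun z => -η z) x) (b - a) := by
    rw [hneg, ea, inner_neg_left, real_inner_smul_left, inner_sub_right,
      real_inner_self_eq_norm_sq, na]
    nlinarith
  have e1 := eventually_pos_of_inner_pos (hρ.1.differentiableAt one_ne_zero) hρ.2.1 h1
  have e2 := eventually_pos_of_inner_pos (hη.1.differentiableAt one_ne_zero).fun_neg
    (by simp [hη.2.1]) h2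
  have hc : Filter.Tendsto (fun t : ℝ => x + t • (b - a)) (𝓝[>] 0) (𝓝 x) := by
    have : Continuous fun t : ℝ => x + t • (b - a) := by fun_prop
    simpa using (this.tendsto 0).mono_left nhdsWithin_le_nhds
  obtain ⟨t, t1, t2, t3, t4⟩ :=
    (e1.and (e2.and ((hc.eventually hρ.2.2.2).and (hc.eventually hη.2.2.2)))).exists
  have : x + t • (b - a) ∈ K := t4.2 (by linarith)
  linarith [t3.1 this]

end HyperbolicClifford

end

open HyperbolicClifford

noncomputable section

open MeasureTheory Topology Set Filter
open scoped Gradient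

set_option linter.unusedSectionVars false

/-! The two formulas are one identity read in different coordinates, and that identity is the
divergence theorem applied to a field with a point singularity at `y`.

Write A = x - y and B = x - ŷ. The field `cauchyField y f` sends v to E v f - F v̂ f̂, so its flux
through ∂K is the boundary integrand. Its divergence is E Mf - F (Mf)^, by two algebraic facts.
Differentiating E from the right leaves only (n-2) A B / (‖A‖^n ‖B‖^n) (`rightDirac_E`), because A /
‖A‖^n is killed by the right Dirac operator. On the other side, (E - F) e_n equals -2 x_n A B /
(‖A‖^n ‖B‖^n) (`E_sub_F_mul`). Hence the zeroth order term with 1 / x_n in M is exactly what absorbs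
the derivatives of the kernels (`divergence_cauchyField`).

The singularity is removed by a smooth radial cutoff at scale 1/c instead of an excised ball. The
product rule then gives one extra volume term, the field evaluated on the gradient of the cutoff.
That term is ω_n times an approximate identity acting on a function continuous at `y` with value
f(y) / (2 y_n)^(n-2) there (`cauchyField_gradient_cutoff`, `cauchyDensity_self`). Letting c tend to
infinity gives `borel_pompeiu`, which is the formula with E and F.

For the other formula, p is (4 x_n y_n)^(n-2) times E(x,y) - E(x,ŷ), and q is half of E(x,y) +
E(x,ŷ) (`p_eq`, `q_eq`). Moreover F(x,y) is the conjugate of E(x,ŷ), and a difference S - T̂ has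
components P(S - T) and Q(S + T) (`sub_hat_eq_P_add_Q`).

The divergence theorem itself is proved for C¹ boundaries, for fields that are C¹ inside, continuous
up to the boundary and of integrable divergence. It avoids the area formula. In charts whose graphs
have slope at most δ over planes nearly orthogonal to the normal, the flux through the graph differs
from the integral against Hausdorff measure by at most a factor vanishing with δ, times the surface
integral of ‖Φ‖. With a nonnegative partition of unity these errors add up to the same factor times
the full integral of ‖Φ‖, whatever the number of charts. Then δ tends to 0. -/

namespace HyperbolicClifford

/-! ### Divergence of a field of linear maps, and coordinates adapted to a graph -/

section Divergence

variable {E W X : Type*}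
  [NormedAddCommGroup E] [InnerProductSpace ℝ E] [FiniteDimensional ℝ E]
  [NormedAddCommGroup W] [InnerProductSpace ℝ W] [FiniteDimensional ℝ W]
  [NormedAddCommGroup X] [NormedSpace ℝ X]

/-- The divergence of a field of linear maps `E → X`, i.e. of an `X`-valued vector field. -/
def divergence (Φ : E → E →L[ℝ] X) (x : E) : X :=
  ∑ i, fderiv ℝ Φ x (stdOrthonormalBasis ℝ E i) (stdOrthonormalBasis ℝ E i)

/-- The trace of a bilinear map is basis free: expand each b i in b' and use Parseval in b. This
allows the divergence to be computed in a frame adapted to a chart and, later, in the standard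
basis. -/
theorem sum_bilin_orthonormalBasis {ι κ : Type*} [Fintype ι] [Fintype κ]
    (b : OrthonormalBasis ι ℝ E) (b' : OrthonormalBasis κ ℝ E) (B : E →ₗ[ℝ] E →ₗ[ℝ] X) :
    ∑ i, B (b i) (b i) = ∑ j, B (b' j) (b' j) := by
  have h1 : ∀ i, B (b i) (b i) =
      ∑ j, ∑ l, (inner ℝ (b' j) (b i) * inner ℝ (b i) (b' l)) • B (b' j) (b' l) := by
    intro i
    conv_lhs => rw [← b'.sum_repr' (b i)]
    simp only [map_sum, map_smul, LinearMap.sum_apply, LinearMap.smul_apply, Finset.smul_sum,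
      smul_smul]
    rw [Finset.sum_comm]
    refine Finset.sum_congr rfl fun j _ => Finset.sum_congr rfl fun l _ => ?_
    rw [real_inner_comm (b' l) (b i), mul_comm]
  simp only [h1]
  rw [Finset.sum_comm]
  refine Finset.sum_congr rfl fun j _ => ?_
  rw [Finset.sum_comm]
  simp only [← Finset.sum_smul, b.sum_inner_mul_inner]
  classical
  simp [orthonormal_iff_ite.1 b'.orthonormal]

theorem divergence_eq_sum {ι : Type*} [Fintype ι] (b : OrthonormalBasis ι ℝ E)
    (Φ : E → E →L[ℝ] X) (x : E) : divergence Φ x = ∑ i, fderiv ℝ Φ x (b i) (b i) :=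
  sum_bilin_orthonormalBasis (stdOrthonormalBasis ℝ E) b
    ((ContinuousLinearMap.coeLM ℝ).comp (fderiv ℝ Φ x).toLinearMap)

theorem divergence_of_notMem_tsupport {Φ : E → E →L[ℝ] X} {x : E} (hx : x ∉ tsupport Φ) :
    divergence Φ x = 0 := by
  have : fderiv ℝ Φ x = 0 := by
    have h := (notMem_tsupport_iff_eventuallyEq.1 hx).fderiv_eq (𝕜 := ℝ)
    rw [h]; simp
  simp [divergence, this]

/-- Integration by parts against the constant function 1. -/
theorem integral_fderiv_eq_zero [MeasurableSpace E] [BorelSpace E] {g : E → X}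
    (hg : ContDiff ℝ 1 g) (hc : HasCompactSupport g) (v : E) :
    ∫ x, fderiv ℝ g x v = 0 := by
  have hi : Integrable (fun x => fderiv ℝ g x v) :=
    ((hg.continuous_fderiv one_ne_zero).clm_apply continuous_const).integrable_of_hasCompactSupport
      (hc.fderiv_apply ℝ v)
  have := integral_smul_fderiv_eq_neg_fderiv_smul_of_integrable (μ := (volume : Measure E))
    (f := fun _ => (1 : ℝ)) (g := g) (v := v)
    (by simp) (by simpa using hi)
    (by simpa using hg.continuous.integrable_of_hasCompactSupport hc)
    (by intros; fun_prop) (fun x _ => hg.differentiable one_ne_zero x)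
  simpa using this

/-- The region below the graph of `h`, in the coordinates given by `c`. -/
def subgraph (c : WithLp 2 (W × ℝ) ≃ₗᵢ[ℝ] E) (h : W → ℝ) : Set E :=
  {z | (c.symm z).snd < h (c.symm z).fst}

/-- The coordinate `(x, t)` of depth `t` below the graph of `h`. -/
def graphShear (c : WithLp 2 (W × ℝ) ≃ₗᵢ[ℝ] E) (h : W → ℝ) (hh : Continuous h) : W × ℝ ≃ₜ E where
  toFun q := c (WithLp.toLp 2 (q.1, h q.1 - q.2))
  invFun z := ((c.symm z).fst, h (c.symm z).fst - (c.symm z).snd)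
  left_inv q := by simp
  right_inv z := by
    simp only [sub_sub_cancel]
    exact c.apply_symm_apply z
  continuous_toFun := by fun_prop
  continuous_invFun := by fun_prop

theorem graphShear_apply (c : WithLp 2 (W × ℝ) ≃ₗᵢ[ℝ] E) (h : W → ℝ) (hh : Continuous h)
    (q : W × ℝ) : graphShear c h hh q = c (WithLp.toLp 2 (q.1, h q.1 - q.2)) := rfl

/-- On each vertical line the map is t ↦ h x - t, which preserves length; Fubini does the rest, so
no Jacobian and no differentiability of h are needed. -/
theorem measurePreserving_graphShear [MeasurableSpace E] [BorelSpace E] [MeasurableSpace W]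
    [BorelSpace W] (c : WithLp 2 (W × ℝ) ≃ₗᵢ[ℝ] E) (h : W → ℝ) (hh : Continuous h) :
    MeasurePreserving (graphShear c h hh) := by
  refine c.measurePreserving.comp ((WithLp.volume_preserving_toLp W ℝ).comp ?_)
  refine (MeasurePreserving.id volume).skew_product (g := fun x t => h x - t) ?_ ?_
  · exact Continuous.measurable (by fun_prop)
  · exact Eventually.of_forall fun x => (Measure.measurePreserving_sub_left volume (h x)).map_eq

theorem graphShear_mem_subgraph (c : WithLp 2 (W × ℝ) ≃ₗᵢ[ℝ] E) (h : W → ℝ) (hh : Continuous h)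
    (q : W × ℝ) : graphShear c h hh q ∈ subgraph c h ↔ 0 < q.2 := by
  simp [subgraph, graphShear_apply]


/-- The direction vector `(-∇h, 1)` normal to the graph of `h`. -/
def graphNormal (c : WithLp 2 (W × ℝ) ≃ₗᵢ[ℝ] E) (h : W → ℝ) (x : W) : E :=
  c (WithLp.toLp 2 (-∇ h x, 1))

theorem continuous_graphNormal (c : WithLp 2 (W × ℝ) ≃ₗᵢ[ℝ] E) {h : W → ℝ}
    (hh : ContDiff ℝ 1 h) : Continuous (graphNormal c h) := by
  have : Continuous (∇ h) :=
    (InnerProductSpace.toDual ℝ W).symm.continuous.comp (hh.continuous_fderiv one_ne_zero)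
  unfold graphNormal
  fun_prop

theorem hasFDerivAt_graphShear_fst (c : WithLp 2 (W × ℝ) ≃ₗᵢ[ℝ] E) {h : W → ℝ}
    (hh : ContDiff ℝ 1 h) (x : W) (t : ℝ) :
    HasFDerivAt (fun x => graphShear c h hh.continuous (x, t))
      ((c.toContinuousLinearEquiv : WithLp 2 (W × ℝ) →L[ℝ] E) ∘L
        ((WithLp.prodContinuousLinearEquiv 2 ℝ W ℝ).symm : W × ℝ →L[ℝ] WithLp 2 (W × ℝ)) ∘L
        ((ContinuousLinearMap.id ℝ W).prod (fderiv ℝ h x))) x := by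
  have h1 : HasFDerivAt (fun x => (x, h x - t))
      ((ContinuousLinearMap.id ℝ W).prod (fderiv ℝ h x)) x :=
    (hasFDerivAt_id x).prodMk
      ((hh.differentiable one_ne_zero x).hasFDerivAt.sub_const t)
  exact (((c.toContinuousLinearEquiv : WithLp 2 (W × ℝ) →L[ℝ] E) ∘L
        ((WithLp.prodContinuousLinearEquiv 2 ℝ W ℝ).symm :
          W × ℝ →L[ℝ] WithLp 2 (W × ℝ))).hasFDerivAt (x := (x, h x - t))).comp x h1

theorem hasDerivAt_graphShear_snd (c : WithLp 2 (W × ℝ) ≃ₗᵢ[ℝ] E) {h : W → ℝ}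
    (hh : Continuous h) (x : W) (t : ℝ) :
    HasDerivAt (fun t => graphShear c h hh (x, t)) (-c (WithLp.toLp 2 (0, 1))) t := by
  have h1 : HasDerivAt (fun t : ℝ => (x, h x - t)) ((0, -1) : W × ℝ) t :=
    (hasDerivAt_const t x).prodMk (by simpa using (hasDerivAt_id t).const_sub (h x))
  have h2 := ((((c.toContinuousLinearEquiv : WithLp 2 (W × ℝ) →L[ℝ] E) ∘L
        ((WithLp.prodContinuousLinearEquiv 2 ℝ W ℝ).symm :
          W × ℝ →L[ℝ] WithLp 2 (W × ℝ))).hasFDerivAt (x := (x, h x - t))).comp_hasDerivAt t h1)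
  refine HasDerivAt.congr_deriv (f := fun t => graphShear c h hh (x, t)) h2 ?_
  rw [← map_neg]
  change c _ = c _
  congr 1
  exact WithLp.ofLp_injective 2 (Prod.ext (by simp) (by simp))

/-- Moving x at fixed depth t also moves the height by the derivative of h, so each tangential
derivative of the composite exceeds the diagonal term of the divergence by a multiple of the
vertical derivative of Φ. Collecting these excesses turns the vertical vector w into w minus the
gradient of h, which is `graphNormal`. The first sum integrates to zero in x, and the last term is a
pure t-derivative because the normal does not depend on t. The normal is never differentiated, so h
need only be C¹. -/
theorem divergence_graphShear (c : WithLp 2 (W × ℝ) ≃ₗᵢ[ℝ] E) {h : W → ℝ}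
    (hh : ContDiff ℝ 1 h) {Φ : E → E →L[ℝ] X} {x : W} {t : ℝ}
    (hΦ : DifferentiableAt ℝ Φ (graphShear c h hh.continuous (x, t))) :
    divergence Φ (graphShear c h hh.continuous (x, t)) =
      ∑ i, fderiv ℝ (fun x' => Φ (graphShear c h hh.continuous (x', t))
          (c (WithLp.toLp 2 (stdOrthonormalBasis ℝ W i, 0)))) x (stdOrthonormalBasis ℝ W i) +
        fderiv ℝ Φ (graphShear c h hh.continuous (x, t)) (c (WithLp.toLp 2 (0, 1)))
          (graphNormal c h x) := by
  set b := stdOrthonormalBasis ℝ W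
  set D := fderiv ℝ Φ (graphShear c h hh.continuous (x, t))
  set w := c (WithLp.toLp 2 ((0 : W), (1 : ℝ))) with hw
  set T : W → E := fun v => c (WithLp.toLp 2 (v, 0)) with hT
  have hTb : ∀ i, fderiv ℝ (fun x' => Φ (graphShear c h hh.continuous (x', t)) (T (b i))) x (b i) =
      D (T (b i)) (T (b i)) + fderiv ℝ h x (b i) • D w (T (b i)) := by
    intro i
    have h1 := (hΦ.hasFDerivAt.comp x (hasFDerivAt_graphShear_fst c hh x t)).clm_apply
      (hasFDerivAt_const (T (b i)) x)
    have h2 := h1.fderiv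
    have h3 : c (WithLp.toLp 2 (b i, fderiv ℝ h x (b i))) = T (b i) + fderiv ℝ h x (b i) • w := by
      rw [hT, hw, ← map_smul, ← map_add]
      congr 1
      exact WithLp.ofLp_injective 2 (Prod.ext (by simp) (by simp))
    change fderiv ℝ (fun x' => Φ (graphShear c h hh.continuous (x', t)) (T (b i))) x = _ at h2
    rw [h2]
    simp only [add_apply, ContinuousLinearMap.comp_apply,
      ContinuousLinearMap.flip_apply, zero_apply, map_zero, zero_add]
    change D (c (WithLp.toLp 2 (b i, fderiv ℝ h x (b i)))) (T (b i)) = _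
    rw [h3, map_add, map_smul]
    simp
  rw [divergence_eq_sum ((b.prod (OrthonormalBasis.singleton Unit ℝ)).map c), Fintype.sum_sum_type]
  have hN : graphNormal c h x = w - ∑ i, fderiv ℝ h x (b i) • T (b i) := by
    have h4 : ∑ i, fderiv ℝ h x (b i) • T (b i) = T (∇ h x) := by
      have h5 : ∇ h x = ∑ i, fderiv ℝ h x (b i) • b i := by
        rw [← b.sum_repr' (∇ h x)]
        refine Finset.sum_congr rfl fun i _ => ?_
        rw [real_inner_comm, gradient, InnerProductSpace.toDual_symm_apply]
      let T' : W →ₗ[ℝ] E := c.toLinearEquiv.toLinearMap ∘ₗ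
        (WithLp.linearEquiv 2 ℝ (W × ℝ)).symm.toLinearMap ∘ₗ LinearMap.inl ℝ W ℝ
      have hT' : ∀ v, T v = T' v := fun v => rfl
      rw [h5]
      simp [hT', map_sum]
    rw [h4, hw, hT, graphNormal, ← map_sub]
    congr 1
    exact WithLp.ofLp_injective 2 (Prod.ext (by simp) (by simp))
  change _ = ∑ i, fderiv ℝ (fun x' => Φ (graphShear c h hh.continuous (x', t)) (T (b i))) x (b i) +
    D w (graphNormal c h x)
  rw [Finset.sum_congr rfl fun i _ => hTb i, Finset.sum_add_distrib, hN]
  simp only [map_sub, map_sum, map_smul]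
  simp only [OrthonormalBasis.map_apply, OrthonormalBasis.prod_apply, Sum.elim_inl, Sum.elim_inr,
    Function.comp_apply, LinearMap.inl_apply, LinearMap.inr_apply, Finset.univ_unique,
    OrthonormalBasis.singleton_apply, Finset.sum_const, Finset.card_singleton, one_smul]
  change (∑ i, D (T (b i)) (T (b i))) + D w w = _
  abel

end Divergence

/-! ### The divergence theorem below a graph -/

section SubgraphIntegral

variable {E W X : Type*}
  [NormedAddCommGroup E] [InnerProductSpace ℝ E] [FiniteDimensional ℝ E]
  [MeasurableSpace E] [BorelSpace E]
  [NormedAddCommGroup W] [InnerProductSpace ℝ W] [FiniteDimensional ℝ W]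
  [MeasurableSpace W] [BorelSpace W]
  [NormedAddCommGroup X] [NormedSpace ℝ X]

theorem isOpen_subgraph (c : WithLp 2 (W × ℝ) ≃ₗᵢ[ℝ] E) {h : W → ℝ} (hh : Continuous h) :
    IsOpen (subgraph c h) := by
  refine isOpen_lt ?_ ?_
  · exact (by fun_prop : Continuous fun z : WithLp 2 (W × ℝ) => z.snd).comp c.symm.continuous
  · exact hh.comp
      ((by fun_prop : Continuous fun z : WithLp 2 (W × ℝ) => z.fst).comp c.symm.continuous)

theorem contDiff_graphShear_fst (c : WithLp 2 (W × ℝ) ≃ₗᵢ[ℝ] E) {h : W → ℝ}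
    (hh : ContDiff ℝ 1 h) (t : ℝ) :
    ContDiff ℝ 1 (fun x => graphShear c h hh.continuous (x, t)) := by
  have h1 : ContDiff ℝ 1 (fun x => (x, h x - t)) := by fun_prop
  exact (((c.toContinuousLinearEquiv : WithLp 2 (W × ℝ) →L[ℝ] E) ∘L
        ((WithLp.prodContinuousLinearEquiv 2 ℝ W ℝ).symm :
          W × ℝ →L[ℝ] WithLp 2 (W × ℝ))).contDiff).comp h1

theorem hasDerivAt_neg_comp_graphShear (c : WithLp 2 (W × ℝ) ≃ₗᵢ[ℝ] E) {h : W → ℝ}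
    (hh : Continuous h) {Φ : E → E →L[ℝ] X} {x : W} {t : ℝ}
    (hΦ : DifferentiableAt ℝ Φ (graphShear c h hh (x, t))) (v : E) :
    HasDerivAt (fun t => -(Φ (graphShear c h hh (x, t)) v))
      (fderiv ℝ Φ (graphShear c h hh (x, t)) (c (WithLp.toLp 2 (0, 1))) v) t := by
  have h0 : HasDerivAt (fun t => Φ (graphShear c h hh (x, t))) _ t :=
    hΦ.hasFDerivAt.comp_hasDerivAt t (hasDerivAt_graphShear_snd c hh x t)
  have h1 := (((ContinuousLinearMap.apply ℝ X v).hasFDerivAt.comp_hasDerivAt t h0)).fun_neg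
  refine h1.congr_deriv ?_
  rw [map_neg, ContinuousLinearMap.apply_apply, neg_apply, neg_neg]

/-- The divergence theorem above depth `ε > 0` below the graph of `h`. -/
theorem integral_divergence_graphShear_Ioi [CompleteSpace X]
    (c : WithLp 2 (W × ℝ) ≃ₗᵢ[ℝ] E) {h : W → ℝ}
    (hh : ContDiff ℝ 1 h) {Φ : E → E →L[ℝ] X} (hcpt : HasCompactSupport Φ)
    (hd : ContDiffOn ℝ 1 Φ (subgraph c h)) {ε : ℝ} (hε : 0 < ε)
    (hi : IntegrableOn (fun q => divergence Φ (graphShear c h hh.continuous q))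
      (univ ×ˢ Ioi ε)) :
    ∫ q in univ ×ˢ Ioi ε, divergence Φ (graphShear c h hh.continuous q) =
      ∫ x : W, Φ (graphShear c h hh.continuous (x, ε)) (graphNormal c h x) := by
  set S := graphShear c h hh.continuous with hS
  set K' := S ⁻¹' tsupport Φ with hK'
  have hK'c : IsCompact K' := S.isCompact_preimage.2 hcpt
  have hopen := isOpen_subgraph c hh.continuous
  have hCD : ∀ q : W × ℝ, 0 < q.2 → ContDiffAt ℝ 1 Φ (S q) := fun q hq =>
    hd.contDiffAt (hopen.mem_nhds ((graphShear_mem_subgraph c h _ q).2 hq))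
  have hdiff : ∀ q : W × ℝ, 0 < q.2 → DifferentiableAt ℝ Φ (S q) := fun q hq =>
    (hCD q hq).differentiableAt one_ne_zero
  set w := c (WithLp.toLp 2 ((0 : W), (1 : ℝ))) with hw
  set u2 : W × ℝ → X := fun q => fderiv ℝ Φ (S q) w (graphNormal c h q.1) with hu2
  have hΦ0 : ∀ q, q ∉ K' → Φ (S q) = 0 := fun q hq => image_eq_zero_of_notMem_tsupport hq
  have hD0 : ∀ q, q ∉ K' → fderiv ℝ Φ (S q) = 0 := fun q hq => by
    have h := (notMem_tsupport_iff_eventuallyEq.1 (show S q ∉ tsupport Φ from hq)).fderiv_eq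
      (𝕜 := ℝ)
    rw [h]; simp
  have hu20 : ∀ q, q ∉ K' → u2 q = 0 := fun q hq => by simp [hu2, hD0 q hq]
  have hu2c : ContinuousOn u2 {q | 0 < q.2} := by
    have h1 : ContinuousOn (fun q => fderiv ℝ Φ (S q)) {q | 0 < q.2} :=
      (hd.continuousOn_fderiv_of_isOpen hopen le_rfl).comp S.continuous.continuousOn
        fun q hq => (graphShear_mem_subgraph c h _ q).2 hq
    exact (h1.clm_apply continuousOn_const).clm_apply
      ((continuous_graphNormal c hh).comp continuous_fst).continuousOn
  have hclosed : IsClosed {q : W × ℝ | ε ≤ q.2} := isClosed_le continuous_const continuous_snd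
  -- Positive depth matters here: the derivative of Φ is continuous inside but uncontrolled at the
  -- graph, so at ε = 0 only the full divergence is known to be integrable, not its two parts.
  have hu2i : IntegrableOn u2 (univ ×ˢ Ioi ε) := by
    have h1 : IntegrableOn u2 (K' ∩ {q | ε ≤ q.2}) :=
      (hu2c.mono fun q hq => hε.trans_le hq.2).integrableOn_compact (hK'c.inter_right hclosed)
    refine h1.of_forall_sdiff_eq_zero (MeasurableSet.univ.prod measurableSet_Ioi) ?_
    rintro q ⟨hq1, hq2⟩
    exact hu20 q fun hq => hq2 ⟨hq, le_of_lt (mem_Ioi.1 hq1.2)⟩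
  have hslice : ∀ x, ∫ t in Ioi ε, u2 (x, t) = Φ (S (x, ε)) (graphNormal c h x) := by
    intro x
    have hcs : HasCompactSupport fun t => Φ (S (x, t)) (graphNormal c h x) := by
      refine HasCompactSupport.intro (hK'c.image continuous_snd) fun t ht => ?_
      rw [hΦ0 (x, t) fun hq => ht ⟨_, hq, rfl⟩]; simp
    have hder : ∀ t ∈ Ici ε, HasDerivAt (fun t => -(Φ (S (x, t)) (graphNormal c h x)))
        (u2 (x, t)) t := by
      intro t ht
      exact hasDerivAt_neg_comp_graphShear c hh.continuous (hdiff (x, t) (hε.trans_le ht)) _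
    have hint : IntegrableOn (fun t => u2 (x, t)) (Ioi ε) := by
      have hc1 : IsCompact (Prod.snd '' K' ∩ Ici ε) :=
        (hK'c.image continuous_snd).inter_right isClosed_Ici
      have h1 : IntegrableOn (fun t => u2 (x, t)) (Prod.snd '' K' ∩ Ici ε) := by
        refine ContinuousOn.integrableOn_compact hc1 ?_
        exact hu2c.comp (by fun_prop) fun t ht => hε.trans_le ht.2
      refine h1.of_forall_sdiff_eq_zero measurableSet_Ioi ?_
      rintro t ⟨ht1, ht2⟩
      exact hu20 _ fun hq => ht2 ⟨⟨_, hq, rfl⟩, le_of_lt (mem_Ioi.1 ht1)⟩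
    have htend : Tendsto (fun t => -(Φ (S (x, t)) (graphNormal c h x))) atTop (𝓝 0) := by
      rw [hasCompactSupport_iff_eventuallyEq, Filter.coclosedCompact_eq_cocompact] at hcs
      have h5 : Tendsto (fun t => Φ (S (x, t)) (graphNormal c h x)) atTop (𝓝 0) :=
        (hcs.filter_mono atTop_le_cocompact).tendsto
      simpa only [neg_zero] using h5.neg
    rw [integral_Ioi_of_hasDerivAt_of_tendsto' hder hint htend]
    simp
  have hu1 : ∀ t, 0 < t → ∫ x, (divergence Φ (S (x, t)) - u2 (x, t)) = 0 := by
    intro t ht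
    have h1 : ∀ v : E, ContDiff ℝ 1 (fun x => Φ (S (x, t)) v) := fun v =>
      contDiff_iff_contDiffAt.2 fun x => ((hCD (x, t) ht).comp x
        (contDiff_graphShear_fst c hh t).contDiffAt).clm_apply contDiffAt_const
    have h2 : ∀ v : E, HasCompactSupport (fun x => Φ (S (x, t)) v) := fun v => by
      refine HasCompactSupport.intro (hK'c.image continuous_fst) fun x hx => ?_
      rw [hΦ0 (x, t) fun hq => hx ⟨_, hq, rfl⟩]; simp
    have h3 : ∀ x, divergence Φ (S (x, t)) - u2 (x, t) =
        ∑ i, fderiv ℝ (fun x' => Φ (S (x', t))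
          (c (WithLp.toLp 2 (stdOrthonormalBasis ℝ W i, 0)))) x (stdOrthonormalBasis ℝ W i) := by
      intro x
      rw [sub_eq_iff_eq_add]
      exact divergence_graphShear c hh (hdiff (x, t) ht)
    simp_rw [h3]
    rw [integral_finsetSum]
    · exact Finset.sum_eq_zero fun i _ => integral_fderiv_eq_zero (h1 _) (h2 _) _
    · intro i _
      exact (((h1 _).continuous_fderiv one_ne_zero).clm_apply
        continuous_const).integrable_of_hasCompactSupport ((h2 _).fderiv_apply ℝ _)
  have hv : IntegrableOn (fun q => divergence Φ (S q) - u2 q) (univ ×ˢ Ioi ε) := hi.sub hu2i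
  -- Fubini with x inside for the tangential part, and with t inside for `u2` below.
  have e1 : ∫ q in univ ×ˢ Ioi ε, (divergence Φ (S q) - u2 q) = 0 := by
    rw [Measure.volume_eq_prod, ← setIntegral_prod_swap, setIntegral_prod]
    · refine (setIntegral_congr_fun (g := fun _ => (0 : X)) measurableSet_Ioi fun t ht => ?_).trans
        (by simp)
      simp only [Prod.swap_prod_mk, setIntegral_univ]
      exact hu1 t (hε.trans ht)
    · exact hv.swap
  have e2 : ∫ q in univ ×ˢ Ioi ε, u2 q =
      ∫ x : W, Φ (S (x, ε)) (graphNormal c h x) := by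
    rw [Measure.volume_eq_prod, setIntegral_prod _ hu2i, setIntegral_univ]
    exact integral_congr_ae (Eventually.of_forall hslice)
  rw [integral_sub hi hu2i, sub_eq_zero] at e1
  rw [e1, e2]

/-- The divergence theorem on the region below the graph of a `C¹` function. -/
theorem integral_divergence_subgraph [CompleteSpace X]
    (c : WithLp 2 (W × ℝ) ≃ₗᵢ[ℝ] E) {h : W → ℝ}
    (hh : ContDiff ℝ 1 h) {Φ : E → E →L[ℝ] X} (hcpt : HasCompactSupport Φ)
    (hd : ContDiffOn ℝ 1 Φ (subgraph c h))
    (hc : ContinuousOn Φ {z | (c.symm z).snd ≤ h (c.symm z).fst})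
    (hi : IntegrableOn (divergence Φ) (subgraph c h)) :
    ∫ z in subgraph c h, divergence Φ z =
      ∫ x : W, Φ (c (WithLp.toLp 2 (x, h x))) (graphNormal c h x) := by
  set S := graphShear c h hh.continuous with hS
  have hmp : MeasurePreserving S := measurePreserving_graphShear c h hh.continuous
  have hpre : S ⁻¹' subgraph c h = univ ×ˢ Ioi 0 := by
    ext q
    simpa using graphShear_mem_subgraph c h hh.continuous q
  have hi' : IntegrableOn (fun q => divergence Φ (S q)) (univ ×ˢ Ioi 0) := by
    rw [← hpre]
    exact (hmp.integrableOn_comp_preimage S.measurableEmbedding).2 hi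
  have hK'c : IsCompact (S ⁻¹' tsupport Φ) := S.isCompact_preimage.2 hcpt
  set KW := Prod.fst '' (S ⁻¹' tsupport Φ) with hKW
  have hKWc : IsCompact KW := hK'c.image continuous_fst
  have hlim1 : Tendsto (fun ε : ℝ => ∫ q in univ ×ˢ Ioi ε, divergence Φ (S q)) (𝓝[>] 0)
      (𝓝 (∫ q in univ ×ˢ Ioi 0, divergence Φ (S q))) := by
    have hcov : AECover (volume.restrict ((univ : Set W) ×ˢ Ioi (0 : ℝ))) (𝓝[>] (0 : ℝ))
        (fun ε : ℝ => (univ : Set W) ×ˢ Ioi ε) := by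
      constructor
      · refine (ae_restrict_iff' (MeasurableSet.univ.prod measurableSet_Ioi)).2
          (Eventually.of_forall fun q hq => ?_)
        have : ∀ᶠ ε : ℝ in 𝓝[>] 0, ε < q.2 := nhdsWithin_le_nhds (gt_mem_nhds hq.2)
        filter_upwards [this] with ε hε
        exact ⟨trivial, hε⟩
      · exact fun ε => MeasurableSet.univ.prod measurableSet_Ioi
    refine (hcov.integral_tendsto_of_countably_generated hi').congr' ?_
    filter_upwards [self_mem_nhdsWithin] with ε hε
    rw [Measure.restrict_restrict (MeasurableSet.univ.prod measurableSet_Ioi),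
      inter_eq_self_of_subset_left]
    exact prod_mono_right (Ioi_subset_Ioi (le_of_lt hε))
  have hlim2 : Tendsto (fun ε : ℝ => ∫ x : W, Φ (S (x, ε)) (graphNormal c h x)) (𝓝[>] 0)
      (𝓝 (∫ x : W, Φ (S (x, 0)) (graphNormal c h x))) := by
    -- Replacing ε by max ε 0 keeps the point on or below the graph, where Φ is continuous, so the
    -- parametric integral is continuous on all of ℝ.
    have hcont : Continuous (Function.uncurry fun (ε : ℝ) (x : W) =>
        Φ (S (x, max ε 0)) (graphNormal c h x)) := by
      have h1 : Continuous fun q : ℝ × W => Φ (S (q.2, max q.1 0)) := by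
        rw [← continuousOn_univ]
        refine hc.comp ?_ ?_
        · exact (S.continuous.comp (by fun_prop)).continuousOn
        · intro q _
          simp [hS, graphShear_apply]
      exact h1.clm_apply ((continuous_graphNormal c hh).comp continuous_snd)
    have h2 := (continuous_parametric_integral_of_continuous (μ := volume) hcont hKWc).tendsto 0
    have h3 : ∀ ε : ℝ, ∫ x in KW, Φ (S (x, max ε 0)) (graphNormal c h x) =
        ∫ x, Φ (S (x, max ε 0)) (graphNormal c h x) := by
      intro ε
      refine setIntegral_eq_integral_of_forall_compl_eq_zero fun x hx => ?_
      have : Φ (S (x, max ε 0)) = 0 :=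
        image_eq_zero_of_notMem_tsupport fun hq => hx ⟨(x, max ε 0), hq, rfl⟩
      simp [this]
    simp only [h3] at h2
    simp only [max_self] at h2
    refine (h2.mono_left nhdsWithin_le_nhds).congr' ?_
    filter_upwards [self_mem_nhdsWithin] with ε hε
    rw [max_eq_left (le_of_lt hε)]
  have heq : ∫ q in univ ×ˢ Ioi 0, divergence Φ (S q) =
      ∫ x : W, Φ (S (x, 0)) (graphNormal c h x) := by
    refine tendsto_nhds_unique hlim1 (hlim2.congr' ?_)
    filter_upwards [self_mem_nhdsWithin] with ε hε
    exact (integral_divergence_graphShear_Ioi c hh hcpt hd hε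
      (hi'.mono_set (prod_mono_right (Ioi_subset_Ioi (le_of_lt hε))))).symm
  rw [← hmp.setIntegral_preimage_emb S.measurableEmbedding, hpre, heq]
  simp [hS, graphShear_apply]

end SubgraphIntegral

/-! ### Boundary charts that are flat up to δ -/

section Charts

/-- Take any isometry and follow it by the reflection that exchanges the image of the last axis with
w, both being unit vectors. -/
theorem exists_frame {n : ℕ} (hn : 0 < n) (w : Vec n) (hw : ‖w‖ = 1) :
    ∃ c : WithLp 2 (Vec (n - 1) × ℝ) ≃ₗᵢ[ℝ] Vec n, c (WithLp.toLp 2 (0, 1)) = w := by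
  have hfr : Module.finrank ℝ (WithLp 2 (Vec (n - 1) × ℝ)) = n := by
    rw [(WithLp.linearEquiv 2 ℝ (Vec (n - 1) × ℝ)).finrank_eq, Module.finrank_prod]
    simp
    omega
  let c₀ : WithLp 2 (Vec (n - 1) × ℝ) ≃ₗᵢ[ℝ] Vec n :=
    ((stdOrthonormalBasis ℝ _).reindex (finCongr hfr)).repr
  have h1 : ‖c₀ (WithLp.toLp 2 (0, 1))‖ = ‖w‖ := by
    rw [c₀.norm_map, hw, WithLp.prod_norm_eq_of_L2]
    simp
  exact ⟨c₀.trans (ℝ ∙ (c₀ (WithLp.toLp 2 (0, 1)) - w))ᗮ.reflection,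
    Submodule.reflection_sub h1⟩

theorem continuousAt_gradient {n : ℕ} {ρ : Vec n → ℝ} {x : Vec n} (h : ContDiffAt ℝ 1 ρ x) :
    ContinuousAt (∇ ρ) x :=
  (InnerProductSpace.toDual ℝ (Vec n)).symm.continuous.continuousAt.comp
    (h.continuousAt_fderiv one_ne_zero)

/-- One defining function serves all nearby boundary points, which is what makes the pointwise
chosen normal continuous. It vanishes there because a positive value would keep K away from the
point and a negative one would put the point inside K. -/
theorem IsDefiningFunctionAt.eventually {n : ℕ} {K : Set (Vec n)} (hKo : IsOpen K)
    {ρ : Vec n → ℝ} {x : Vec n} (h : IsDefiningFunctionAt K ρ x) :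
    ∀ᶠ z in 𝓝[frontier K] x, IsDefiningFunctionAt K ρ z := by
  obtain ⟨h1, h2, h3, h4⟩ := h
  have e1 : ∀ᶠ z in 𝓝 x, ContDiffAt ℝ 1 ρ z := h1.eventually (by simp)
  have e2 : ∀ᶠ z in 𝓝 x, ∇ ρ z ≠ 0 := (continuousAt_gradient h1).eventually_ne h3
  filter_upwards [nhdsWithin_le_nhds e1, nhdsWithin_le_nhds e2,
    nhdsWithin_le_nhds h4.eventually_nhds, self_mem_nhdsWithin] with z z1 z2 z4 z5
  refine ⟨z1, le_antisymm ?_ ?_, z2, z4⟩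
  · by_contra! hpos
    have e3 : ∀ᶠ y in 𝓝 z, 0 < ρ y := z1.continuousAt.eventually (lt_mem_nhds hpos)
    obtain ⟨y, hy1, hy2, hy3⟩ := ((mem_closure_iff_frequently.1 z5.1).and_eventually
      (e3.and z4)).exists
    linarith [hy3.1 hy1]
  · by_contra! hneg
    have : z ∈ K := z4.self_of_nhds.2 hneg
    exact z5.2 (by rwa [hKo.interior_eq])

theorem continuousOn_outerNormal {n : ℕ} {K : Set (Vec n)} (hKo : IsOpen K)
    (hKs : HasC1Boundary K) : ContinuousOn (outerNormal K) (frontier K) := by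
  intro x hx
  obtain ⟨ρ, hρ⟩ := hKs x hx
  have hg := continuousAt_gradient hρ.1
  have h1 : ContinuousAt (fun z => ‖∇ ρ z‖⁻¹ • ∇ ρ z) x :=
    (hg.norm.inv₀ (norm_ne_zero_iff.2 hρ.2.2.1)).smul hg
  refine h1.continuousWithinAt.congr_of_eventuallyEq ?_ (outerNormal_eq hρ)
  filter_upwards [hρ.eventually hKo] with z hz using outerNormal_eq hz

theorem norm_outerNormal {n : ℕ} {K : Set (Vec n)} (hKs : HasC1Boundary K) {x : Vec n}
    (hx : x ∈ frontier K) : ‖outerNormal K x‖ = 1 := by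
  obtain ⟨ρ, hρ⟩ := hKs x hx
  rw [outerNormal_eq hρ, norm_smul, norm_inv, norm_norm,
    inv_mul_cancel₀ (norm_ne_zero_iff.2 hρ.2.2.1)]

/-- A chart of the boundary of `K` in which `K` lies below the graph of a function whose gradient
is at most `δ`, over a hyperplane whose unit normal is `δ`-close to the outer unit normal. -/
structure BoundaryChart {n : ℕ} (K : Set (Vec n)) (δ : ℝ) where
  frame : WithLp 2 (Vec (n - 1) × ℝ) ≃ₗᵢ[ℝ] Vec n
  height : Vec (n - 1) → ℝ
  dom : Set (Vec n)
  base : Set (Vec (n - 1))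
  contDiff_height : ContDiff ℝ 1 height
  isOpen_dom : IsOpen dom
  isBounded_dom : Bornology.IsBounded dom
  convex_base : Convex ℝ base
  fst_mem_base : ∀ z ∈ dom, (frame.symm z).fst ∈ base
  norm_fderiv_le : ∀ x ∈ base, ‖fderiv ℝ height x‖ ≤ δ
  mem_iff : ∀ z ∈ dom, (z ∈ K ↔ z ∈ subgraph frame height)
  normal_le : ∀ z ∈ dom, z ∈ frontier K → ‖outerNormal K z - frame (WithLp.toLp 2 (0, 1))‖ ≤ δ

/-- A local `C¹` function with small gradient near a point agrees there with a global one. -/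
theorem exists_contDiff_extension {V : Type*} [NormedAddCommGroup V] [InnerProductSpace ℝ V]
    [FiniteDimensional ℝ V] {g : V → ℝ} {x₀ : V} (hg : ContDiffAt ℝ 1 g x₀) :
    ∃ h : V → ℝ, ContDiff ℝ 1 h ∧ h =ᶠ[𝓝 x₀] g := by
  obtain ⟨r, hr, hgr⟩ := Metric.eventually_nhds_iff_ball.1 (hg.eventually (by simp))
  let χ : ContDiffBump x₀ := ⟨r / 4, r / 2, by positivity, by linarith⟩
  refine ⟨fun x => χ x * g x, contDiff_iff_contDiffAt.2 fun x => ?_, ?_⟩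
  · by_cases hx : x ∈ Metric.ball x₀ r
    · exact χ.contDiff.contDiffAt.mul (hgr x hx)
    · have : x ∉ tsupport χ := by
        rw [χ.tsupport_eq]
        intro h
        refine hx (Metric.closedBall_subset_ball ?_ h)
        change r / 2 < r
        linarith
      have h0 : (fun x => χ x * g x) =ᶠ[𝓝 x] fun _ => 0 := by
        filter_upwards [notMem_tsupport_iff_eventuallyEq.1 this] with y hy
        simp [hy]
      exact contDiffAt_const.congr_of_eventuallyEq h0
  · filter_upwards [χ.eventuallyEq_one] with y hy
    simp [hy]

/-- Apply the implicit function theorem in a frame whose last axis is the outer normal at `x₀`. The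
height then has zero derivative at the base point, so by continuity its slope and the deviation of
the normal are at most δ on a small enough cylinder. -/
theorem exists_boundaryChart {n : ℕ} (hn : 0 < n) {K : Set (Vec n)} (hKo : IsOpen K)
    (hKs : HasC1Boundary K) {x₀ : Vec n} (hx₀ : x₀ ∈ frontier K) {δ : ℝ} (hδ : 0 < δ) :
    ∃ χ : BoundaryChart K δ, x₀ ∈ χ.dom := by
  obtain ⟨ρ, hρ⟩ := hKs x₀ hx₀
  set w := outerNormal K x₀ with hw
  obtain ⟨c, hc⟩ := exists_frame hn w (norm_outerNormal hKs hx₀)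
  obtain ⟨l, hpos, hgw⟩ : ∃ l : ℝ, 0 < l ∧ ∇ ρ x₀ = l • w := by
    refine ⟨‖∇ ρ x₀‖, norm_pos_iff.2 hρ.2.2.1, ?_⟩
    rw [hw, outerNormal_eq hρ, smul_smul, mul_inv_cancel₀ (norm_ne_zero_iff.2 hρ.2.2.1), one_smul]
  let C : Vec (n - 1) × ℝ →L[ℝ] Vec n :=
    (c.toContinuousLinearEquiv : WithLp 2 (Vec (n - 1) × ℝ) →L[ℝ] Vec n) ∘L
        ((WithLp.prodContinuousLinearEquiv 2 ℝ (Vec (n - 1)) ℝ).symm :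
          Vec (n - 1) × ℝ →L[ℝ] WithLp 2 (Vec (n - 1) × ℝ))
  have hC : ∀ q, C q = c (WithLp.toLp 2 q) := fun q => rfl
  set u : Vec (n - 1) × ℝ := (c.symm x₀).ofLp with hu
  have hCu : C u = x₀ := by
    rw [hC]
    exact c.apply_symm_apply x₀
  let g : Vec (n - 1) × ℝ → ℝ := fun q => ρ (C q)
  have hg : ContDiffAt ℝ 1 g u := by
    refine ContDiffAt.comp u ?_ C.contDiff.contDiffAt
    rw [hCu]
    exact hρ.1
  have hgu : g u = 0 := by
    change ρ (C u) = 0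
    rw [hCu, hρ.2.1]
  have hfd : ∀ q, fderiv ℝ g u q = l * q.2 := by
    intro q
    have h1 : HasFDerivAt ρ (InnerProductSpace.toDual ℝ (Vec n) (∇ ρ x₀)) (C u) := by
      rw [hCu]
      exact (hρ.1.differentiableAt one_ne_zero).hasGradientAt.hasFDerivAt
    have h2 : HasFDerivAt g _ u := h1.comp u C.hasFDerivAt
    rw [h2.fderiv, ContinuousLinearMap.comp_apply, InnerProductSpace.toDual_apply_apply, hgw,
      real_inner_smul_left, ← hc, hC, c.inner_map_map, WithLp.prod_inner_apply]
    simp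
  -- The partial derivative along the last axis is multiplication by l, the norm of the gradient of
  -- ρ at `x₀`.
  have hinv : (fderiv ℝ g u ∘L .inr ℝ (Vec (n - 1)) ℝ).IsInvertible := by
    refine ⟨ContinuousLinearEquiv.smulLeft (Units.mk0 _ hpos.ne'), ?_⟩
    ext
    simp [hfd]
  set h₀ := hg.implicitFunction one_ne_zero hinv with hh₀
  have hh₀u : h₀ u.1 = u.2 := hg.implicitFunction_apply_self one_ne_zero hinv
  have hh₀d : HasStrictFDerivAt h₀ (0 : Vec (n - 1) →L[ℝ] ℝ) u.1 := by
    have h1 := hg.hasStrictFDerivAt_implicitFunction one_ne_zero hinv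
    have : fderiv ℝ g u ∘L .inl ℝ (Vec (n - 1)) ℝ = 0 := by
      ext v
      simp [hfd]
    rw [this] at h1
    simpa using h1
  have hh₀c : ContDiffAt ℝ 1 h₀ u.1 := hg.contDiffAt_implicitFunction one_ne_zero hinv
  obtain ⟨h, hh, hhe⟩ := exists_contDiff_extension hh₀c
  have hfd0 : fderiv ℝ h u.1 = 0 := by
    rw [hhe.fderiv_eq, hh₀d.hasFDerivAt.fderiv]
  have E1 : ∀ᶠ q in 𝓝 u, DifferentiableAt ℝ g q := by
    filter_upwards [hg.eventually (by simp)] with q hq using hq.differentiableAt one_ne_zero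
  have E2 : ∀ᶠ q in 𝓝 u, 0 < fderiv ℝ g q (0, 1) := by
    have h1 : ContinuousAt (fun q => fderiv ℝ g q (0, 1)) u :=
      (hg.continuousAt_fderiv one_ne_zero).clm_apply continuousAt_const
    refine h1.eventually (lt_mem_nhds ?_)
    simpa [hfd] using hpos
  have E3 : ∀ᶠ q in 𝓝 u, (C q ∈ K ↔ g q < 0) := by
    have : Tendsto C (𝓝 u) (𝓝 x₀) := by
      simpa only [hCu] using C.continuous.tendsto u
    exact this.eventually hρ.2.2.2
  have E4 : ∀ᶠ q in 𝓝 u, C q ∈ frontier K → ‖outerNormal K (C q) - w‖ ≤ δ := by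
    have : Tendsto C (𝓝 u) (𝓝 x₀) := by
      simpa only [hCu] using C.continuous.tendsto u
    have h1 := Metric.tendsto_nhdsWithin_nhds.1 (continuousOn_outerNormal hKo hKs x₀ hx₀) δ hδ
    obtain ⟨r, hr, h1⟩ := h1
    filter_upwards [this.eventually (Metric.ball_mem_nhds x₀ hr)] with q hq hq'
    rw [← dist_eq_norm]
    exact (h1 hq' hq).le
  obtain ⟨a, ha, Ha⟩ := Metric.eventually_nhds_iff_ball.1 (E1.and (E2.and (E3.and E4)))
  have hhu : h u.1 = u.2 := hhe.self_of_nhds.trans hh₀u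
  have F1 : ∀ᶠ x in 𝓝 u.1, g (x, h x) = 0 := by
    filter_upwards [hg.eventually_apply_implicitFunction one_ne_zero hinv, hhe] with x hx1 hx2
    rw [hx2, hx1, hgu]
  have F2 : ∀ᶠ x in 𝓝 u.1, ‖fderiv ℝ h x‖ ≤ δ := by
    have h1 : ContinuousAt (fun x => ‖fderiv ℝ h x‖) u.1 :=
      (hh.continuous_fderiv one_ne_zero).norm.continuousAt
    have h2 := h1.eventually (gt_mem_nhds (by simpa [hfd0] using hδ : ‖fderiv ℝ h u.1‖ < δ))
    filter_upwards [h2] with x hx using hx.le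
  have F3 : ∀ᶠ x in 𝓝 u.1, h x ∈ Metric.ball u.2 a := by
    refine hh.continuous.continuousAt.eventually ?_
    rw [hhu]
    exact Metric.ball_mem_nhds _ ha
  obtain ⟨r, hr, Hr⟩ := Metric.eventually_nhds_iff_ball.1
    ((F1.and (F2.and F3)).and (Metric.ball_mem_nhds u.1 ha))
  have hcont1 : Continuous fun z => (c.symm z).fst :=
    (by fun_prop : Continuous fun z : WithLp 2 (Vec (n - 1) × ℝ) => z.fst).comp c.symm.continuous
  have hcont2 : Continuous fun z => (c.symm z).snd :=
    (by fun_prop : Continuous fun z : WithLp 2 (Vec (n - 1) × ℝ) => z.snd).comp c.symm.continuous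
  have hCs : ∀ z, C ((c.symm z).fst, (c.symm z).snd) = z := fun z => c.apply_symm_apply z
  have hbox : ∀ z, (c.symm z).fst ∈ Metric.ball u.1 r → (c.symm z).snd ∈ Metric.ball u.2 a →
      ((c.symm z).fst, (c.symm z).snd) ∈ Metric.ball u a := by
    intro z h1 h2
    rw [← ball_prod_same]
    exact ⟨(Hr _ h1).2, h2⟩
  refine ⟨⟨c, h, {z | (c.symm z).fst ∈ Metric.ball u.1 r ∧ (c.symm z).snd ∈ Metric.ball u.2 a},
    Metric.ball u.1 r, hh, ?_, ?_, convex_ball _ _, fun z hz => hz.1, fun x hx => (Hr x hx).1.2.1,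
    ?_, ?_⟩, ?_⟩
  · exact (Metric.isOpen_ball.preimage hcont1).inter (Metric.isOpen_ball.preimage hcont2)
  · refine (((isCompact_closedBall u.1 r).prod (isCompact_closedBall u.2 a)).image
      C.continuous).isBounded.subset ?_
    rintro z ⟨h1, h2⟩
    exact ⟨_, ⟨Metric.ball_subset_closedBall h1, Metric.ball_subset_closedBall h2⟩, hCs z⟩
  · rintro z ⟨h1, h2⟩
    have hz := Ha _ (hbox z h1 h2)
    have h3 := hz.2.2.1
    rw [hCs] at h3
    rw [h3]
    set x := (c.symm z).fst with hx
    set s := (c.symm z).snd with hs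
    -- The defining function increases along the last axis and vanishes at height `h x`, so its sign
    -- tells on which side of the graph a point lies.
    have hmono : StrictMonoOn (fun s => g (x, s)) (Metric.ball u.2 a) := by
      have hd : ∀ s ∈ Metric.ball u.2 a, HasDerivAt (fun s => g (x, s))
          (fderiv ℝ g (x, s) (0, 1)) s := by
        intro s hs
        have h5 : (x, s) ∈ Metric.ball u a := by
          rw [← ball_prod_same]
          exact ⟨(Hr _ h1).2, hs⟩
        exact (Ha _ h5).1.hasFDerivAt.comp_hasDerivAt s
          ((hasDerivAt_const s x).prodMk (hasDerivAt_id s))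
      refine strictMonoOn_of_deriv_pos (convex_ball _ _)
        (fun s hs => (hd s hs).continuousAt.continuousWithinAt) fun s hs => ?_
      have hs' := interior_subset hs
      rw [(hd s hs').deriv]
      have h5 : (x, s) ∈ Metric.ball u a := by
        rw [← ball_prod_same]
        exact ⟨(Hr _ h1).2, hs'⟩
      exact (Ha _ h5).2.1
    have h6 := hmono.lt_iff_lt h2 (Hr x h1).1.2.2
    simp only [(Hr x h1).1.1] at h6
    exact h6
  · rintro z ⟨h1, h2⟩ hzf
    have hz := (Ha _ (hbox z h1 h2)).2.2.2
    rw [hCs] at hz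
    rw [hc]
    exact hz hzf
  · exact ⟨Metric.mem_ball_self hr, Metric.mem_ball_self ha⟩

end Charts

/-! ### Comparing measures and integrals -/

section Comparison

theorem euclideanHausdorffMeasure_image_le {X Y : Type*} [EMetricSpace X] [MeasurableSpace X]
    [BorelSpace X] [EMetricSpace Y] [MeasurableSpace Y] [BorelSpace Y] {C : NNReal} {f : X → Y}
    {s : Set X} (hf : LipschitzOnWith C f s) (d : ℕ) :
    μHE[d] (f '' s) ≤ (C : ENNReal) ^ d * μHE[d] s := by
  simp only [Measure.euclideanHausdorffMeasure_def, Measure.smul_apply]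
  have h1 := hf.hausdorffMeasure_image_le (d := d) (by positivity)
  rw [ENNReal.rpow_natCast] at h1
  rw [ENNReal.smul_def, ENNReal.smul_def, smul_eq_mul, smul_eq_mul, mul_left_comm]
  gcongr

/-- Integrals against comparable measures are close. -/
theorem norm_integral_sub_integral_le {α X : Type*} [MeasurableSpace α] [NormedAddCommGroup X]
    [NormedSpace ℝ X] {μ ν : Measure α} [IsFiniteMeasure ν] {C : ℝ}
    (hC : 1 ≤ C) (h1 : ν ≤ μ) (h2 : μ ≤ ENNReal.ofReal C • ν) {g : α → X} (hg : Integrable g μ) :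
    ‖∫ x, g x ∂μ - ∫ x, g x ∂ν‖ ≤ (C - 1) * ∫ x, ‖g x‖ ∂μ := by
  have hgν : Integrable g ν := hg.mono_measure h1
  -- The error is the integral against μ - ν, and the integral of ‖g‖ against μ - ν is at most C - 1
  -- times its integral against ν.
  have hdec : (μ - ν) + ν = μ := Measure.sub_add_cancel_of_le h1
  have hgd : Integrable g (μ - ν) := hg.mono_measure Measure.sub_le
  have e1 : ∫ x, g x ∂μ = ∫ x, g x ∂(μ - ν) + ∫ x, g x ∂ν := by
    rw [← integral_add_measure hgd hgν, hdec]
  have e2 : ∫ x, ‖g x‖ ∂μ = ∫ x, ‖g x‖ ∂(μ - ν) + ∫ x, ‖g x‖ ∂ν := by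
    rw [← integral_add_measure hgd.norm hgν.norm, hdec]
  have e3 : ∫ x, ‖g x‖ ∂μ ≤ C * ∫ x, ‖g x‖ ∂ν := by
    have := integral_mono_measure (f := fun x => ‖g x‖) h2
      (Eventually.of_forall fun x => norm_nonneg _) (hgν.norm.smul_measure ENNReal.ofReal_ne_top)
    rwa [integral_smul_measure, ENNReal.toReal_ofReal (by linarith), smul_eq_mul] at this
  have e4 : ∫ x, ‖g x‖ ∂ν ≤ ∫ x, ‖g x‖ ∂μ := by
    rw [e2]
    have : 0 ≤ ∫ x, ‖g x‖ ∂(μ - ν) := integral_nonneg fun x => norm_nonneg _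
    linarith
  rw [e1, add_sub_cancel_right]
  refine (norm_integral_le_integral_norm _).trans ?_
  have : ∫ x, ‖g x‖ ∂(μ - ν) ≤ (C - 1) * ∫ x, ‖g x‖ ∂ν := by linarith
  refine this.trans ?_
  gcongr

end Comparison

/-! ### Surface measure in a chart -/

section ChartMeasure

namespace BoundaryChart

variable {n : ℕ} {K : Set (Vec n)} {δ : ℝ} (χ : BoundaryChart K δ)

/-- The parametrisation of the boundary by a chart. -/
def param (x : Vec (n - 1)) : Vec n := χ.frame (WithLp.toLp 2 (x, χ.height x))

/-- The parameters of points in the domain of the chart. -/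
def paramDom : Set (Vec (n - 1)) := χ.param ⁻¹' χ.dom

/-- The base coordinate of a chart. -/
def proj (z : Vec n) : Vec (n - 1) := (χ.frame.symm z).fst

theorem proj_param (x : Vec (n - 1)) : χ.proj (χ.param x) = x := by
  simp [proj, param]

theorem continuous_param : Continuous χ.param := by
  have := χ.contDiff_height.continuous
  exact χ.frame.continuous.comp (by fun_prop)

theorem continuous_proj : Continuous χ.proj :=
  (by fun_prop : Continuous fun z : WithLp 2 (Vec (n - 1) × ℝ) => z.fst).comp
    χ.frame.symm.continuous

theorem isOpen_paramDom : IsOpen χ.paramDom := χ.isOpen_dom.preimage χ.continuous_param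

theorem paramDom_subset_base : χ.paramDom ⊆ χ.base := fun x hx => by
  have := χ.fst_mem_base _ hx
  simpa [param] using this

theorem lipschitzWith_proj : LipschitzWith 1 χ.proj := by
  refine LipschitzWith.of_dist_le_mul fun z z' => ?_
  rw [NNReal.coe_one, one_mul, dist_eq_norm, dist_eq_norm, ← χ.frame.symm.norm_map (z - z'),
    map_sub]
  exact WithLp.norm_fst_le _ (χ.frame.symm z - χ.frame.symm z')

/-- The mean value inequality on the convex base makes the height δ-Lipschitz. -/
theorem lipschitzOnWith_param (hδ : 0 ≤ δ) :
    LipschitzOnWith (1 + δ.toNNReal) χ.param χ.base := by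
  have h1 : LipschitzOnWith δ.toNNReal χ.height χ.base :=
    χ.convex_base.lipschitzOnWith_of_nnnorm_fderiv_le
      (fun x _ => χ.contDiff_height.differentiable one_ne_zero x) fun x hx => by
        rw [← NNReal.coe_le_coe, coe_nnnorm, Real.coe_toNNReal _ hδ]
        exact χ.norm_fderiv_le x hx
  refine LipschitzOnWith.of_dist_le_mul fun x hx x' hx' => ?_
  have h2 := h1.dist_le_mul x hx x' hx'
  rw [dist_eq_norm, param, param, ← map_sub, χ.frame.norm_map]
  have h3 : WithLp.toLp 2 (x, χ.height x) - WithLp.toLp 2 (x', χ.height x') =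
      WithLp.toLp 2 (x - x', 0) + WithLp.toLp 2 (0, χ.height x - χ.height x') :=
    WithLp.ofLp_injective 2 (Prod.ext (by simp) (by simp))
  rw [h3]
  refine (norm_add_le _ _).trans ?_
  rw [WithLp.norm_toLp_fst, WithLp.norm_toLp_snd, NNReal.coe_add, add_mul, NNReal.coe_one, one_mul]
  rw [dist_eq_norm, dist_eq_norm] at h2
  rw [dist_eq_norm]
  gcongr

theorem mem_frontier_iff (hKo : IsOpen K) {z : Vec n} (hz : z ∈ χ.dom) :
    z ∈ frontier K ↔ (χ.frame.symm z).snd = χ.height (χ.frame.symm z).fst := by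
  have hc2 : Continuous fun z => (χ.frame.symm z).snd :=
    (by fun_prop : Continuous fun z : WithLp 2 (Vec (n - 1) × ℝ) => z.snd).comp
      χ.frame.symm.continuous
  have hc1 : Continuous fun z => χ.height (χ.frame.symm z).fst :=
    χ.contDiff_height.continuous.comp χ.continuous_proj
  rw [hKo.frontier_eq]
  constructor
  · rintro ⟨h1, h2⟩
    rw [χ.mem_iff z hz, subgraph, mem_ofPred_eq, not_lt] at h2
    refine le_antisymm ?_ h2
    by_contra! h3
    have : ∀ᶠ y in 𝓝 z, y ∈ χ.dom ∧ χ.height (χ.frame.symm y).fst < (χ.frame.symm y).snd :=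
      (χ.isOpen_dom.eventually_mem hz).and ((isOpen_lt hc1 hc2).eventually_mem h3)
    obtain ⟨y, hy1, hy2, hy3⟩ := ((mem_closure_iff_frequently.1 h1).and_eventually this).exists
    have := (χ.mem_iff y hy2).1 hy1
    exact lt_asymm this hy3
  · intro h
    refine ⟨?_, fun h1 => ?_⟩
    · have ht : Tendsto (fun t : ℝ => χ.frame (WithLp.toLp 2 ((χ.frame.symm z).fst,
          (χ.frame.symm z).snd - t))) (𝓝[>] 0) (𝓝 z) := by
        have h1 : Continuous fun t : ℝ => χ.frame (WithLp.toLp 2 ((χ.frame.symm z).fst,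
            (χ.frame.symm z).snd - t)) := χ.frame.continuous.comp (by fun_prop)
        have h2 := (h1.tendsto 0).mono_left (nhdsWithin_le_nhds (s := Ioi 0))
        have h3 : χ.frame (WithLp.toLp 2 ((χ.frame.symm z).fst, (χ.frame.symm z).snd)) = z :=
          χ.frame.apply_symm_apply z
        simpa only [sub_zero, h3] using h2
      refine mem_closure_of_tendsto ht ?_
      filter_upwards [ht.eventually (χ.isOpen_dom.mem_nhds hz), self_mem_nhdsWithin] with t h1 h2
      rw [χ.mem_iff _ h1]
      simp only [subgraph, mem_ofPred_eq, LinearIsometryEquiv.symm_apply_apply]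
      have : (0 : ℝ) < t := h2
      change (χ.frame.symm z).snd - t < χ.height (χ.frame.symm z).fst
      linarith
    · have := (χ.mem_iff z hz).1 h1
      exact absurd h (ne_of_lt this)

theorem mem_closure_of_le (hKo : IsOpen K) {z : Vec n} (hz : z ∈ χ.dom)
    (hle : (χ.frame.symm z).snd ≤ χ.height (χ.frame.symm z).fst) : z ∈ closure K := by
  rcases hle.lt_or_eq with h | h
  · exact subset_closure ((χ.mem_iff z hz).2 h)
  · exact frontier_subset_closure ((χ.mem_frontier_iff hKo hz).2 h)

theorem param_mem_frontier (hKo : IsOpen K) {x : Vec (n - 1)} (hx : x ∈ χ.paramDom) :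
    χ.param x ∈ frontier K :=
  (χ.mem_frontier_iff hKo hx).2 (by simp [param])

theorem param_proj (hKo : IsOpen K) {z : Vec n} (hz : z ∈ χ.dom) (hz' : z ∈ frontier K) :
    χ.param (χ.proj z) = z := by
  have := (χ.mem_frontier_iff hKo hz).1 hz'
  rw [param, proj, ← this]
  exact χ.frame.apply_symm_apply z

/-- Lebesgue measure on the parameters, transported to the boundary. -/
def paramMeasure : Measure (Vec n) := (volume.restrict χ.paramDom).map χ.param

theorem volume_paramDom_lt_top : volume χ.paramDom < ⊤ := by
  have h1 : χ.paramDom ⊆ χ.proj '' χ.dom := fun x hx => ⟨_, hx, χ.proj_param x⟩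
  exact ((χ.lipschitzWith_proj.isBounded_image χ.isBounded_dom).subset h1).measure_lt_top

instance : IsFiniteMeasure χ.paramMeasure := by
  have : IsFiniteMeasure (volume.restrict χ.paramDom) :=
    ⟨by rw [Measure.restrict_apply_univ]; exact χ.volume_paramDom_lt_top⟩
  unfold paramMeasure
  infer_instance

theorem paramMeasure_apply {A : Set (Vec n)} (hA : MeasurableSet A) :
    χ.paramMeasure A = μHE[n - 1] (χ.param ⁻¹' A ∩ χ.paramDom) := by
  rw [paramMeasure, Measure.map_apply χ.continuous_param.measurable hA,
    Measure.restrict_apply (χ.continuous_param.measurable hA),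
    EuclideanSpace.euclideanHausdorffMeasure_eq_volume]

theorem surfaceMeasure_restrict_apply (hKo : IsOpen K) {A : Set (Vec n)} (hA : MeasurableSet A) :
    (surfaceMeasure K).restrict χ.dom A = μHE[n - 1] (χ.param '' (χ.param ⁻¹' A ∩ χ.paramDom)) := by
  rw [surfaceMeasure, Measure.restrict_restrict χ.isOpen_dom.measurableSet,
    Measure.restrict_apply hA]
  congr 1
  ext z
  constructor
  · rintro ⟨h1, h2, h3⟩
    have h4 := χ.param_proj hKo h2 h3
    refine ⟨χ.proj z, ⟨?_, ?_⟩, h4⟩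
    · rwa [mem_preimage, h4]
    · rwa [paramDom, mem_preimage, h4]
  · rintro ⟨x, ⟨h1, h2⟩, rfl⟩
    exact ⟨h1, h2, χ.param_mem_frontier hKo h2⟩

/-- The projection to the base inverts the parametrisation and is 1-Lipschitz, so it cannot increase
Hausdorff measure; on the base the normalised Hausdorff measure is Lebesgue measure. -/
theorem paramMeasure_le (hKo : IsOpen K) : χ.paramMeasure ≤ (surfaceMeasure K).restrict χ.dom := by
  refine Measure.le_iff.2 fun A hA => ?_
  rw [χ.paramMeasure_apply hA, χ.surfaceMeasure_restrict_apply hKo hA]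
  have h1 := euclideanHausdorffMeasure_image_le (χ.lipschitzWith_proj.lipschitzOnWith
    (s := χ.param '' (χ.param ⁻¹' A ∩ χ.paramDom))) (n - 1)
  rw [image_image] at h1
  simpa [proj_param] using h1

/-- The parametrisation is (1 + δ)-Lipschitz, which costs its (n-1)-st power. Together with
`paramMeasure_le` this replaces the area formula. -/
theorem surfaceMeasure_restrict_le (hKo : IsOpen K) (hδ : 0 ≤ δ) :
    (surfaceMeasure K).restrict χ.dom ≤ ENNReal.ofReal ((1 + δ) ^ (n - 1)) • χ.paramMeasure := by
  refine Measure.le_iff.2 fun A hA => ?_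
  rw [Measure.smul_apply, χ.paramMeasure_apply hA, χ.surfaceMeasure_restrict_apply hKo hA]
  have h1 := euclideanHausdorffMeasure_image_le ((χ.lipschitzOnWith_param hδ).mono
    (inter_subset_right.trans χ.paramDom_subset_base : χ.param ⁻¹' A ∩ χ.paramDom ⊆ _)) (n - 1)
  refine h1.trans (le_of_eq ?_)
  rw [smul_eq_mul, ENNReal.ofReal_pow (by positivity), ENNReal.ofReal_add zero_le_one hδ]
  simp [ENNReal.ofReal]

end BoundaryChart

/-- The boundary is compact and each chart has finite surface measure; any fixed δ will do, here 1.
-/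
theorem isFiniteMeasure_surfaceMeasure {n : ℕ} (hn : 0 < n) {K : Set (Vec n)} (hKo : IsOpen K)
    (hKb : Bornology.IsBounded K) (hKs : HasC1Boundary K) : IsFiniteMeasure (surfaceMeasure K) := by
  have hc : IsCompact (frontier K) :=
    hKb.isCompact_closure.of_isClosed_subset isClosed_frontier frontier_subset_closure
  have h1 : surfaceMeasure K (frontier K) < ⊤ := by
    refine hc.measure_lt_top_of_nhdsWithin fun x hx => ?_
    obtain ⟨χ, hχ⟩ := exists_boundaryChart hn hKo hKs hx one_pos
    refine ⟨χ.dom, nhdsWithin_le_nhds (χ.isOpen_dom.mem_nhds hχ), ?_⟩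
    have h2 := χ.surfaceMeasure_restrict_le hKo zero_le_one univ
    rw [Measure.restrict_apply_univ] at h2
    refine h2.trans_lt ?_
    rw [Measure.smul_apply]
    exact ENNReal.mul_lt_top ENNReal.ofReal_lt_top (measure_lt_top _ _)
  refine ⟨?_⟩
  rw [surfaceMeasure, Measure.restrict_apply_univ]
  rwa [surfaceMeasure, Measure.restrict_apply_self] at h1

theorem integrable_surfaceMeasure {n : ℕ} (hn : 0 < n) {K : Set (Vec n)} (hKo : IsOpen K)
    (hKb : Bornology.IsBounded K) (hKs : HasC1Boundary K) {X : Type*} [NormedAddCommGroup X]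
    {g : Vec n → X} (hg : ContinuousOn g (frontier K)) : Integrable g (surfaceMeasure K) := by
  have hc : IsCompact (frontier K) :=
    hKb.isCompact_closure.of_isClosed_subset isClosed_frontier frontier_subset_closure
  have := isFiniteMeasure_surfaceMeasure hn hKo hKb hKs
  have h1 : IntegrableOn g (frontier K) (surfaceMeasure K) := hg.integrableOn_compact hc
  rwa [IntegrableOn, surfaceMeasure, Measure.restrict_restrict isClosed_frontier.measurableSet,
    inter_self] at h1

theorem ae_surfaceMeasure_mem {n : ℕ} (K : Set (Vec n)) :
    ∀ᵐ x ∂surfaceMeasure K, x ∈ frontier K :=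
  ae_restrict_mem isClosed_frontier.measurableSet

end ChartMeasure

/-! ### Product rule and compactly supported fields -/

section DivergenceCalculus

variable {E X : Type*}
  [NormedAddCommGroup E] [InnerProductSpace ℝ E] [FiniteDimensional ℝ E]
  [NormedAddCommGroup X] [NormedSpace ℝ X]

theorem divergence_smul {φ : E → ℝ} {Φ : E → E →L[ℝ] X} {x : E} (hφ : DifferentiableAt ℝ φ x)
    (hΦ : DifferentiableAt ℝ Φ x) :
    divergence (fun z => φ z • Φ z) x = φ x • divergence Φ x + Φ x (∇ φ x) := by
  have h5 : ∇ φ x = ∑ i, fderiv ℝ φ x (stdOrthonormalBasis ℝ E i) • stdOrthonormalBasis ℝ E i := by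
    rw [← (stdOrthonormalBasis ℝ E).sum_repr' (∇ φ x)]
    refine Finset.sum_congr rfl fun i _ => ?_
    rw [real_inner_comm, gradient, InnerProductSpace.toDual_symm_apply]
  simp only [divergence, fderiv_fun_smul hφ hΦ, h5, map_sum, map_smul, Finset.smul_sum,
    ← Finset.sum_add_distrib]
  simp

theorem divergence_congr {Φ Ψ : E → E →L[ℝ] X} {x : E} (h : Φ =ᶠ[𝓝 x] Ψ) :
    divergence Φ x = divergence Ψ x := by
  simp only [divergence, h.fderiv_eq]

theorem divergence_sum {ι : Type*} {s : Finset ι} {Φ : ι → E → E →L[ℝ] X} {x : E}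
    (h : ∀ i ∈ s, DifferentiableAt ℝ (Φ i) x) :
    divergence (fun z => ∑ i ∈ s, Φ i z) x = ∑ i ∈ s, divergence (Φ i) x := by
  simp only [divergence, fderiv_fun_sum h, sum_apply]
  rw [Finset.sum_comm]

theorem integral_divergence_eq_zero [MeasurableSpace E] [BorelSpace E] {Φ : E → E →L[ℝ] X}
    (hΦ : ContDiff ℝ 1 Φ) (hc : HasCompactSupport Φ) : ∫ x, divergence Φ x = 0 := by
  have h1 : ∀ v w : E, ContDiff ℝ 1 (fun x => Φ x w) := fun v w => by fun_prop
  have h2 : ∀ w : E, HasCompactSupport (fun x => Φ x w) := fun w =>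
    hc.mono fun x hx => by
      contrapose! hx
      simp only [Function.mem_support, not_not] at hx ⊢
      simp [hx]
  have h3 : ∀ x v, fderiv ℝ Φ x v v = fderiv ℝ (fun x => Φ x v) x v := by
    intro x v
    rw [fderiv_clm_apply (hΦ.differentiable one_ne_zero x) (by fun_prop)]
    simp
  simp only [divergence, h3]
  rw [integral_finsetSum]
  · exact Finset.sum_eq_zero fun i _ => integral_fderiv_eq_zero (h1 0 _) (h2 _) _
  · intro i _
    exact (((h1 0 _).continuous_fderiv one_ne_zero).clm_apply
        continuous_const).integrable_of_hasCompactSupport ((h2 _).fderiv_apply ℝ _)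

end DivergenceCalculus

/-! ### The divergence theorem in one chart, up to an error of order δ -/

section LocalEstimate

variable {n : ℕ} {K : Set (Vec n)} {δ : ℝ} {X : Type*} [NormedAddCommGroup X] [NormedSpace ℝ X]

theorem norm_gradient {V : Type*} [NormedAddCommGroup V] [InnerProductSpace ℝ V] [CompleteSpace V]
    (g : V → ℝ) (x : V) : ‖∇ g x‖ = ‖fderiv ℝ g x‖ := by
  rw [gradient, LinearIsometryEquiv.norm_map]

theorem norm_graphNormal_sub_le (χ : BoundaryChart K δ) {x : Vec (n - 1)} (hx : x ∈ χ.base) :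
    ‖graphNormal χ.frame χ.height x - χ.frame (WithLp.toLp 2 (0, 1))‖ ≤ δ := by
  have h3 : WithLp.toLp 2 (-∇ χ.height x, (1 : ℝ)) - WithLp.toLp 2 (0, 1) =
      WithLp.toLp 2 (-∇ χ.height x, 0) :=
    WithLp.ofLp_injective 2 (Prod.ext (by simp) (by simp))
  rw [graphNormal, ← map_sub, h3, χ.frame.norm_map, WithLp.norm_toLp_fst, norm_neg, norm_gradient]
  exact χ.norm_fderiv_le x hx

theorem norm_frame_last (χ : BoundaryChart K δ) : ‖χ.frame (WithLp.toLp 2 (0, 1))‖ = 1 := by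
  rw [χ.frame.norm_map, WithLp.norm_toLp_snd, norm_one]

/-- In a chart, the divergence theorem for a field supported in the chart. -/
theorem BoundaryChart.integral_divergence [CompleteSpace X] (χ : BoundaryChart K δ)
    (hKo : IsOpen K) {Φ : Vec n → Vec n →L[ℝ] X} (hcpt : HasCompactSupport Φ)
    (hsub : tsupport Φ ⊆ χ.dom) (hd : ContDiffOn ℝ 1 Φ K) (hc : ContinuousOn Φ (closure K))
    (hi : IntegrableOn (divergence Φ) K) :
    ∫ x in K, divergence Φ x =
      ∫ x in χ.paramDom, Φ (χ.param x) (graphNormal χ.frame χ.height x) := by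
  have hopen := isOpen_subgraph χ.frame χ.contDiff_height.continuous
  have hset : K ∩ χ.dom = subgraph χ.frame χ.height ∩ χ.dom := by
    ext z
    exact and_congr_left fun hz => χ.mem_iff z hz
  have hz0 : ∀ z, z ∉ χ.dom → divergence Φ z = 0 := fun z hz =>
    divergence_of_notMem_tsupport fun h => hz (hsub h)
  have e1 : ∫ x in K, divergence Φ x = ∫ x in K ∩ χ.dom, divergence Φ x :=
    setIntegral_eq_of_subset_of_forall_sdiff_eq_zero hKo.measurableSet inter_subset_left
      fun z hz => hz0 z fun h => hz.2 ⟨hz.1, h⟩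
  have e2 : ∫ x in subgraph χ.frame χ.height, divergence Φ x =
      ∫ x in subgraph χ.frame χ.height ∩ χ.dom, divergence Φ x :=
    setIntegral_eq_of_subset_of_forall_sdiff_eq_zero hopen.measurableSet inter_subset_left
      fun z hz => hz0 z fun h => hz.2 ⟨hz.1, h⟩
  have hi' : IntegrableOn (divergence Φ) (subgraph χ.frame χ.height) := by
    refine IntegrableOn.of_forall_sdiff_eq_zero (s := K ∩ χ.dom) (hi.mono_set inter_subset_left)
      hopen.measurableSet fun z hz => hz0 z fun h => hz.2 ?_
    rw [hset]
    exact ⟨hz.1, h⟩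
  rw [e1, hset, ← e2, integral_divergence_subgraph χ.frame χ.contDiff_height hcpt ?_ ?_ hi']
  · symm
    refine setIntegral_eq_integral_of_forall_compl_eq_zero fun x hx => ?_
    have : Φ (χ.param x) = 0 := image_eq_zero_of_notMem_tsupport fun h => hx (hsub h)
    simp [this]
  · intro z hz
    by_cases hzs : z ∈ tsupport Φ
    · have hzK : z ∈ K := (χ.mem_iff z (hsub hzs)).2 hz
      exact (hd.contDiffAt (hKo.mem_nhds hzK)).contDiffWithinAt
    · exact (contDiffAt_const (c := (0 : Vec n →L[ℝ] X))).contDiffWithinAt.congr_of_eventuallyEq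
        (nhdsWithin_le_nhds (notMem_tsupport_iff_eventuallyEq.1 hzs))
        (image_eq_zero_of_notMem_tsupport hzs)
  · intro z hz
    by_cases hzs : z ∈ tsupport Φ
    · have hzK : z ∈ closure K := χ.mem_closure_of_le hKo (hsub hzs) hz
      refine (hc z hzK).mono_of_mem_nhdsWithin ?_
      filter_upwards [self_mem_nhdsWithin,
        nhdsWithin_le_nhds (χ.isOpen_dom.mem_nhds (hsub hzs))] with y hy1 hy2
      exact χ.mem_closure_of_le hKo hy2 hy1
    · exact (continuousAt_const (y := (0 : Vec n →L[ℝ] X))).continuousWithinAt.congr_of_eventuallyEq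
        (nhdsWithin_le_nhds (notMem_tsupport_iff_eventuallyEq.1 hzs))
        (image_eq_zero_of_notMem_tsupport hzs)

/-- The exact flux through the graph uses the graph normal and Lebesgue measure on the base. Both
normals are compared with the frame vector w, at a cost of δ each, and the two measures with each
other, at a cost of (1 + δ)^(n-1) - 1. Bounding by the integral of ‖Φ‖, and not by a supremum, makes
the errors of different charts add up well. -/
theorem BoundaryChart.norm_integral_divergence_sub_le [CompleteSpace X] (χ : BoundaryChart K δ)
    (hn : 0 < n) (hδ : 0 ≤ δ) (hKo : IsOpen K) (hKb : Bornology.IsBounded K)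
    (hKs : HasC1Boundary K) {Φ : Vec n → Vec n →L[ℝ] X} (hcpt : HasCompactSupport Φ)
    (hsub : tsupport Φ ⊆ χ.dom) (hd : ContDiffOn ℝ 1 Φ K) (hc : ContinuousOn Φ (closure K))
    (hi : IntegrableOn (divergence Φ) K) :
    ‖(∫ x in K, divergence Φ x) - ∫ x, Φ x (outerNormal K x) ∂surfaceMeasure K‖ ≤
      (2 * δ + ((1 + δ) ^ (n - 1) - 1)) * ∫ x, ‖Φ x‖ ∂surfaceMeasure K := by
  set w := χ.frame (WithLp.toLp 2 (0, 1)) with hw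
  set μ := (surfaceMeasure K).restrict χ.dom with hμ
  have hcf : ContinuousOn Φ (frontier K) := hc.mono frontier_subset_closure
  have hnu := continuousOn_outerNormal hKo hKs
  have i1 : Integrable (fun x => Φ x w) (surfaceMeasure K) :=
    integrable_surfaceMeasure hn hKo hKb hKs (hcf.clm_apply continuousOn_const)
  have i2 : Integrable (fun x => Φ x (outerNormal K x)) (surfaceMeasure K) :=
    integrable_surfaceMeasure hn hKo hKb hKs (hcf.clm_apply hnu)
  have i3 : Integrable (fun x => ‖Φ x‖) (surfaceMeasure K) :=
    integrable_surfaceMeasure hn hKo hKb hKs hcf.norm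
  have hΦ0 : ∀ x, x ∉ χ.dom → Φ x = 0 := fun x hx =>
    image_eq_zero_of_notMem_tsupport fun h => hx (hsub h)
  have r2 : ∫ x, Φ x (outerNormal K x) ∂surfaceMeasure K = ∫ x, Φ x (outerNormal K x) ∂μ :=
    (setIntegral_eq_integral_of_forall_compl_eq_zero fun x hx => by simp [hΦ0 x hx]).symm
  have r3 : ∫ x, ‖Φ x‖ ∂surfaceMeasure K = ∫ x, ‖Φ x‖ ∂μ :=
    (setIntegral_eq_integral_of_forall_compl_eq_zero fun x hx => by simp [hΦ0 x hx]).symm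
  have j1 : Integrable (fun x => Φ x w) μ := i1.restrict
  have j2 : Integrable (fun x => Φ x (outerNormal K x)) μ := i2.restrict
  have j3 : Integrable (fun x => ‖Φ x‖) μ := i3.restrict
  have hle := χ.paramMeasure_le hKo
  have p3 : Integrable (fun x => ‖Φ x‖) χ.paramMeasure := j3.mono_measure hle
  have p1 : Integrable (fun x => Φ x w) χ.paramMeasure := j1.mono_measure hle
  have hmeas := χ.continuous_param.measurable
  have q3 : IntegrableOn (fun x => ‖Φ (χ.param x)‖) χ.paramDom :=
    (integrable_map_measure p3.aestronglyMeasurable hmeas.aemeasurable).1 p3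
  have q1 : IntegrableOn (fun x => Φ (χ.param x) w) χ.paramDom :=
    (integrable_map_measure p1.aestronglyMeasurable hmeas.aemeasurable).1 p1
  have m3 : ∫ x in χ.paramDom, ‖Φ (χ.param x)‖ = ∫ x, ‖Φ x‖ ∂χ.paramMeasure :=
    (integral_map hmeas.aemeasurable p3.aestronglyMeasurable).symm
  have m1 : ∫ x in χ.paramDom, Φ (χ.param x) w = ∫ x, Φ x w ∂χ.paramMeasure :=
    (integral_map hmeas.aemeasurable p1.aestronglyMeasurable).symm
  have q0 : IntegrableOn (fun x => Φ (χ.param x) (graphNormal χ.frame χ.height x - w))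
      χ.paramDom := by
    refine Integrable.mono' (q3.mul_const δ) ?_ ?_
    · refine ContinuousOn.aestronglyMeasurable ?_ χ.isOpen_paramDom.measurableSet
      refine ContinuousOn.clm_apply ?_ ?_
      · exact hcf.comp χ.continuous_param.continuousOn fun x hx => χ.param_mem_frontier hKo hx
      · exact ((continuous_graphNormal _ χ.contDiff_height).sub continuous_const).continuousOn
    · refine (ae_restrict_iff' χ.isOpen_paramDom.measurableSet).2
        (Eventually.of_forall fun x hx => ?_)
      exact (ContinuousLinearMap.le_opNorm _ _).trans (mul_le_mul_of_nonneg_left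
        (norm_graphNormal_sub_le χ (χ.paramDom_subset_base hx)) (norm_nonneg _))
  have mono : ∫ x, ‖Φ x‖ ∂χ.paramMeasure ≤ ∫ x, ‖Φ x‖ ∂μ :=
    integral_mono_measure hle (Eventually.of_forall fun x => norm_nonneg _) j3
  have b1 : ‖∫ x in χ.paramDom, Φ (χ.param x) (graphNormal χ.frame χ.height x - w)‖ ≤
      δ * ∫ x, ‖Φ x‖ ∂μ := by
    refine (norm_integral_le_of_norm_le (q3.mul_const δ) ?_).trans ?_
    · refine (ae_restrict_iff' χ.isOpen_paramDom.measurableSet).2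
        (Eventually.of_forall fun x hx => ?_)
      exact (ContinuousLinearMap.le_opNorm _ _).trans (mul_le_mul_of_nonneg_left
        (norm_graphNormal_sub_le χ (χ.paramDom_subset_base hx)) (norm_nonneg _))
    · rw [integral_mul_const, m3, mul_comm]
      gcongr
  have b2 : ‖∫ x, Φ x w ∂μ - ∫ x, Φ x w ∂χ.paramMeasure‖ ≤
      ((1 + δ) ^ (n - 1) - 1) * ∫ x, ‖Φ x‖ ∂μ := by
    have hC : 1 ≤ (1 + δ) ^ (n - 1) := one_le_pow₀ (by linarith)
    refine (norm_integral_sub_integral_le hC hle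
      (χ.surfaceMeasure_restrict_le hKo hδ) j1).trans ?_
    refine mul_le_mul_of_nonneg_left ?_ (by linarith)
    refine integral_mono j1.norm j3 fun x => ?_
    refine ((Φ x).le_opNorm w).trans ?_
    rw [hw, norm_frame_last, mul_one]
  have b3 : ‖∫ x, Φ x (outerNormal K x) ∂μ - ∫ x, Φ x w ∂μ‖ ≤ δ * ∫ x, ‖Φ x‖ ∂μ := by
    rw [← integral_sub j2 j1]
    refine (norm_integral_le_of_norm_le (j3.mul_const δ) ?_).trans ?_
    · filter_upwards [ae_restrict_mem χ.isOpen_dom.measurableSet,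
        ae_restrict_of_ae (ae_surfaceMeasure_mem K)] with x hx1 hx2
      rw [← map_sub]
      exact ((Φ x).le_opNorm _).trans
        (mul_le_mul_of_nonneg_left (χ.normal_le x hx1 hx2) (norm_nonneg _))
    · rw [integral_mul_const, mul_comm]
  have split : ∫ x in χ.paramDom, Φ (χ.param x) (graphNormal χ.frame χ.height x) =
      (∫ x in χ.paramDom, Φ (χ.param x) (graphNormal χ.frame χ.height x - w)) +
        ∫ x, Φ x w ∂χ.paramMeasure := by
    rw [← m1, ← integral_add q0 q1]
    refine integral_congr_ae (Eventually.of_forall fun x => ?_)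
    simp
  rw [χ.integral_divergence hKo hcpt hsub hd hc hi, split, r2, r3]
  set A := ∫ x in χ.paramDom, Φ (χ.param x) (graphNormal χ.frame χ.height x - w)
  have : A + ∫ x, Φ x w ∂χ.paramMeasure - ∫ x, Φ x (outerNormal K x) ∂μ =
      A - (∫ x, Φ x w ∂μ - ∫ x, Φ x w ∂χ.paramMeasure) -
        (∫ x, Φ x (outerNormal K x) ∂μ - ∫ x, Φ x w ∂μ) := by abel
  rw [this]
  refine (norm_sub_le _ _).trans ((add_le_add_left (norm_sub_le _ _) _).trans ?_)
  linarith

end LocalEstimate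

/-! ### The divergence theorem on a bounded domain with C¹ boundary -/

section DivergenceTheorem

variable {n : ℕ} {K : Set (Vec n)} {X : Type*} [NormedAddCommGroup X] [NormedSpace ℝ X]

theorem integrableOn_of_continuousOn_closure (hKb : Bornology.IsBounded K) {Y : Type*}
    [NormedAddCommGroup Y] {g : Vec n → Y} (hg : ContinuousOn g (closure K)) :
    IntegrableOn g K :=
  (hg.integrableOn_compact hKb.isCompact_closure).mono_set subset_closure

theorem continuous_gradient {V : Type*} [NormedAddCommGroup V] [InnerProductSpace ℝ V]
    [CompleteSpace V] {φ : V → ℝ} (hφ : ContDiff ℝ 1 φ) : Continuous (∇ φ) :=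
  (InnerProductSpace.toDual ℝ V).symm.continuous.comp (hφ.continuous_fderiv one_ne_zero)

theorem integrableOn_divergence_smul (hKo : IsOpen K) (hKb : Bornology.IsBounded K)
    {φ : Vec n → ℝ} (hφ : ContDiff ℝ 1 φ) {Φ : Vec n → Vec n →L[ℝ] X} (hd : ContDiffOn ℝ 1 Φ K)
    (hc : ContinuousOn Φ (closure K)) (hi : IntegrableOn (divergence Φ) K) :
    IntegrableOn (divergence fun z => φ z • Φ z) K := by
  have h1 : IntegrableOn (fun z => φ z • divergence Φ z + Φ z (∇ φ z)) K := by
    refine Integrable.add ?_ ?_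
    · obtain ⟨C, hC⟩ := (hKb.isCompact_closure.image hφ.continuous).isBounded.exists_norm_le
      refine Integrable.bdd_smul hi C hφ.continuous.aestronglyMeasurable ?_
      refine (ae_restrict_iff' hKo.measurableSet).2 (Eventually.of_forall fun x hx => ?_)
      exact hC _ ⟨x, subset_closure hx, rfl⟩
    · exact integrableOn_of_continuousOn_closure hKb
        (hc.clm_apply (continuous_gradient hφ).continuousOn)
  refine h1.congr_fun (fun z hz => ?_) hKo.measurableSet
  exact (divergence_smul (hφ.differentiable one_ne_zero z)
    ((hd.contDiffAt (hKo.mem_nhds hz)).differentiableAt one_ne_zero)).symm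

/-- A partition of unity is nonnegative with sum 1, so the norms of the pieces add up exactly to
‖Φ‖. The total error thus has the same constant as one chart, although the number of charts grows as
δ shrinks. -/
theorem norm_integral_divergence_sub_le [CompleteSpace X] (hn : 0 < n) (hKo : IsOpen K)
    (hKb : Bornology.IsBounded K) (hKs : HasC1Boundary K) {Φ : Vec n → Vec n →L[ℝ] X}
    (hd : ContDiffOn ℝ 1 Φ K) (hc : ContinuousOn Φ (closure K))
    (hi : IntegrableOn (divergence Φ) K) {δ : ℝ} (hδ : 0 < δ) :
    ‖(∫ x in K, divergence Φ x) - ∫ x, Φ x (outerNormal K x) ∂surfaceMeasure K‖ ≤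
      (2 * δ + ((1 + δ) ^ (n - 1) - 1)) * ∫ x, ‖Φ x‖ ∂surfaceMeasure K := by
  have hfc : IsCompact (frontier K) :=
    hKb.isCompact_closure.of_isClosed_subset isClosed_frontier frontier_subset_closure
  choose χ hχ using fun x (hx : x ∈ frontier K) => exists_boundaryChart hn hKo hKs hx hδ
  obtain ⟨t, htc⟩ := hfc.elim_nhds_subcover' (fun x hx => (χ x hx).dom)
    fun x hx => (χ x hx).isOpen_dom.mem_nhds (hχ x hx)
  -- The index `none` stands for the interior piece, supported in K itself.
  let U : Option t → Set (Vec n) := fun i => i.elim K fun x => (χ x.1.1 x.1.2).dom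
  have hUo : ∀ i, IsOpen (U i) := by
    rintro (_ | x)
    · exact hKo
    · exact (χ x.1.1 x.1.2).isOpen_dom
  have hUb : ∀ i, Bornology.IsBounded (U i) := by
    rintro (_ | x)
    · exact hKb
    · exact (χ x.1.1 x.1.2).isBounded_dom
  have hUc : closure K ⊆ ⋃ i, U i := by
    intro x hx
    by_cases hxK : x ∈ K
    · exact mem_iUnion.2 ⟨none, hxK⟩
    · have hxf : x ∈ frontier K := ⟨hx, fun h => hxK (interior_subset h)⟩
      obtain ⟨z, hz, hxz⟩ := mem_iUnion₂.1 (htc hxf)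
      exact mem_iUnion.2 ⟨some ⟨z, hz⟩, hxz⟩
  obtain ⟨φ, hφ⟩ := SmoothPartitionOfUnity.exists_isSubordinate (modelWithCornersSelf ℝ (Vec n))
    (isClosed_closure (s := K)) U hUo hUc
  have hφd : ∀ i, ContDiff ℝ 1 (φ i) := fun i => (φ i).contMDiff.contDiff.of_le (by simp)
  have hφ1 : ∀ x ∈ closure K, ∑ i, φ i x = 1 := fun x hx => by
    rw [← finsum_eq_sum_of_fintype]
    exact φ.sum_eq_one hx
  have hφ0 : ∀ i x, 0 ≤ φ i x := φ.nonneg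
  let Ψ : Option t → Vec n → Vec n →L[ℝ] X := fun i z => φ i z • Φ z
  have hts : ∀ i, tsupport (Ψ i) ⊆ tsupport (φ i) := fun i => tsupport_smul_subset_left _ _
  have hsub : ∀ i, tsupport (Ψ i) ⊆ U i := fun i => (hts i).trans (hφ i)
  have hcpt : ∀ i, HasCompactSupport (Ψ i) := fun i =>
    Metric.isCompact_of_isClosed_isBounded (isClosed_tsupport _) ((hUb i).subset (hsub i))
  have hΨd : ∀ i, ContDiffOn ℝ 1 (Ψ i) K := fun i => (hφd i).contDiffOn.smul hd
  have hΨc : ∀ i, ContinuousOn (Ψ i) (closure K) := fun i =>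
    (hφd i).continuous.continuousOn.smul hc
  have hΨi : ∀ i, IntegrableOn (divergence (Ψ i)) K := fun i =>
    integrableOn_divergence_smul hKo hKb (hφd i) hd hc hi
  have hsum : ∀ x ∈ closure K, ∑ i, Ψ i x = Φ x := fun x hx => by
    simp only [Ψ]
    rw [← Finset.sum_smul, hφ1 x hx, one_smul]
  have e1 : ∫ x in K, divergence Φ x = ∑ i, ∫ x in K, divergence (Ψ i) x := by
    rw [← integral_finsetSum _ fun i _ => hΨi i]
    refine setIntegral_congr_fun hKo.measurableSet fun x hx => ?_
    rw [← divergence_sum fun i _ =>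
      ((hΨd i).contDiffAt (hKo.mem_nhds hx)).differentiableAt one_ne_zero]
    refine divergence_congr ?_
    filter_upwards [hKo.mem_nhds hx] with z hz using (hsum z (subset_closure hz)).symm
  have hΨs : ∀ i, Integrable (fun x => Ψ i x (outerNormal K x)) (surfaceMeasure K) := fun i =>
    integrable_surfaceMeasure hn hKo hKb hKs (((hΨc i).mono frontier_subset_closure).clm_apply
      (continuousOn_outerNormal hKo hKs))
  have hΨn : ∀ i, Integrable (fun x => ‖Ψ i x‖) (surfaceMeasure K) := fun i =>
    integrable_surfaceMeasure hn hKo hKb hKs ((hΨc i).mono frontier_subset_closure).norm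
  have e2 : ∫ x, Φ x (outerNormal K x) ∂surfaceMeasure K =
      ∑ i, ∫ x, Ψ i x (outerNormal K x) ∂surfaceMeasure K := by
    rw [← integral_finsetSum _ fun i _ => hΨs i]
    refine integral_congr_ae ?_
    filter_upwards [ae_surfaceMeasure_mem K] with x hx
    rw [← hsum x (frontier_subset_closure hx), sum_apply]
  have e3 : ∫ x, ‖Φ x‖ ∂surfaceMeasure K = ∑ i, ∫ x, ‖Ψ i x‖ ∂surfaceMeasure K := by
    rw [← integral_finsetSum _ fun i _ => hΨn i]
    refine integral_congr_ae ?_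
    filter_upwards [ae_surfaceMeasure_mem K] with x hx
    simp only [Ψ, norm_smul, Real.norm_of_nonneg (hφ0 _ _)]
    rw [← Finset.sum_mul, hφ1 x (frontier_subset_closure hx), one_mul]
  rw [e1, e2, e3, ← Finset.sum_sub_distrib, Finset.mul_sum]
  refine (norm_sum_le _ _).trans (Finset.sum_le_sum fun i _ => ?_)
  rcases i with _ | x
  -- The interior piece is C¹ with compact support on the whole space and vanishes on the boundary,
  -- so it contributes no error.
  · have h0 : ∫ x in K, divergence (Ψ none) x = 0 := by
      have hg : ContDiff ℝ 1 (Ψ none) := contDiff_iff_contDiffAt.2 fun x => by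
        by_cases hx : x ∈ tsupport (Ψ none)
        · exact (hΨd none).contDiffAt (hKo.mem_nhds (hsub none hx))
        · exact contDiffAt_const.congr_of_eventuallyEq (notMem_tsupport_iff_eventuallyEq.1 hx)
      rw [← integral_divergence_eq_zero hg (hcpt none)]
      exact setIntegral_eq_integral_of_forall_compl_eq_zero fun x hx =>
        divergence_of_notMem_tsupport fun h => hx (hsub none h)
    have h1 : ∀ᵐ x ∂surfaceMeasure K, Ψ none x = 0 := by
      filter_upwards [ae_surfaceMeasure_mem K] with x hx
      refine image_eq_zero_of_notMem_tsupport fun h => ?_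
      exact hx.2 (by rw [hKo.interior_eq]; exact hsub none h)
    have h2 : ∫ x, Ψ none x (outerNormal K x) ∂surfaceMeasure K = 0 := by
      refine integral_eq_zero_of_ae ?_
      filter_upwards [h1] with x hx
      simp [hx]
    have h3 : ∫ x, ‖Ψ none x‖ ∂surfaceMeasure K = 0 := by
      refine integral_eq_zero_of_ae ?_
      filter_upwards [h1] with x hx
      simp [hx]
    rw [h0, h2, h3]
    simp
  · exact (χ x.1.1 x.1.2).norm_integral_divergence_sub_le hn hδ.le hKo hKb hKs (hcpt _) (hsub (some x))
      (hΨd _) (hΨc _) (hΨi _)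

/-- **The divergence theorem** for bounded open sets with `C¹` boundary. -/
theorem integral_divergence_eq_integral_surfaceMeasure [CompleteSpace X] (hn : 0 < n)
    (hKo : IsOpen K) (hKb : Bornology.IsBounded K) (hKs : HasC1Boundary K)
    {Φ : Vec n → Vec n →L[ℝ] X} (hd : ContDiffOn ℝ 1 Φ K) (hc : ContinuousOn Φ (closure K))
    (hi : IntegrableOn (divergence Φ) K) :
    ∫ x in K, divergence Φ x = ∫ x, Φ x (outerNormal K x) ∂surfaceMeasure K := by
  have hlim : Tendsto (fun δ : ℝ => (2 * δ + ((1 + δ) ^ (n - 1) - 1)) *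
      ∫ x, ‖Φ x‖ ∂surfaceMeasure K) (𝓝[>] 0) (𝓝 0) := by
    have h1 : Continuous (fun δ : ℝ => (2 * δ + ((1 + δ) ^ (n - 1) - 1)) *
        ∫ x, ‖Φ x‖ ∂surfaceMeasure K) := by fun_prop
    have h2 := (h1.tendsto 0).mono_left (nhdsWithin_le_nhds (s := Ioi 0))
    simpa using h2
  have h3 : ‖(∫ x in K, divergence Φ x) - ∫ x, Φ x (outerNormal K x) ∂surfaceMeasure K‖ ≤ 0 := by
    refine ge_of_tendsto hlim ?_
    filter_upwards [self_mem_nhdsWithin] with δ hδ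
    exact norm_integral_divergence_sub_le hn hKo hKb hKs hd hc hi hδ
  exact sub_eq_zero.1 (norm_le_zero_iff.1 h3)

end DivergenceTheorem

/-! ### Algebra of the reflection and of the kernels -/

section CliffordAlgebraFacts

variable {n : ℕ} [NeZero n]

theorem hat_hat (A : Cl n) : hat (hat A) = A := by
  have h : (hat (n := n)).comp hat = AlgHom.id ℝ (Cl n) := by
    refine CliffordAlgebra.hom_ext (LinearMap.ext fun x => ?_)
    change hat (hat (vec x)) = vec x
    rw [hat_vec, hat_vec]
    congr 1
    ext i
    rw [reflect_apply, reflect_apply]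
    split_ifs <;> simp
  exact DFunLike.congr_fun h A

theorem reflect_reflect (x : Vec n) : reflect n (reflect n x) = x := by
  ext i
  rw [reflect_apply, reflect_apply]
  split_ifs <;> simp

theorem vec_mul_self (v : Vec n) : vec v * vec v = -((‖v‖ ^ 2) • (1 : Cl n)) := by
  rw [CliffordAlgebra.ι_sq_scalar, negSq_apply, map_neg, Algebra.algebraMap_eq_smul_one]

theorem inner_basisVec (v : Vec n) (j : Fin n) : inner ℝ v (basisVec n j) = v j := by
  simp [basisVec, EuclideanSpace.inner_single_right]

theorem e_mul_vec (v : Vec n) (j : Fin n) :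
    e n j * vec v = -(vec v * e n j) - (2 * v j) • (1 : Cl n) := by
  have h := CliffordAlgebra.ι_mul_ι_add_swap (Q := negSq n) (basisVec n j) v
  have h2 : QuadraticMap.polar (negSq n) (basisVec n j) v = -(2 * v j) := by
    simp only [QuadraticMap.polar, negSq_apply, norm_add_sq_real]
    rw [real_inner_comm, inner_basisVec]
    ring
  rw [h2, Algebra.algebraMap_eq_smul_one] at h
  rw [e, eq_sub_iff_add_eq, ← sub_eq_zero]
  have h3 : vec (basisVec n j) * vec v + (2 * v j) • (1 : Cl n) - -(vec v * vec (basisVec n j)) =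
      (vec (basisVec n j) * vec v + vec v * vec (basisVec n j)) + (2 * v j) • (1 : Cl n) := by abel
  rw [h3]
  change CliffordAlgebra.ι (negSq n) _ * CliffordAlgebra.ι (negSq n) _ + _ + _ = _
  rw [h, neg_smul, neg_add_cancel]

theorem reflect_eq (v : Vec n) :
    reflect n v = v - (2 * v (lastIdx n)) • basisVec n (lastIdx n) := rfl

theorem hat_vec_eq (v : Vec n) :
    hat (vec v) = vec v - (2 * v (lastIdx n)) • e n (lastIdx n) := by
  rw [hat_vec, reflect_eq, map_sub, map_smul]
  rfl

theorem vec_sub_reflect (x y : Vec n) :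
    vec (x - y) = vec (x - reflect n y) - (2 * y (lastIdx n)) • e n (lastIdx n) := by
  rw [reflect_eq, e, ← map_smul, ← map_sub]
  congr 1
  abel

theorem sub_reflect_last (x y : Vec n) :
    (x - reflect n y) (lastIdx n) = x (lastIdx n) + y (lastIdx n) := by
  rw [PiLp.sub_apply, reflect_apply, if_pos rfl, sub_neg_eq_add]

/-- With B = x - ŷ, both x - y and the conjugate of B are B minus a multiple of e_n; expanding and
commuting e_n past B leaves only the factor x_n. This is the algebraic source of the 1 / x_n in M.
-/
theorem vec_mul_vec_sub_vec_mul_hat (x y : Vec n) :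
    vec (x - reflect n y) * vec (x - reflect n y) - vec (x - y) * hat (vec (x - reflect n y)) =
      (2 * x (lastIdx n)) • (vec (x - reflect n y) * e n (lastIdx n)) := by
  rw [hat_vec_eq, vec_sub_reflect x y, sub_reflect_last]
  simp only [sub_mul, mul_sub, smul_mul_assoc, mul_smul_comm, e_mul_self, e_mul_vec,
    sub_reflect_last]
  module

/-- Because F(x,y) is the conjugate of E(x,ŷ), this makes the derivative terms of E and of F produce
the same product A B. -/
theorem hat_mul_hat_eq (x y : Vec n) :
    hat (vec (x - reflect n y)) * hat (vec (x - y)) = vec (x - y) * vec (x - reflect n y) := by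
  rw [hat_vec_eq, hat_vec_eq, vec_sub_reflect x y, sub_reflect_last, PiLp.sub_apply]
  simp only [sub_mul, mul_sub, smul_mul_assoc, mul_smul_comm, e_mul_self, e_mul_vec,
    sub_reflect_last]
  module

theorem norm_sub_reflect_sq_sub (x y : Vec n) :
    ‖x - reflect n y‖ ^ 2 - ‖x - y‖ ^ 2 = 4 * x (lastIdx n) * y (lastIdx n) := by
  have h : x - reflect n y = (x - y) + (2 * y (lastIdx n)) • basisVec n (lastIdx n) := by
    rw [reflect_eq]; abel
  rw [h, norm_add_sq_real, real_inner_smul_right, inner_basisVec, norm_smul, PiLp.sub_apply]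
  simp only [basisVec, PiLp.norm_single, norm_one, mul_one, Real.norm_eq_abs, sq_abs]
  ring

theorem norm_reflect_sub (x y : Vec n) : ‖reflect n x - y‖ = ‖x - reflect n y‖ := by
  rw [← norm_reflect n (reflect n x - y), map_sub, reflect_reflect]

theorem vec_reflect_sub (x y : Vec n) : vec (reflect n x - y) = hat (vec (x - reflect n y)) := by
  rw [hat_vec]
  congr 1
  rw [map_sub, reflect_reflect]

theorem Q'_eq (A : Cl n) : Q' A = -((1 / 2 : ℝ) • (e n (lastIdx n) * (A - hat A))) := by
  simp only [Q', Q, mul_neg, neg_mul, neg_neg, mul_smul_comm, smul_mul_assoc, mul_assoc, e_mul_self,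
    mul_one, smul_neg]

theorem P_hat (A : Cl n) : P (hat A) = P A := by
  rw [P, P, hat_hat, add_comm]

theorem Q_hat (A : Cl n) : Q (hat A) = -Q A := by
  rw [Q, Q, hat_hat, ← neg_sub A (hat A), neg_mul, smul_neg]

theorem E_eq (hn : 2 < n) (x y : Vec n) :
    E x y = -(((‖x - y‖ ^ n)⁻¹ * (‖x - reflect n y‖ ^ (n - 2))⁻¹) • vec (x - y)) := by
  have h : ‖x - y‖ ^ n = ‖x - y‖ ^ (n - 2) * ‖x - y‖ ^ 2 := by
    rw [← pow_add]; congr 1; omega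
  rw [E, vecInv, smul_neg, smul_smul, h]
  congr 2
  rw [one_div, mul_inv, mul_inv]
  ring

theorem F_eq (x y : Vec n) : F x y = hat (E x (reflect n y)) := by
  rw [F, E, reflect_reflect, map_smul, norm_reflect_sub, vecInv, vecInv, map_neg, map_smul,
    vec_reflect_sub, norm_reflect_sub, mul_comm (‖x - y‖ ^ (n - 2))]

/-- Over the common denominator the numerator of E - F is A (B B - A B̂), since squares of vectors
are minus their squared norms; then `vec_mul_vec_sub_vec_mul_hat` applies. -/
theorem E_sub_F_mul (hn : 2 < n) {x y : Vec n} (h1 : x ≠ y) (h2 : x ≠ reflect n y) :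
    (E x y - F x y) * e n (lastIdx n) = -((2 * x (lastIdx n) *
      ((‖x - y‖ ^ n)⁻¹ * (‖x - reflect n y‖ ^ n)⁻¹)) • (vec (x - y) * vec (x - reflect n y))) := by
  have ha : ‖x - y‖ ≠ 0 := norm_ne_zero_iff.2 (sub_ne_zero.2 h1)
  have hb : ‖x - reflect n y‖ ≠ 0 := norm_ne_zero_iff.2 (sub_ne_zero.2 h2)
  have pa : (‖x - y‖ ^ (n - 2))⁻¹ = (‖x - y‖ ^ n)⁻¹ * ‖x - y‖ ^ 2 := by
    rw [eq_comm, inv_mul_eq_iff_eq_mul₀ (by positivity), ← div_eq_mul_inv,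
      eq_div_iff (by positivity), ← pow_add]
    congr 1; omega
  have pb : (‖x - reflect n y‖ ^ (n - 2))⁻¹ =
      (‖x - reflect n y‖ ^ n)⁻¹ * ‖x - reflect n y‖ ^ 2 := by
    rw [eq_comm, inv_mul_eq_iff_eq_mul₀ (by positivity), ← div_eq_mul_inv,
      eq_div_iff (by positivity), ← pow_add]
    congr 1; omega
  rw [F_eq, E_eq hn, E_eq hn, map_neg, map_smul, reflect_reflect, pa, pb]
  set κ := (‖x - y‖ ^ n)⁻¹ * (‖x - reflect n y‖ ^ n)⁻¹ with hκ
  set A := vec (x - y) with hA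
  set B := vec (x - reflect n y) with hB
  have e1 : (-(((‖x - y‖ ^ n)⁻¹ * ((‖x - reflect n y‖ ^ n)⁻¹ * ‖x - reflect n y‖ ^ 2)) • A) -
      -(((‖x - reflect n y‖ ^ n)⁻¹ * ((‖x - y‖ ^ n)⁻¹ * ‖x - y‖ ^ 2)) • hat B)) =
      κ • (A * (B * B - A * hat B)) := by
    rw [mul_sub, ← mul_assoc A A, hA, hB, vec_mul_self, vec_mul_self, hκ]
    simp only [mul_neg, neg_mul, mul_smul_comm, smul_mul_assoc, mul_one, one_mul]
    module
  rw [e1, hA, hB, vec_mul_vec_sub_vec_mul_hat]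
  simp only [mul_smul_comm, smul_mul_assoc, mul_assoc, e_mul_self, mul_neg, mul_one]
  module

end CliffordAlgebraFacts

/-! ### Differentiating products in the Clifford algebra -/

section CliffordCalculus

variable {n : ℕ} {V : Type*} [NormedAddCommGroup V] [NormedSpace ℝ V]

/-- Multiplication in `Cl_n` as a continuous bilinear map. -/
def mulL (n : ℕ) : Cl n →L[ℝ] Cl n →L[ℝ] Cl n := (LinearMap.mul ℝ (Cl n)).toContinuousBilinearMap

/-- The inclusion `ℝⁿ ⊆ Cl_n` as a continuous linear map. -/
def vecL (n : ℕ) : Vec n →L[ℝ] Cl n := LinearMap.toContinuousLinearMap vec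

theorem vecL_apply (v : Vec n) : vecL n v = vec v := rfl

/-- The automorphism `A ↦ Â` as a continuous linear map. -/
def hatL (n : ℕ) [NeZero n] : Cl n →L[ℝ] Cl n :=
  LinearMap.toContinuousLinearMap (hat (n := n)).toLinearMap

theorem hatL_apply [NeZero n] (a : Cl n) : hatL n a = hat a := rfl

theorem differentiableAt_cl_mul {f g : V → Cl n} {x : V} (hf : DifferentiableAt ℝ f x)
    (hg : DifferentiableAt ℝ g x) : DifferentiableAt ℝ (fun z => f z * g z) x :=
  ((mulL n).hasFDerivAt_of_bilinear hf.hasFDerivAt hg.hasFDerivAt).differentiableAt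

theorem fderiv_cl_mul {f g : V → Cl n} {x : V} (hf : DifferentiableAt ℝ f x)
    (hg : DifferentiableAt ℝ g x) (v : V) :
    fderiv ℝ (fun z => f z * g z) x v = f x * fderiv ℝ g x v + fderiv ℝ f x v * g x := by
  have h : HasFDerivAt (fun z => f z * g z) _ x :=
    (mulL n).hasFDerivAt_of_bilinear hf.hasFDerivAt hg.hasFDerivAt
  rw [h.fderiv]
  rfl

theorem continuousOn_cl_mul {Y : Type*} [TopologicalSpace Y] {f g : Y → Cl n} {s : Set Y}
    (hf : ContinuousOn f s) (hg : ContinuousOn g s) : ContinuousOn (fun z => f z * g z) s :=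
  ((mulL n).continuous.comp_continuousOn hf).clm_apply hg

theorem differentiableAt_hat [NeZero n] {f : V → Cl n} {x : V} (hf : DifferentiableAt ℝ f x) :
    DifferentiableAt ℝ (fun z => hat (f z)) x :=
  (hatL n).differentiableAt.comp x hf

theorem fderiv_hat [NeZero n] {f : V → Cl n} {x : V} (hf : DifferentiableAt ℝ f x) (v : V) :
    fderiv ℝ (fun z => hat (f z)) x v = hat (fderiv ℝ f x v) := by
  have h : HasFDerivAt (fun z => hat (f z)) _ x := (hatL n).hasFDerivAt.comp x hf.hasFDerivAt
  rw [h.fderiv]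
  rfl

/-- The linear map `v ↦ a v b`, as a function of `a` and `b`. -/
def sandwich (n : ℕ) : Cl n →L[ℝ] Cl n →L[ℝ] Vec n →L[ℝ] Cl n :=
  (LinearMap.mk₂ ℝ (fun a b : Cl n => LinearMap.toContinuousLinearMap
    (LinearMap.mulLeft ℝ a ∘ₗ LinearMap.mulRight ℝ b ∘ₗ vec))
    (fun a a' b => by ext v; simp [add_mul])
    (fun r a b => by ext v; simp)
    (fun a b b' => by ext v; simp [mul_add])
    (fun r a b => by ext v; simp)).toContinuousBilinearMap

theorem sandwich_apply (a b : Cl n) (v : Vec n) : sandwich n a b v = a * vec v * b := by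
  rw [mul_assoc]; rfl

end CliffordCalculus

/-! ### Gradients of radial weights and the right Dirac operator -/

section KernelCalculus

variable {n : ℕ} [NeZero n]

theorem hasGradientAt_inv_norm_pow {V : Type*} [NormedAddCommGroup V] [InnerProductSpace ℝ V]
    [CompleteSpace V] (m : ℕ) {c z : V} (h : z ≠ c) :
    HasGradientAt (fun z => (‖z - c‖ ^ m)⁻¹) (-(m * (‖z - c‖ ^ (m + 2))⁻¹) • (z - c)) z := by
  have h0 : ‖z - c‖ ≠ 0 := norm_ne_zero_iff.2 (sub_ne_zero.2 h)
  have h1 : HasFDerivAt (fun z : V => ‖z - c‖ ^ 2) (2 • (innerSL ℝ (z - c))) z := by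
    simpa using ((hasFDerivAt_id z).sub_const c).norm_sq
  have h2 : HasFDerivAt (fun z : V => ‖z - c‖) ((‖z - c‖)⁻¹ • innerSL ℝ (z - c)) z := by
    have h3 := h1.sqrt (by positivity)
    simp only [Real.sqrt_sq (norm_nonneg _)] at h3
    refine h3.congr_fderiv ?_
    ext v
    simp
    field_simp
  have h4 := (hasDerivAt_pow m ‖z - c‖).inv (pow_ne_zero m h0)
  have h5 := h4.comp_hasFDerivAt z h2
  rw [hasGradientAt_iff_hasFDerivAt]
  refine HasFDerivAt.congr_fderiv (f := fun z => (‖z - c‖ ^ m)⁻¹) h5 ?_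
  ext v
  simp only [smul_apply, innerSL_apply_apply, InnerProductSpace.toDual_apply_apply,
    real_inner_smul_left, smul_eq_mul]
  rcases m with _ | m
  · simp
  · rw [Nat.add_sub_cancel]
    field_simp
    ring

theorem hasGradientAt_mul {V : Type*} [NormedAddCommGroup V] [InnerProductSpace ℝ V]
    [CompleteSpace V] {s t : V → ℝ} {a b z : V} (hs : HasGradientAt s a z)
    (ht : HasGradientAt t b z) : HasGradientAt (fun z => s z * t z) (s z • b + t z • a) z := by
  rw [hasGradientAt_iff_hasFDerivAt] at *
  refine (hs.mul ht).congr_fderiv ?_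
  rw [map_add, map_smulₛₗ, map_smulₛₗ]
  rfl

theorem diracD_algebraMap {s : Vec n → ℝ} {g x : Vec n} (hs : HasGradientAt s g x) :
    diracD (fun z => algebraMap ℝ (Cl n) (s z)) x = vec g := by
  have h1 := ((LinearMap.toContinuousLinearMap (Algebra.linearMap ℝ (Cl n))).hasFDerivAt).comp x
    hs.hasFDerivAt
  have h2 : fderiv ℝ (fun z => algebraMap ℝ (Cl n) (s z)) x = _ := h1.fderiv
  rw [diracD, h2, vec_eq_sum]
  refine Finset.sum_congr rfl fun j _ => ?_
  change e n j * algebraMap ℝ (Cl n) (inner ℝ g (basisVec n j)) = _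
  rw [inner_basisVec, Algebra.algebraMap_eq_smul_one, mul_smul_comm, mul_one]

/-- The n comes from the n terms e_j e_j = -1. -/
theorem rightDirac_smul_vec {s : Vec n → ℝ} {g x : Vec n} (c : Vec n) (hs : HasGradientAt s g x) :
    ∑ j, fderiv ℝ (fun z => s z • vec (z - c)) x (basisVec n j) * e n j =
      vec (x - c) * vec g - (n * s x) • (1 : Cl n) := by
  have h1 : HasFDerivAt (fun z => vec (z - c)) (vecL n) x :=
    (vecL n).hasFDerivAt.comp x ((hasFDerivAt_id x).sub_const c)
  have h2 : HasFDerivAt (fun z => s z • vec (z - c)) _ x := hs.hasFDerivAt.smul h1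
  have h3 : ∀ j, fderiv ℝ (fun z => s z • vec (z - c)) x (basisVec n j) * e n j =
      vec (x - c) * (g j • e n j) - s x • (1 : Cl n) := by
    intro j
    rw [h2.fderiv]
    simp only [add_apply, smul_apply, ContinuousLinearMap.smulRight_apply,
      InnerProductSpace.toDual_apply_apply, inner_basisVec, add_mul, smul_mul_assoc, vecL_apply,
      mul_smul_comm]
    change s x • (e n j * e n j) + _ = _
    rw [e_mul_self, smul_neg]
    abel
  simp only [h3, Finset.sum_sub_distrib, ← Finset.mul_sum, ← vec_eq_sum, Finset.sum_const,
    Finset.card_univ, Fintype.card_fin]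
  rw [← Nat.cast_smul_eq_nsmul ℝ, smul_smul]

theorem hasGradientAt_kernel_weight {V : Type*} [NormedAddCommGroup V] [InnerProductSpace ℝ V]
    [CompleteSpace V] (m l : ℕ) {c d z : V} (hc : z ≠ c) (hd : z ≠ d) :
    HasGradientAt (fun z => (‖z - c‖ ^ m)⁻¹ * (‖z - d‖ ^ l)⁻¹)
      (-((l * ((‖z - c‖ ^ m)⁻¹ * (‖z - d‖ ^ (l + 2))⁻¹)) • (z - d)) -
        (m * ((‖z - c‖ ^ (m + 2))⁻¹ * (‖z - d‖ ^ l)⁻¹)) • (z - c)) z := by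
  convert hasGradientAt_mul (hasGradientAt_inv_norm_pow m hc) (hasGradientAt_inv_norm_pow l hd)
    using 1
  module

/-- The contribution of ‖x - y‖^(-n) cancels against the n of `rightDirac_smul_vec`, so only the
gradient of the weight in ‖x - ŷ‖ survives. -/
theorem rightDirac_E (hn : 2 < n) {x y : Vec n} (h1 : x ≠ y) (h2 : x ≠ reflect n y) :
    ∑ j, fderiv ℝ (fun z => E z y) x (basisVec n j) * e n j =
      (((n : ℝ) - 2) * ((‖x - y‖ ^ n)⁻¹ * (‖x - reflect n y‖ ^ n)⁻¹)) •
        (vec (x - y) * vec (x - reflect n y)) := by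
  have ha : ‖x - y‖ ≠ 0 := norm_ne_zero_iff.2 (sub_ne_zero.2 h1)
  have h3 := rightDirac_smul_vec y (hasGradientAt_kernel_weight n (n - 2) h1 h2)
  have h4 : (fun z => E z y) = fun z => -(((‖z - y‖ ^ n)⁻¹ * (‖z - reflect n y‖ ^ (n - 2))⁻¹) •
      vec (z - y)) := funext fun z => E_eq hn z y
  rw [h4, fderiv_fun_neg]
  simp only [neg_apply, neg_mul, Finset.sum_neg_distrib]
  have h5 : (‖x - y‖ ^ (n + 2))⁻¹ * ‖x - y‖ ^ 2 = (‖x - y‖ ^ n)⁻¹ := by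
    rw [pow_add]; field_simp
  have h6 : ∀ (r t : ℝ) (u v : Vec n), vec (-(r • u) - t • v) = -(r • vec u) - t • vec v := by
    intro r t u v
    rw [map_sub, map_neg, map_smul, map_smul]
  rw [h3, Nat.sub_add_cancel hn.le, h6, mul_sub, mul_neg, mul_smul_comm, mul_smul_comm, vec_mul_self, ← h5, Nat.cast_sub hn.le]
  push_cast
  module

end KernelCalculus

/-! ### The kernels p and q through E, and the field whose divergence is computed -/

section Kernels

variable {n : ℕ} [NeZero n]

theorem q_eq (hn : 2 < n) {x y : Vec n} (h1 : x ≠ y) (h2 : x ≠ reflect n y) :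
    q x y = (1 / 2 : ℝ) • (E x y + E x (reflect n y)) := by
  have hk : (n : ℝ) - 2 ≠ 0 := by
    have : (2 : ℝ) < n := by exact_mod_cast hn
    linarith
  have h3 := hasGradientAt_kernel_weight (n - 2) (n - 2) h1 h2
  have h4 : (fun z => algebraMap ℝ (Cl n)
      (1 / (‖z - y‖ ^ (n - 2) * ‖z - reflect n y‖ ^ (n - 2)))) =
      fun z => algebraMap ℝ (Cl n) ((‖z - y‖ ^ (n - 2))⁻¹ * (‖z - reflect n y‖ ^ (n - 2))⁻¹) := by
    funext z
    rw [one_div, mul_inv]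
  have h6 : ∀ (r t : ℝ) (u v : Vec n), vec (-(r • u) - t • v) = -(r • vec u) - t • vec v := by
    intro r t u v
    rw [map_sub, map_neg, map_smul, map_smul]
  rw [q, h4, diracD_algebraMap h3, E_eq hn, E_eq hn, reflect_reflect, Nat.sub_add_cancel hn.le, h6,
    Nat.cast_sub hn.le]
  push_cast
  have h7 : 1 / (2 * ((n : ℝ) - 2)) = (1 / 2) * ((n : ℝ) - 2)⁻¹ := by
    rw [one_div, mul_inv, one_div]
  rw [h7, mul_smul, smul_sub, smul_neg, smul_smul, smul_smul, inv_mul_cancel_left₀ hk,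
    inv_mul_cancel_left₀ hk, mul_comm (‖x - reflect n y‖ ^ n)⁻¹]
  module

theorem weight_quotient (k : ℕ) {α β : ℝ} (hα : 0 < α) (hβ : 0 < β) :
    (1 - (α / β) ^ 2) ^ k / (α / β) ^ (k + 1) =
      (β ^ 2 - α ^ 2) ^ k * β * (β ^ k * α ^ (k + 1))⁻¹ := by
  have h1 : 1 - (α / β) ^ 2 = (β ^ 2 - α ^ 2) / β ^ 2 := by field_simp
  rw [h1, div_pow, div_pow]
  field_simp
  ring

theorem hasDerivAt_integral_weight (k : ℕ) {τ : ℝ} (hτ : 0 < τ) :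
    HasDerivAt (fun u : ℝ => ∫ t in u..1, (1 - t ^ 2) ^ k / t ^ (k + 1))
      (-((1 - τ ^ 2) ^ k / τ ^ (k + 1))) τ := by
  have hc : ∀ t : ℝ, 0 < t → ContinuousAt (fun t : ℝ => (1 - t ^ 2) ^ k / t ^ (k + 1)) t :=
    fun t ht => by
      have : t ^ (k + 1) ≠ 0 := by positivity
      fun_prop (disch := assumption)
  have hco : ContinuousOn (fun t : ℝ => (1 - t ^ 2) ^ k / t ^ (k + 1)) (Ioi 0) :=
    fun t ht => (hc t ht).continuousWithinAt
  refine intervalIntegral.integral_hasDerivAt_left ?_ ?_ (hc τ hτ)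
  · refine (hco.mono fun t ht => ?_).intervalIntegrable
    exact (lt_min hτ one_pos).trans_le ht.1
  · exact hco.stronglyMeasurableAtFilter isOpen_Ioi τ hτ

theorem hasGradientAt_norm_sub {V : Type*} [NormedAddCommGroup V] [InnerProductSpace ℝ V]
    [CompleteSpace V] {c z : V} (h : z ≠ c) :
    HasGradientAt (fun z => ‖z - c‖) (‖z - c‖⁻¹ • (z - c)) z := by
  have h0 : 0 < ‖z - c‖ := norm_pos_iff.2 (sub_ne_zero.2 h)
  have h3 := (((hasFDerivAt_id z).sub_const c).norm_sq).sqrt (by simpa using h0.ne')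
  simp only [id, Real.sqrt_sq (norm_nonneg _)] at h3
  rw [hasGradientAt_iff_hasFDerivAt]
  refine h3.congr_fderiv ?_
  ext v
  simp
  field_simp

theorem hasGradientAt_comp {V : Type*} [NormedAddCommGroup V] [InnerProductSpace ℝ V]
    [CompleteSpace V] {φ : ℝ → ℝ} {c : ℝ} {s : V → ℝ} {g z : V} (hφ : HasDerivAt φ c (s z))
    (hs : HasGradientAt s g z) : HasGradientAt (fun z => φ (s z)) (c • g) z := by
  rw [hasGradientAt_iff_hasFDerivAt, map_smulₛₗ]
  exact hφ.comp_hasFDerivAt z hs.hasFDerivAt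

theorem contDiffAt_bilin {V X Y Z : Type*} [NormedAddCommGroup V] [NormedSpace ℝ V]
    [NormedAddCommGroup X] [NormedSpace ℝ X] [NormedAddCommGroup Y] [NormedSpace ℝ Y]
    [NormedAddCommGroup Z] [NormedSpace ℝ Z] (B : X →L[ℝ] Y →L[ℝ] Z) {f : V → X} {g : V → Y}
    {x : V} {m : WithTop ℕ∞} (hf : ContDiffAt ℝ m f x) (hg : ContDiffAt ℝ m g x) :
    ContDiffAt ℝ m (fun z => B (f z) (g z)) x :=
  (B.contDiff.contDiffAt.comp x hf).clm_apply hg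

/-- Chain rule for G as a function of the ratio τ = ‖x - y‖ / ‖x - ŷ‖. The numerator of 1 - τ² is ‖x
- ŷ‖² - ‖x - y‖² = 4 x_n y_n, whose power comes out, and the gradients of the two norms give the two
values of E. -/
theorem p_eq (hn : 2 < n) {x y : Vec n} (h1 : x ≠ y) (h2 : x ≠ reflect n y) :
    p x y = (4 * x (lastIdx n) * y (lastIdx n)) ^ (n - 2) • (E x y - E x (reflect n y)) := by
  have ha : 0 < ‖x - y‖ := norm_pos_iff.2 (sub_ne_zero.2 h1)
  have hb : 0 < ‖x - reflect n y‖ := norm_pos_iff.2 (sub_ne_zero.2 h2)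
  obtain ⟨k, hk⟩ : ∃ k, n = k + 2 := ⟨n - 2, by omega⟩
  have e1 : n - 2 = k := by omega
  have e2 : n - 1 = k + 1 := by omega
  have g1 := hasGradientAt_mul (hasGradientAt_norm_sub h1) (hasGradientAt_inv_norm_pow 1 h2)
  have hτ : 0 < ‖x - y‖ / ‖x - reflect n y‖ := by positivity
  have hd := hasDerivAt_integral_weight k hτ
  have hτe : ‖x - y‖ / ‖x - reflect n y‖ = ‖x - y‖ * (‖x - reflect n y‖ ^ 1)⁻¹ := by
    rw [pow_one, div_eq_mul_inv]
  rw [weight_quotient k ha hb, hτe] at hd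
  have g2 := hasGradientAt_comp (s := fun z => ‖z - y‖ * (‖z - reflect n y‖ ^ 1)⁻¹) hd g1
  have h4 : p x y = diracD (fun z => algebraMap ℝ (Cl n)
      (∫ t in (‖z - y‖ * (‖z - reflect n y‖ ^ 1)⁻¹)..1, (1 - t ^ 2) ^ k / t ^ (k + 1))) x := by
    simp only [p, G, e1, e2, pow_one, div_eq_mul_inv]
  rw [h4, diracD_algebraMap g2, ← norm_sub_reflect_sq_sub, E_eq hn, E_eq hn, reflect_reflect, e1]
  have h6 : ∀ (r s t u : ℝ) (v w : Vec n), vec (r • (s • (t • v) + u • w)) =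
      (r * s * t) • vec v + (r * u) • vec w := by
    intro r s t u v w
    rw [map_smul, map_add, map_smul, map_smul, map_smul, smul_add, smul_smul, smul_smul, smul_smul,
      mul_assoc]
  have pn : ∀ r : ℝ, r ^ n = r ^ (k + 2) := fun r => congrArg (r ^ ·) hk
  rw [smul_smul (‖x - reflect n y‖ ^ 1)⁻¹, h6, pn, pn]
  set α := ‖x - y‖
  set β := ‖x - reflect n y‖
  have c1 : -((β ^ 2 - α ^ 2) ^ k * β * (β ^ k * α ^ (k + 1))⁻¹) * α *
      -((1 : ℕ) * (β ^ (1 + 2))⁻¹) = (β ^ 2 - α ^ 2) ^ k * ((β ^ (k + 2))⁻¹ * (α ^ k)⁻¹) := by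
    push_cast
    field_simp
    ring
  have c2 : -((β ^ 2 - α ^ 2) ^ k * β * (β ^ k * α ^ (k + 1))⁻¹) * ((β ^ 1)⁻¹ * α⁻¹) =
      -((β ^ 2 - α ^ 2) ^ k * ((α ^ (k + 2))⁻¹ * (β ^ k)⁻¹)) := by
    field_simp
    ring
  rw [c1, c2]
  module

theorem contDiffAt_E (hn : 2 < n) {x y : Vec n} (h1 : x ≠ y) (h2 : x ≠ reflect n y) :
    ContDiffAt ℝ 1 (fun z => E z y) x := by
  have h4 : (fun z => E z y) = fun z => -(((‖z - y‖ ^ n)⁻¹ * (‖z - reflect n y‖ ^ (n - 2))⁻¹) •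
      vecL n (z - y)) := funext fun z => E_eq hn z y
  have ha : x - y ≠ 0 := sub_ne_zero.2 h1
  have hb : x - reflect n y ≠ 0 := sub_ne_zero.2 h2
  have n1 : ContDiffAt ℝ 1 (fun z : Vec n => ‖z - y‖) x :=
    (contDiffAt_id.sub contDiffAt_const).norm ℝ ha
  have n2 : ContDiffAt ℝ 1 (fun z : Vec n => ‖z - reflect n y‖) x :=
    (contDiffAt_id.sub contDiffAt_const).norm ℝ hb
  rw [h4]
  have n3 : ContDiffAt ℝ 1 (fun z : Vec n => vecL n (z - y)) x :=
    (vecL n).contDiff.contDiffAt.comp x (contDiffAt_id.sub contDiffAt_const)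
  exact ((((n1.pow n).inv (pow_ne_zero _ (norm_ne_zero_iff.2 ha))).mul
    ((n2.pow (n - 2)).inv (pow_ne_zero _ (norm_ne_zero_iff.2 hb)))).smul n3).neg

theorem contDiffAt_F (hn : 2 < n) {x y : Vec n} (h1 : x ≠ y) (h2 : x ≠ reflect n y) :
    ContDiffAt ℝ 1 (fun z => F z y) x := by
  have h4 : (fun z => F z y) = fun z => hatL n (E z (reflect n y)) := funext fun z => F_eq z y
  rw [h4]
  exact (hatL n).contDiff.contDiffAt.comp x
    (contDiffAt_E hn h2 (by rwa [reflect_reflect]))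

/-- The reflection as a continuous linear map. -/
def reflectL (n : ℕ) [NeZero n] : Vec n →L[ℝ] Vec n := LinearMap.toContinuousLinearMap (reflect n)

/-- The vector field whose flux through `∂K` and whose divergence are the integrands of the formula
in terms of `E` and `F`. -/
def cauchyField (y : Vec n) (f : Vec n → Cl n) (x : Vec n) : Vec n →L[ℝ] Cl n :=
  sandwich n (E x y) (f x) - (sandwich n (F x y) (hatL n (f x))).comp (reflectL n)

theorem cauchyField_apply (y : Vec n) (f : Vec n → Cl n) (x v : Vec n) :
    cauchyField y f x v = E x y * vec v * f x - F x y * hat (vec v) * hat (f x) := by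
  rw [cauchyField, sub_apply, ContinuousLinearMap.comp_apply, sandwich_apply, sandwich_apply,
    hat_vec, hatL_apply]
  rfl

theorem contDiffAt_cauchyField (hn : 2 < n) {y x : Vec n} (h1 : x ≠ y) (h2 : x ≠ reflect n y)
    {f : Vec n → Cl n} (hf : ContDiffAt ℝ 1 f x) : ContDiffAt ℝ 1 (cauchyField y f) x := by
  have h3 := contDiffAt_bilin (sandwich n) (contDiffAt_E hn h1 h2) hf
  have h4 := contDiffAt_bilin (sandwich n) (contDiffAt_F hn h1 h2)
    ((hatL n).contDiff.contDiffAt.comp x hf)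
  exact h3.sub (h4.clm_comp contDiffAt_const)

theorem diracHodge_eq (f : Vec n → Cl n) (x : Vec n) :
    diracHodge f x = diracD f x - (((n : ℝ) - 2) / (2 * x (lastIdx n))) •
      (e n (lastIdx n) * (f x - hat (f x))) := by
  rw [diracHodge, Q'_eq, smul_neg, smul_smul, ← sub_eq_add_neg]
  congr 2
  rw [mul_one_div, div_div, mul_comm (2 : ℝ)]

/-- The product rule yields E Df - F (Df)^ plus the kernel derivatives, which by `rightDirac_E` and
`hat_mul_hat_eq` combine to a multiple of A B (f - f̂). By `E_sub_F_mul` this is what the term of M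
with coefficient (n-2) / x_n produces. -/
theorem divergence_cauchyField (hn : 2 < n) {y x : Vec n} (h1 : x ≠ y) (h2 : x ≠ reflect n y)
    (hx : x (lastIdx n) ≠ 0) {f : Vec n → Cl n} (hf : ContDiffAt ℝ 1 f x) :
    divergence (cauchyField y f) x = E x y * diracHodge f x - F x y * hat (diracHodge f x) := by
  have dE : DifferentiableAt ℝ (fun z => E z y) x :=
    (contDiffAt_E hn h1 h2).differentiableAt one_ne_zero
  have dE' : DifferentiableAt ℝ (fun z => E z (reflect n y)) x :=
    (contDiffAt_E hn h2 (by rwa [reflect_reflect])).differentiableAt one_ne_zero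
  have dF : DifferentiableAt ℝ (fun z => F z y) x :=
    (contDiffAt_F hn h1 h2).differentiableAt one_ne_zero
  have df : DifferentiableAt ℝ f x := hf.differentiableAt one_ne_zero
  have dΦ : DifferentiableAt ℝ (cauchyField y f) x :=
    (contDiffAt_cauchyField hn h1 h2 hf).differentiableAt one_ne_zero
  have hj : ∀ j, fderiv ℝ (cauchyField y f) x (basisVec n j) (basisVec n j) =
      (fderiv ℝ (fun z => E z y) x (basisVec n j) * e n j) * f x +
        E x y * (e n j * fderiv ℝ f x (basisVec n j)) -
      (hat (fderiv ℝ (fun z => E z (reflect n y)) x (basisVec n j) * e n j) * hat (f x) +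
        F x y * hat (e n j * fderiv ℝ f x (basisVec n j))) := by
    intro j
    have s1 : fderiv ℝ (cauchyField y f) x (basisVec n j) (basisVec n j) =
        fderiv ℝ (fun z => cauchyField y f z (basisVec n j)) x (basisVec n j) := by
      rw [fderiv_clm_apply dΦ (by fun_prop)]
      simp
    have s2 : (fun z => cauchyField y f z (basisVec n j)) = fun z =>
        E z y * (e n j * f z) - hat (E z (reflect n y) * (e n j * f z)) := by
      funext z
      rw [cauchyField_apply, F_eq, map_mul, map_mul, mul_assoc, mul_assoc]
      rfl
    have d1 : DifferentiableAt ℝ (fun z => e n j * f z) x :=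
      differentiableAt_cl_mul (differentiableAt_const _) df
    rw [s1, s2, fderiv_fun_sub (differentiableAt_cl_mul dE d1)
      (differentiableAt_hat (differentiableAt_cl_mul dE' d1)), sub_apply,
      fderiv_hat (differentiableAt_cl_mul dE' d1), fderiv_cl_mul dE d1, fderiv_cl_mul dE' d1,
      fderiv_cl_mul (differentiableAt_const _) df, F_eq]
    simp only [fderiv_fun_const, Pi.zero_apply, zero_apply, zero_mul, add_zero, map_mul, map_add,
      mul_assoc]
    abel
  rw [divergence_eq_sum (EuclideanSpace.basisFun (Fin n) ℝ)]
  have hb : ∀ j, EuclideanSpace.basisFun (Fin n) ℝ j = basisVec n j := fun j => by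
    simp [basisVec]
  simp only [hb, hj]
  rw [Finset.sum_sub_distrib, Finset.sum_add_distrib, Finset.sum_add_distrib, ← Finset.sum_mul,
    ← Finset.sum_mul, ← Finset.mul_sum, ← Finset.mul_sum, ← map_sum, ← map_sum,
    rightDirac_E hn h1 h2, rightDirac_E hn h2 (by rwa [reflect_reflect]), reflect_reflect,
    map_smul, map_mul, hat_mul_hat_eq, mul_comm (‖x - reflect n y‖ ^ n)⁻¹]
  change _ * f x + E x y * diracD f x - (_ + F x y * hat (diracD f x)) = _
  have key := E_sub_F_mul hn h1 h2
  rw [diracHodge_eq]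
  set M := e n (lastIdx n) * (f x - hat (f x)) with hM
  -- Conjugation changes the sign of both e_n and f - f̂, so the zeroth order term enters only
  -- through E - F.
  have hMh : hat M = M := by
    rw [hM, map_mul, map_sub, hat_hat, hat_e_last, neg_mul, ← mul_neg, neg_sub]
  set κ := (‖x - y‖ ^ n)⁻¹ * (‖x - reflect n y‖ ^ n)⁻¹
  set AB := vec (x - y) * vec (x - reflect n y)
  have h7 : (E x y - F x y) * M = -((2 * x (lastIdx n) * κ) • (AB * (f x - hat (f x)))) := by
    rw [hM, ← mul_assoc, key, neg_mul, smul_mul_assoc]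
  have h8 : E x y * (diracD f x - (((n : ℝ) - 2) / (2 * x (lastIdx n))) • M) -
      F x y * hat (diracD f x - (((n : ℝ) - 2) / (2 * x (lastIdx n))) • M) =
      E x y * diracD f x - F x y * hat (diracD f x) -
        (((n : ℝ) - 2) / (2 * x (lastIdx n))) • ((E x y - F x y) * M) := by
    rw [map_sub, map_smul, hMh, mul_sub, mul_sub, sub_mul, mul_smul_comm, mul_smul_comm, smul_sub]
    abel
  have h9 : ((n : ℝ) - 2) / (2 * x (lastIdx n)) * (2 * x (lastIdx n) * κ) = ((n : ℝ) - 2) * κ := by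
    field_simp
  rw [h8, h7, smul_neg, smul_smul, h9, mul_sub, smul_mul_assoc, smul_mul_assoc, smul_sub]
  abel

end Kernels

/-! ### Integrability near the singularity -/

section Integrability

variable {n : ℕ} [NeZero n]

/-- In polar coordinates the Jacobian s^(n-1) cancels the singularity. -/
theorem integrableOn_norm_sub_pow_inv (y : Vec n) (r : ℝ) :
    IntegrableOn (fun x : Vec n => (‖x - y‖ ^ (n - 1))⁻¹) (Metric.ball y r) := by
  have h1 : IntegrableOn (fun x : Vec n => (fun s : ℝ => (s ^ (n - 1))⁻¹) ‖x‖)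
      (Metric.ball 0 r) := by
    have : Nontrivial (Vec n) := by
      have : Nonempty (Fin n) := ⟨lastIdx n⟩
      infer_instance
    rw [integrableOn_fun_norm_addHaar volume (f := fun s : ℝ => (s ^ (n - 1))⁻¹)]
    simp only [finrank_euclideanSpace, Fintype.card_fin, smul_eq_mul]
    have : IntegrableOn (fun _ : ℝ => (1 : ℝ)) (Ioo 0 r) := integrableOn_const (by simp)
    refine this.congr_fun (fun s hs => ?_) measurableSet_Ioo
    have : s ≠ 0 := hs.1.ne'
    field_simp
  have h2 := ((measurePreserving_sub_right volume y).integrableOn_comp_preimage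
    (Homeomorph.subRight y).measurableEmbedding).2 h1
  refine h2.congr_set_ae (ae_of_all _ fun x => ?_) |>.congr_fun (fun x _ => rfl) Metric.isOpen_ball.measurableSet
  simp [Metric.ball, dist_eq_norm]

/-- Near y the factor h is bounded and κ is integrable; away from y the kernel κ is bounded and h is
integrable. Only integrability of h on K is used, not boundedness up to ∂K. -/
theorem integrableOn_mul_of_singular {K : Set (Vec n)} (hKo : IsOpen K) {y : Vec n} (hy : y ∈ K)
    {κ h : Vec n → Cl n} {C : ℝ} (hκ : ContinuousOn κ (K \ {y}))
    (hC : ∀ x ∈ K, ‖x - y‖ ^ (n - 1) * ‖κ x‖ ≤ C) (hc : ContinuousOn h K)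
    (hh : IntegrableOn h K) : IntegrableOn (fun x => κ x * h x) K := by
  have : Nonempty (Fin n) := ⟨lastIdx n⟩
  have : Nontrivial (Vec n) := by infer_instance
  have hKy : K =ᵐ[volume] (K \ {y} : Set (Vec n)) := (sdiff_null_ae_eq_self (by simp)).symm
  have hκm : AEStronglyMeasurable κ (volume.restrict K) := by
    rw [Measure.restrict_congr_set hKy]
    exact hκ.aestronglyMeasurable (hKo.measurableSet.diff (measurableSet_singleton y))
  have hm : AEStronglyMeasurable (fun x => κ x * h x) (volume.restrict K) :=
    (mulL n).aestronglyMeasurable_comp₂ hκm hh.aestronglyMeasurable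
  have hle : ∀ x, ‖κ x * h x‖ ≤ ‖mulL n‖ * ‖κ x‖ * ‖h x‖ := fun x =>
    (mulL n).le_opNorm₂ (κ x) (h x)
  obtain ⟨r, hr, hrK⟩ := Metric.nhds_basis_closedBall.mem_iff.1 (hKo.mem_nhds hy)
  obtain ⟨B, hB⟩ := (isCompact_closedBall y r).exists_bound_of_continuousOn (hc.mono hrK)
  have hC0 : 0 ≤ C := (by positivity : (0 : ℝ) ≤ _).trans (hC y hy)
  have hκC : ∀ x ∈ K, x ≠ y → ‖κ x‖ ≤ C * (‖x - y‖ ^ (n - 1))⁻¹ := by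
    intro x hx hxy
    have : 0 < ‖x - y‖ := norm_pos_iff.2 (sub_ne_zero.2 hxy)
    rw [← div_eq_mul_inv, le_div_iff₀ (by positivity), mul_comm]
    exact hC x hx
  have hbK : Metric.ball y r ⊆ K := Metric.ball_subset_closedBall.trans hrK
  have h1 : IntegrableOn (fun x => κ x * h x) (Metric.ball y r) := by
    refine Integrable.mono' ((integrableOn_norm_sub_pow_inv y r).const_mul (‖mulL n‖ * C * B))
      (hm.mono_set hbK) ?_
    have hae : ∀ᵐ x ∂(volume.restrict (Metric.ball y r)), x ≠ y :=
      ae_restrict_of_ae (Measure.ae_ne volume y)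
    filter_upwards [hae, ae_restrict_mem Metric.isOpen_ball.measurableSet] with x hxy hx
    refine (hle x).trans ?_
    have b1 := hκC x (hbK hx) hxy
    have b2 := hB x (Metric.ball_subset_closedBall hx)
    calc ‖mulL n‖ * ‖κ x‖ * ‖h x‖ ≤ ‖mulL n‖ * (C * (‖x - y‖ ^ (n - 1))⁻¹) * B := by gcongr
      _ = ‖mulL n‖ * C * B * (‖x - y‖ ^ (n - 1))⁻¹ := by ring
  have h2 : IntegrableOn (fun x => κ x * h x) (K \ Metric.ball y r) := by
    refine Integrable.mono' ((hh.mono_set sdiff_subset).norm.const_mul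
      (‖mulL n‖ * (C * (r ^ (n - 1))⁻¹))) (hm.mono_set sdiff_subset) ?_
    filter_upwards [ae_restrict_mem (hKo.measurableSet.diff Metric.isOpen_ball.measurableSet)]
      with x hx
    refine (hle x).trans ?_
    have hxr : r ≤ ‖x - y‖ := by simpa [dist_eq_norm] using hx.2
    have b1 := hκC x hx.1 (by rintro rfl; simp at hxr; linarith)
    calc ‖mulL n‖ * ‖κ x‖ * ‖h x‖ ≤ ‖mulL n‖ * (C * (‖x - y‖ ^ (n - 1))⁻¹) * ‖h x‖ := by gcongr
      _ ≤ ‖mulL n‖ * (C * (r ^ (n - 1))⁻¹) * ‖h x‖ := by gcongr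
  have := h1.union h2
  rwa [union_sdiff_cancel hbK] at this

end Integrability
-- The area of the sphere, a radial cutoff and its approximate identity
section Fundamental
theorem sphereArea_eq (n : ℕ) (hn : 0 < n): sphereArea n = n * (volume : Measure (Vec n)).real (Metric.ball 0 1) := by
  have : Nonempty (Fin n) := ⟨⟨0, hn⟩⟩
  have hn' : (0 : ℝ) < n := by exact_mod_cast hn
  rw [Measure.real, EuclideanSpace.volume_ball, Fintype.card_fin, ENNReal.ofReal_one, one_pow, one_mul,
    ENNReal.toReal_ofReal (by positivity), Real.Gamma_add_one (by positivity), sphereArea, Real.sqrt_eq_rpow, ← Real.rpow_natCast, ← Real.rpow_mul Real.pi_pos.le]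
  have : Real.Gamma ((n : ℝ) / 2) ≠ 0 := (Real.Gamma_pos_of_pos (by positivity)).ne'
  field_simp

/-- A radial cutoff profile: `0` on `(-∞, 1]` and `1` on `[2, ∞)`, as a function of `‖x‖²`. -/
def cutoff (s : ℝ) : ℝ := Real.smoothTransition (s - 1)

theorem contDiff_cutoff : ContDiff ℝ 2 cutoff :=
  (Real.smoothTransition.contDiff (n := 2)).comp (contDiff_id.sub contDiff_const)

theorem cutoff_of_le {s : ℝ} (h : s ≤ 1) : cutoff s = 0 :=
  Real.smoothTransition.zero_of_nonpos (by linarith)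

theorem cutoff_of_ge {s : ℝ} (h : 2 ≤ s) : cutoff s = 1 :=
  Real.smoothTransition.one_of_one_le (by linarith)

theorem deriv_cutoff_nonneg (s : ℝ) : 0 ≤ deriv cutoff s :=
  Monotone.deriv_nonneg (fun a b h => Real.smoothTransition.monotone (by linarith))

theorem deriv_cutoff_of_lt {s : ℝ} (h : s < 1) : deriv cutoff s = 0 := by
  have : cutoff =ᶠ[𝓝 s] fun _ => 0 := by
    filter_upwards [Iio_mem_nhds h] with t ht using cutoff_of_le ht.le
  rw [this.deriv_eq, deriv_const]

theorem deriv_cutoff_of_gt {s : ℝ} (h : 2 < s) : deriv cutoff s = 0 := by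
  have : cutoff =ᶠ[𝓝 s] fun _ => 1 := by
    filter_upwards [Ioi_mem_nhds h] with t ht using cutoff_of_ge ht.le
  rw [this.deriv_eq, deriv_const]

theorem continuous_deriv_cutoff : Continuous (deriv cutoff) :=
  contDiff_cutoff.continuous_deriv (by norm_num)

/-- The radial bump whose dilates are an approximate identity. -/
def bump (n : ℕ) (z : Vec n) : ℝ :=
  (sphereArea n)⁻¹ * (2 * deriv cutoff (‖z‖ ^ 2) * (‖z‖ ^ (n - 2))⁻¹)

theorem sphereArea_pos {n : ℕ} (hn : 0 < n) : 0 < sphereArea n := by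
  have hn' : (0 : ℝ) < n := by exact_mod_cast hn
  have : 0 < Real.Gamma ((n : ℝ) / 2) := Real.Gamma_pos_of_pos (by positivity)
  rw [sphereArea]
  positivity

/-- In polar coordinates r^(n-1) r^(-(n-2)) = r, so the radial integrand is the derivative of
`cutoff (r ^ 2)`, which climbs from 0 to 1; the remaining constant is the area of the sphere. -/
theorem integral_bump {n : ℕ} (hn : 2 < n) : ∫ z, bump n z = 1 := by
  have : Nonempty (Fin n) := ⟨⟨0, by omega⟩⟩
  have : Nontrivial (Vec n) := by infer_instance
  have h1 := integral_fun_norm_addHaar (volume : Measure (Vec n)) (fun r : ℝ =>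
    (sphereArea n)⁻¹ * (2 * deriv cutoff (r ^ 2) * (r ^ (n - 2))⁻¹))
  have h2 : ∫ r in Ioi (0 : ℝ), r ^ (n - 1) • ((sphereArea n)⁻¹ *
      (2 * deriv cutoff (r ^ 2) * (r ^ (n - 2))⁻¹)) = (sphereArea n)⁻¹ * 1 := by
    have h3 : ∫ r in Ioi (0 : ℝ), r ^ (n - 1) • ((sphereArea n)⁻¹ *
      (2 * deriv cutoff (r ^ 2) * (r ^ (n - 2))⁻¹)) =
        ∫ r in Ioi (0 : ℝ), (sphereArea n)⁻¹ * (deriv cutoff (r ^ 2) * (2 * r)) := by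
      refine setIntegral_congr_fun measurableSet_Ioi fun r (hr : 0 < r) => ?_
      have e1 : n - 1 = (n - 2) + 1 := by omega
      simp only [smul_eq_mul]
      rw [e1, pow_succ]
      field_simp
    have h5 : ∀ r : ℝ, HasDerivAt (fun r : ℝ => cutoff (r ^ 2)) (deriv cutoff (r ^ 2) * (2 * r)) r := by
      intro r
      have := (contDiff_cutoff.differentiable (by norm_num) (r ^ 2)).hasDerivAt.comp r (hasDerivAt_pow 2 r)
      simpa [Function.comp_def] using this
    have h4 : ∫ r in Ioi (0 : ℝ), deriv cutoff (r ^ 2) * (2 * r) = 1 - 0 := by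
      have h6 : cutoff ((0 : ℝ) ^ 2) = 0 := cutoff_of_le (by norm_num)
      conv_rhs => rw [← h6]
      refine integral_Ioi_of_hasDerivAt_of_nonneg' (fun r _ => h5 r) (fun r hr => ?_) ?_
      · have : (0 : ℝ) < r := hr
        have := deriv_cutoff_nonneg (r ^ 2)
        positivity
      · refine tendsto_const_nhds.congr' ?_
        filter_upwards [eventually_ge_atTop (2 : ℝ)] with r hr
        exact (cutoff_of_ge (by nlinarith)).symm
    rw [h3, integral_const_mul, h4, sub_zero]
  simp only [finrank_euclideanSpace, Fintype.card_fin] at h1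
  change ∫ z, (fun r : ℝ => (sphereArea n)⁻¹ * (2 * deriv cutoff (r ^ 2) * (r ^ (n - 2))⁻¹)) ‖z‖ = 1
  rw [h1, h2, nsmul_eq_mul, smul_eq_mul, mul_one, ← mul_assoc, ← sphereArea_eq n (by omega)]
  exact mul_inv_cancel₀ (sphereArea_pos (by omega)).ne'

theorem bump_nonneg {n : ℕ} (hn : 0 < n) (z : Vec n) : 0 ≤ bump n z := by
  have := deriv_cutoff_nonneg (‖z‖ ^ 2)
  have := sphereArea_pos hn
  rw [bump]
  positivity

theorem continuous_bump {n : ℕ} : Continuous (bump n) := by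
  rw [continuous_iff_continuousAt]
  intro z
  rcases eq_or_ne z 0 with rfl | hz
  · have : bump n =ᶠ[𝓝 0] fun _ => 0 := by
      filter_upwards [Metric.ball_mem_nhds 0 one_pos] with z hz
      have : ‖z‖ < 1 := by simpa using hz
      have : ‖z‖ ^ 2 < 1 := by nlinarith [norm_nonneg z]
      rw [bump, deriv_cutoff_of_lt this]
      simp
    exact continuousAt_const.congr this.symm
  · have h1 : ‖z‖ ^ (n - 2) ≠ 0 := pow_ne_zero _ (norm_ne_zero_iff.2 hz)
    have h2 := continuous_deriv_cutoff
    unfold bump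
    fun_prop (disch := assumption)

theorem bump_of_gt {n : ℕ} {z : Vec n} (h : 2 < ‖z‖) : bump n z = 0 := by
  rw [bump, deriv_cutoff_of_gt (by nlinarith)]
  simp

theorem tendsto_integral_bump {n : ℕ} (hn : 2 < n) {X : Type*} [NormedAddCommGroup X]
    [NormedSpace ℝ X] [CompleteSpace X] {g : Vec n → X} {y : Vec n} (hg : Integrable g) (hy : ContinuousAt g y) :
    Tendsto (fun c : ℝ => ∫ x, (c ^ n * bump n (c • (y - x))) • g x) atTop (𝓝 (g y)) := by
  have h := tendsto_integral_comp_smul_smul_of_integrable' (μ := (volume : Measure (Vec n)))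
    (bump_nonneg (by omega)) (integral_bump hn) ?_ hg hy
  · simpa only [finrank_euclideanSpace, Fintype.card_fin] using h
  · refine tendsto_const_nhds.congr' ?_
    have : ∀ᶠ z : Vec n in Bornology.cobounded _, 2 < ‖z‖ :=
      tendsto_norm_cobounded_atTop.eventually (eventually_gt_atTop 2)
    filter_upwards [this] with z hz
    rw [bump_of_gt hz, mul_zero]

end Fundamental

/-! ### Kernel bounds, the residue at y, and the formula with E and F -/

section BorelPompeiu

variable {n : ℕ} [NeZero n]

theorem ne_reflect {x y : Vec n} (hx : 0 < x (lastIdx n)) (hy : 0 < y (lastIdx n)) :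
    x ≠ reflect n y := by
  rintro rfl
  rw [reflect_apply, if_pos rfl] at hx
  linarith

theorem norm_sub_le_norm_sub_reflect {x y : Vec n} (hx : 0 < x (lastIdx n))
    (hy : 0 < y (lastIdx n)) : ‖x - y‖ ≤ ‖x - reflect n y‖ := by
  refine le_of_sq_le_sq ?_ (norm_nonneg _)
  have := norm_sub_reflect_sq_sub x y
  have := mul_pos hx hy
  nlinarith

theorem last_le_norm_sub_reflect {x y : Vec n} (hx : 0 < x (lastIdx n)) :
    y (lastIdx n) ≤ ‖x - reflect n y‖ := by
  have h1 := PiLp.norm_apply_le (x - reflect n y) (lastIdx n)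
  rw [sub_reflect_last, Real.norm_eq_abs] at h1
  linarith [le_abs_self (x (lastIdx n) + y (lastIdx n))]

theorem norm_self_sub_reflect {y : Vec n} (hy : 0 < y (lastIdx n)) :
    ‖y - reflect n y‖ = 2 * y (lastIdx n) := by
  have h := norm_sub_reflect_sq_sub y y
  rw [sub_self, norm_zero] at h
  refine (sq_eq_sq₀ (norm_nonneg _) (by positivity)).1 ?_
  linarith

theorem norm_E_le (hn : 2 < n) {x y : Vec n} (hx : 0 < x (lastIdx n)) (hy : 0 < y (lastIdx n)) :
    ‖x - y‖ ^ (n - 1) * ‖E x y‖ ≤ ‖vecL n‖ * (y (lastIdx n) ^ (n - 2))⁻¹ := by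
  rcases eq_or_ne x y with rfl | hxy
  · rw [sub_self, norm_zero, zero_pow (by omega), zero_mul]
    positivity
  have ha : 0 < ‖x - y‖ := norm_pos_iff.2 (sub_ne_zero.2 hxy)
  have hb := last_le_norm_sub_reflect (y := y) hx
  have hb' : 0 < ‖x - reflect n y‖ := hy.trans_le hb
  have hv : ‖vec (x - y)‖ ≤ ‖vecL n‖ * ‖x - y‖ := (vecL n).le_opNorm _
  have hp : ‖x - y‖ ^ n = ‖x - y‖ ^ (n - 1) * ‖x - y‖ := by
    rw [← pow_succ]; congr 1; omega
  rw [E_eq hn, norm_neg, norm_smul, Real.norm_of_nonneg (by positivity), hp]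
  calc _ = ‖x - y‖⁻¹ * (‖x - reflect n y‖ ^ (n - 2))⁻¹ * ‖vec (x - y)‖ := by field_simp
    _ ≤ ‖x - y‖⁻¹ * (y (lastIdx n) ^ (n - 2))⁻¹ * (‖vecL n‖ * ‖x - y‖) := by gcongr
    _ = _ := by field_simp

/-- This kernel is less singular than E(x,y), but the same weight is kept so that both kernels fit
`integrableOn_mul_of_singular`; the spare factor ‖x - y‖ is absorbed by ‖x - ŷ‖. -/
theorem norm_E_reflect_le (hn : 2 < n) {x y : Vec n} (hx : 0 < x (lastIdx n))
    (hy : 0 < y (lastIdx n)) :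
    ‖x - y‖ ^ (n - 1) * ‖E x (reflect n y)‖ ≤ ‖vecL n‖ * (y (lastIdx n) ^ (n - 2))⁻¹ := by
  rcases eq_or_ne x y with rfl | hxy
  · rw [sub_self, norm_zero, zero_pow (by omega), zero_mul]
    positivity
  have ha : 0 < ‖x - y‖ := norm_pos_iff.2 (sub_ne_zero.2 hxy)
  have hb := last_le_norm_sub_reflect (y := y) hx
  have hab := norm_sub_le_norm_sub_reflect hx hy
  have hb' : 0 < ‖x - reflect n y‖ := hy.trans_le hb
  have hv : ‖vec (x - reflect n y)‖ ≤ ‖vecL n‖ * ‖x - reflect n y‖ := (vecL n).le_opNorm _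
  have hp : ‖x - reflect n y‖ ^ n = ‖x - reflect n y‖ ^ (n - 2) * ‖x - reflect n y‖ ^ 2 := by
    rw [← pow_add]; congr 1; omega
  have hq : ‖x - y‖ ^ (n - 1) = ‖x - y‖ ^ (n - 2) * ‖x - y‖ := by
    rw [← pow_succ]; congr 1; omega
  rw [E_eq hn, reflect_reflect, norm_neg, norm_smul, Real.norm_of_nonneg (by positivity), hp, hq]
  calc _ = ‖x - y‖ * (‖x - reflect n y‖ ^ (n - 2))⁻¹ * (‖x - reflect n y‖ ^ 2)⁻¹ *
        ‖vec (x - reflect n y)‖ := by field_simp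
    _ ≤ ‖x - reflect n y‖ * (y (lastIdx n) ^ (n - 2))⁻¹ * (‖x - reflect n y‖ ^ 2)⁻¹ *
        (‖vecL n‖ * ‖x - reflect n y‖) := by gcongr
    _ = _ := by field_simp

theorem continuousAt_E (hn : 2 < n) {x y : Vec n} (h1 : x ≠ y) (h2 : x ≠ reflect n y) :
    ContinuousAt (fun z => E z y) x := (contDiffAt_E hn h1 h2).continuousAt

theorem continuousAt_E_reflect (hn : 2 < n) {x y : Vec n} (h1 : x ≠ y) (h2 : x ≠ reflect n y) :
    ContinuousAt (fun z => E z (reflect n y)) x :=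
  continuousAt_E hn h2 (by rwa [reflect_reflect])

theorem continuousOn_diracHodge {K : Set (Vec n)} (hKo : IsOpen K)
    (hK : ∀ x ∈ K, x (lastIdx n) ≠ 0) {f : Vec n → Cl n} (hf : ContDiffOn ℝ 1 f K) :
    ContinuousOn (diracHodge f) K := by
  have h1 : ContinuousOn (fderiv ℝ f) K := hf.continuousOn_fderiv_of_isOpen hKo le_rfl
  have h2 : ContinuousOn (diracD f) K := by
    refine continuousOn_finsetSum _ fun j _ => ?_
    exact continuousOn_cl_mul continuousOn_const (h1.clm_apply continuousOn_const)
  have h3 : ContinuousOn (fun x => Q' (f x)) K := by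
    simp only [Q'_eq]
    have : ContinuousOn (fun x => hat (f x)) K :=
      (hatL n).continuous.comp_continuousOn hf.continuousOn
    have h4 : ContinuousOn (fun x => f x - hat (f x)) K := hf.continuousOn.sub this
    have h5 : ContinuousOn (fun x => e n (lastIdx n) * (f x - hat (f x))) K :=
      continuousOn_cl_mul continuousOn_const h4
    exact (h5.const_smul (1 / 2 : ℝ)).neg
  have h4 : ContinuousOn (fun x : Vec n => ((n : ℝ) - 2) / x (lastIdx n)) K :=
    continuousOn_const.div (by fun_prop) hK
  exact h2.add (h4.smul h3)

theorem integrableOn_E_mul (hn : 2 < n) {K : Set (Vec n)} (hKo : IsOpen K)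
    (hKu : K ⊆ upperHalfSpace n) {y : Vec n} (hy : y ∈ K) {h : Vec n → Cl n}
    (hc : ContinuousOn h K) (hh : IntegrableOn h K) : IntegrableOn (fun x => E x y * h x) K :=
  integrableOn_mul_of_singular hKo hy (fun _ hx => (continuousAt_E hn hx.2
    (ne_reflect (hKu hx.1) (hKu hy))).continuousWithinAt) (fun _ hx => norm_E_le hn (hKu hx) (hKu hy))
    hc hh

theorem integrableOn_E_reflect_mul (hn : 2 < n) {K : Set (Vec n)} (hKo : IsOpen K)
    (hKu : K ⊆ upperHalfSpace n) {y : Vec n} (hy : y ∈ K) {h : Vec n → Cl n}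
    (hc : ContinuousOn h K) (hh : IntegrableOn h K) :
    IntegrableOn (fun x => E x (reflect n y) * h x) K :=
  integrableOn_mul_of_singular hKo hy (fun _ hx => (continuousAt_E_reflect hn hx.2
    (ne_reflect (hKu hx.1) (hKu hy))).continuousWithinAt)
    (fun _ hx => norm_E_reflect_le hn (hKu hx) (hKu hy)) hc hh

theorem F_mul_hat (x y : Vec n) (A : Cl n) : F x y * hat A = hat (E x (reflect n y) * A) := by
  rw [F_eq, map_mul]

theorem integrableOn_F_mul (hn : 2 < n) {K : Set (Vec n)} (hKo : IsOpen K)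
    (hKu : K ⊆ upperHalfSpace n) {y : Vec n} (hy : y ∈ K) {h : Vec n → Cl n}
    (hc : ContinuousOn h K) (hh : IntegrableOn h K) :
    IntegrableOn (fun x => F x y * hat (h x)) K := by
  simp only [F_mul_hat]
  exact (hatL n).integrable_comp (integrableOn_E_reflect_mul hn hKo hKu hy hc hh)

/-- The continuous factor of the radial component of `cauchyField y f` at its singularity `y`. -/
def cauchyDensity (y : Vec n) (f : Vec n → Cl n) (x : Vec n) : Cl n :=
  (‖x - reflect n y‖ ^ (n - 2))⁻¹ • f x + (‖x - reflect n y‖ ^ n)⁻¹ •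
    (hat (vec (x - reflect n y)) * hat (vec (x - y)) * hat (f x))

/-- In the radial direction (x - y)⁻¹ meets x - y, which leaves only the scalar singularity ‖x -
y‖^(-(n-2)). The F term keeps a factor x - y and so disappears from the density at y. -/
theorem cauchyField_radial (hn : 2 < n) {x y : Vec n} (hxy : x ≠ y) (f : Vec n → Cl n) :
    cauchyField y f x (x - y) = (‖x - y‖ ^ (n - 2))⁻¹ • cauchyDensity y f x := by
  have ha : 0 < ‖x - y‖ := norm_pos_iff.2 (sub_ne_zero.2 hxy)
  have hp : ‖x - y‖ ^ n = ‖x - y‖ ^ (n - 2) * ‖x - y‖ ^ 2 := by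
    rw [← pow_add]; congr 1; omega
  have h1 : E x y * vec (x - y) =
      ((‖x - y‖ ^ (n - 2))⁻¹ * (‖x - reflect n y‖ ^ (n - 2))⁻¹) • (1 : Cl n) := by
    rw [E, smul_mul_assoc, vecInv_mul_vec (sub_ne_zero.2 hxy), one_div, mul_inv]
  have h2 : F x y = -(((‖x - y‖ ^ (n - 2))⁻¹ * (‖x - reflect n y‖ ^ n)⁻¹) •
      hat (vec (x - reflect n y))) := by
    rw [F_eq, E_eq hn, reflect_reflect, map_neg, map_smul, mul_comm (‖x - y‖ ^ (n - 2))⁻¹]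
  rw [cauchyField_apply, h1, h2, cauchyDensity]
  simp only [smul_mul_assoc, neg_mul, one_mul, smul_add, smul_smul, sub_neg_eq_add]

theorem cauchyDensity_self {y : Vec n} (hy : 0 < y (lastIdx n)) (f : Vec n → Cl n) :
    cauchyDensity y f y = ((2 * y (lastIdx n)) ^ (n - 2))⁻¹ • f y := by
  rw [cauchyDensity, norm_self_sub_reflect hy, sub_self, map_zero, map_zero, mul_zero, zero_mul,
    smul_zero, add_zero]

theorem continuousOn_cauchyDensity {y : Vec n} {s : Set (Vec n)} (hs : ∀ x ∈ s, x ≠ reflect n y)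
    {f : Vec n → Cl n} (hf : ContinuousOn f s) : ContinuousOn (cauchyDensity y f) s := by
  have h1 : ∀ m : ℕ, ContinuousOn (fun x : Vec n => (‖x - reflect n y‖ ^ m)⁻¹) s := fun m =>
    ContinuousOn.inv₀ (by fun_prop) fun x hx =>
      pow_ne_zero _ (norm_ne_zero_iff.2 (sub_ne_zero.2 (hs x hx)))
  have h2 : ∀ c : Vec n, ContinuousOn (fun x : Vec n => hat (vec (x - c))) s := fun c =>
    (((hatL n).comp (vecL n)).continuous.comp (continuous_id.sub continuous_const)).continuousOn
  have h3 : ContinuousOn (fun x => hat (f x)) s := (hatL n).continuous.comp_continuousOn hf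
  exact ((h1 _).smul hf).add ((h1 _).smul (continuousOn_cl_mul (continuousOn_cl_mul (h2 _) (h2 _)) h3))

theorem hasGradientAt_cutoff (c : ℝ) (y x : Vec n) :
    HasGradientAt (fun x => cutoff (c ^ 2 * ‖x - y‖ ^ 2))
      (deriv cutoff (c ^ 2 * ‖x - y‖ ^ 2) • (2 * c ^ 2) • (x - y)) x := by
  refine hasGradientAt_comp (s := fun x => c ^ 2 * ‖x - y‖ ^ 2)
    (contDiff_cutoff.differentiable (by norm_num) _).hasDerivAt ?_
  have h3 := (((hasFDerivAt_id x).sub_const y).norm_sq).const_mul (c ^ 2)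
  rw [hasGradientAt_iff_hasFDerivAt]
  refine HasFDerivAt.congr_fderiv (f := fun x => c ^ 2 * ‖x - y‖ ^ 2) h3 ?_
  ext v
  simp
  ring

/-- The gradient of a radial cutoff is radial, so `cauchyField_radial` applies; `bump` is defined so
that the product is its dilate with total mass 1. -/
theorem cauchyField_gradient_cutoff (hn : 2 < n) {c : ℝ} (hc : 0 < c) (y : Vec n)
    (f : Vec n → Cl n) (x : Vec n) :
    cauchyField y f x (∇ (fun x => cutoff (c ^ 2 * ‖x - y‖ ^ 2)) x) =
      sphereArea n • (c ^ n * bump n (c • (y - x))) • cauchyDensity y f x := by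
  have hs := (sphereArea_pos (show 0 < n by omega)).ne'
  have hnc : ‖c • (y - x)‖ = c * ‖x - y‖ := by
    rw [norm_smul, Real.norm_of_nonneg hc.le, norm_sub_rev]
  rw [(hasGradientAt_cutoff c y x).gradient, bump, hnc, mul_pow, map_smul, map_smul]
  rcases eq_or_ne x y with rfl | hxy
  · rw [sub_self, norm_zero, map_zero, smul_zero, smul_zero, deriv_cutoff_of_lt (by norm_num)]
    simp
  · have ha : 0 < ‖x - y‖ := norm_pos_iff.2 (sub_ne_zero.2 hxy)
    have hp : c ^ n = c ^ (n - 2) * c ^ 2 := by rw [← pow_add]; congr 1; omega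
    rw [cauchyField_radial hn hxy, smul_smul, smul_smul, smul_smul, hp, mul_pow]
    congr 1
    field_simp

theorem continuousWithinAt_cauchyField (hn : 2 < n) {x y : Vec n} {s : Set (Vec n)} (h1 : x ≠ y)
    (h2 : x ≠ reflect n y) {f : Vec n → Cl n} (hf : ContinuousWithinAt f s x) :
    ContinuousWithinAt (cauchyField y f) s x := by
  have h3 : ContinuousWithinAt (fun z => sandwich n (E z y) (f z)) s x :=
    ((sandwich n).continuous.continuousAt.comp_continuousWithinAt
      (continuousAt_E hn h1 h2).continuousWithinAt).clm_apply hf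
  have h4 : ContinuousWithinAt (fun z => sandwich n (F z y) (hatL n (f z))) s x :=
    ((sandwich n).continuous.continuousAt.comp_continuousWithinAt
      (contDiffAt_F hn h1 h2).continuousAt.continuousWithinAt).clm_apply
      ((hatL n).continuous.continuousAt.comp_continuousWithinAt hf)
  exact h3.sub (h4.clm_comp continuousWithinAt_const)

/-- Apply the divergence theorem to the field times the cutoff η c. For large c the flux no longer
depends on c, while the volume side tends to the integral of `g` plus ω_n times the density at y. -/
theorem borel_pompeiu (hn : 2 < n) {K : Set (Vec n)} (hKo : IsOpen K)
    (hKb : Bornology.IsBounded K) (hKs : HasC1Boundary K) (hKu : closure K ⊆ upperHalfSpace n)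
    {f : Vec n → Cl n} (hf : ContDiffOn ℝ 1 f K) (hfc : ContinuousOn f (closure K))
    (hMf : IntegrableOn (diracHodge f) K) {y : Vec n} (hy : y ∈ K) :
    f y = ((2 * y (lastIdx n)) ^ (n - 2) / sphereArea n) •
      ((∫ x, cauchyField y f x (outerNormal K x) ∂surfaceMeasure K) -
        ∫ x in K, (E x y * diracHodge f x - F x y * hat (diracHodge f x))) := by
  have hKu' : K ⊆ upperHalfSpace n := subset_closure.trans hKu
  have hyn : 0 < y (lastIdx n) := hKu' hy
  have hne : ∀ x ∈ closure K, x ≠ reflect n y := fun x hx => ne_reflect (hKu hx) hyn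
  set g : Vec n → Cl n := fun x => E x y * diracHodge f x - F x y * hat (diracHodge f x) with hg
  have hMc : ContinuousOn (diracHodge f) K :=
    continuousOn_diracHodge hKo (fun x hx => (hKu' hx).ne') hf
  have hgi : IntegrableOn g K := (integrableOn_E_mul hn hKo hKu' hy hMc hMf).sub
    (integrableOn_F_mul hn hKo hKu' hy hMc hMf)
  have hφc : ContinuousOn (cauchyDensity y f) (closure K) := continuousOn_cauchyDensity hne hfc
  set η : ℝ → Vec n → ℝ := fun c x => cutoff (c ^ 2 * ‖x - y‖ ^ 2) with hη
  have hηs : ∀ c, ContDiff ℝ 1 (η c) := fun c =>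
    (contDiff_cutoff.of_le (by norm_num)).comp
      (contDiff_const.mul ((contDiff_id.sub contDiff_const).norm_sq ℝ))
  have hη0 : ∀ c > 0, η c =ᶠ[𝓝 y] fun _ => 0 := by
    intro c hc
    have h1 : ContinuousAt (fun x : Vec n => c ^ 2 * ‖x - y‖ ^ 2) y := by fun_prop
    have h2 : ∀ᶠ x in 𝓝 y, c ^ 2 * ‖x - y‖ ^ 2 < 1 := h1.eventually (gt_mem_nhds (by simp))
    filter_upwards [h2] with x hx using cutoff_of_le hx.le
  have hΦ : ∀ x ∈ K, x ≠ y → ContDiffAt ℝ 1 (cauchyField y f) x := fun x hx hxy =>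
    contDiffAt_cauchyField hn hxy (hne x (subset_closure hx)) (hf.contDiffAt (hKo.mem_nhds hx))
  have hΨ0 : ∀ c > 0, (fun x => η c x • cauchyField y f x) =ᶠ[𝓝 y] fun _ => 0 := fun c hc => by
    filter_upwards [hη0 c hc] with x hx
    rw [hx, zero_smul]
  have hΨd : ∀ c > 0, ContDiffOn ℝ 1 (fun x => η c x • cauchyField y f x) K := by
    intro c hc x hx
    rcases eq_or_ne x y with rfl | hxy
    · exact (contDiffAt_const.congr_of_eventuallyEq (hΨ0 c hc)).contDiffWithinAt
    · exact ((hηs c).contDiffAt.smul (hΦ x hx hxy)).contDiffWithinAt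
  have hΨc : ∀ c > 0, ContinuousOn (fun x => η c x • cauchyField y f x) (closure K) := by
    intro c hc x hx
    rcases eq_or_ne x y with rfl | hxy
    · exact (continuousAt_const.congr (hΨ0 c hc).symm).continuousWithinAt
    · exact (hηs c).continuous.continuousWithinAt.smul
        (continuousWithinAt_cauchyField hn hxy (hne x hx) (hfc x hx))
  have hae : ∀ᵐ x ∂(volume.restrict K), x ≠ y ∧ x ∈ K := by
    have : Nonempty (Fin n) := ⟨lastIdx n⟩
    have : Nontrivial (Vec n) := by infer_instance
    exact (ae_restrict_of_ae (Measure.ae_ne volume y)).and (ae_restrict_mem hKo.measurableSet)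
  have hΨe : ∀ c > 0, divergence (fun x => η c x • cauchyField y f x) =ᵐ[volume.restrict K]
      fun x => η c x • g x +
        sphereArea n • (c ^ n * bump n (c • (y - x))) • cauchyDensity y f x := by
    intro c hc
    filter_upwards [hae] with x hx
    rw [divergence_smul ((hηs c).differentiable one_ne_zero x)
      ((hΦ x hx.2 hx.1).differentiableAt one_ne_zero), cauchyField_gradient_cutoff hn hc,
      divergence_cauchyField hn hx.1 (hne x (subset_closure hx.2)) (hKu' hx.2).ne'
        (hf.contDiffAt (hKo.mem_nhds hx.2))]
  have hη1 : ∀ c x, ‖η c x‖ ≤ 1 := fun c x => by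
    rw [Real.norm_of_nonneg (show 0 ≤ cutoff _ from Real.smoothTransition.nonneg _)]
    exact Real.smoothTransition.le_one _
  have hi1 : ∀ c, IntegrableOn (fun x => η c x • g x) K := fun c =>
    Integrable.bdd_smul hgi 1 (hηs c).continuous.aestronglyMeasurable (ae_of_all _ (hη1 c))
  have hi2 : ∀ c : ℝ, IntegrableOn (fun x => (c ^ n * bump n (c • (y - x))) • cauchyDensity y f x) K := by
    intro c
    have h1 : Continuous fun x => c ^ n * bump n (c • (y - x)) := by
      have := continuous_bump (n := n)
      fun_prop
    exact integrableOn_of_continuousOn_closure hKb (h1.continuousOn.smul hφc)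
  obtain ⟨r, hr, hrK⟩ := Metric.isOpen_iff.1 hKo y hy
  have hflux : ∀ c ≥ 2 / r, (∫ x, cauchyField y f x (outerNormal K x) ∂surfaceMeasure K) =
      (∫ x in K, η c x • g x) + sphereArea n •
        ∫ x, (c ^ n * bump n (c • (y - x))) • K.indicator (cauchyDensity y f) x := by
    intro c hcr
    have hc : 0 < c := (by positivity : 0 < 2 / r).trans_le hcr
    have h1 := integral_divergence_eq_integral_surfaceMeasure (by omega) hKo hKb hKs (hΨd c hc)
      (hΨc c hc) (((hi1 c).add ((hi2 c).smul (sphereArea n))).congr (hΨe c hc).symm)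
    have h2 : ∀ᵐ x ∂surfaceMeasure K, (η c x • cauchyField y f x) (outerNormal K x) =
        cauchyField y f x (outerNormal K x) := by
      filter_upwards [ae_surfaceMeasure_mem K] with x hx
      have hxr : r ≤ ‖x - y‖ := by
        by_contra! h
        have : x ∈ K := hrK (by simpa [dist_eq_norm] using h)
        rw [frontier, hKo.interior_eq] at hx
        exact hx.2 this
      have h3 : 2 ≤ c * ‖x - y‖ := by
        rw [ge_iff_le, div_le_iff₀ hr] at hcr
        exact hcr.trans (by gcongr)
      have h4 : η c x = 1 := cutoff_of_ge (by rw [← mul_pow]; nlinarith)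
      rw [h4, one_smul]
    -- The density is extended by zero because the approximate identity acts on the whole space;
    -- continuity at y survives since K is open.
    have h5 : ∀ x, (c ^ n * bump n (c • (y - x))) • K.indicator (cauchyDensity y f) x =
        K.indicator (fun x => (c ^ n * bump n (c • (y - x))) • cauchyDensity y f x) x := fun x => by
      rw [indicator_smul_apply]
    simp only [h5]
    have hi3 : IntegrableOn (fun x => sphereArea n • (c ^ n * bump n (c • (y - x))) •
        cauchyDensity y f x) K := (hi2 c).smul (sphereArea n)
    rw [← integral_congr_ae h2, ← h1, integral_congr_ae (hΨe c hc),
      integral_add (hi1 c) hi3, integral_smul,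
      integral_indicator hKo.measurableSet]
  have hl1 : Tendsto (fun c => ∫ x in K, η c x • g x) atTop (𝓝 (∫ x in K, g x)) := by
    refine tendsto_integral_filter_of_dominated_convergence (fun x => ‖g x‖)
      (Eventually.of_forall fun c => (hi1 c).aestronglyMeasurable)
      (Eventually.of_forall fun c => ae_of_all _ fun x => ?_) hgi.norm ?_
    · rw [norm_smul]
      exact mul_le_of_le_one_left (norm_nonneg _) (hη1 c x)
    · filter_upwards [hae] with x hx
      have ha : 0 < ‖x - y‖ := norm_pos_iff.2 (sub_ne_zero.2 hx.1)
      refine tendsto_const_nhds.congr' ?_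
      filter_upwards [eventually_ge_atTop (2 / ‖x - y‖)] with c hc
      have h3 : 2 ≤ c * ‖x - y‖ := (div_le_iff₀ ha).1 hc
      have h4 : η c x = 1 := cutoff_of_ge (by rw [← mul_pow]; nlinarith)
      rw [h4, one_smul]
  have hl2 := tendsto_integral_bump hn (y := y)
    ((integrable_indicator_iff hKo.measurableSet).2 (integrableOn_of_continuousOn_closure hKb hφc))
    (((hφc.mono subset_closure).continuousAt (hKo.mem_nhds hy)).congr (by
      filter_upwards [hKo.mem_nhds hy] with x hx using (indicator_of_mem hx _).symm))
  rw [indicator_of_mem hy, cauchyDensity_self hyn] at hl2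
  have hl := tendsto_nhds_unique (tendsto_const_nhds.congr' (by
    filter_upwards [eventually_ge_atTop (2 / r)] with c hc using hflux c hc))
    (hl1.add (hl2.const_smul (sphereArea n)))
  have hs := (sphereArea_pos (show 0 < n by omega)).ne'
  have hp : (2 * y (lastIdx n)) ^ (n - 2) ≠ 0 := by positivity
  rw [hl, add_sub_cancel_left, smul_smul, smul_smul]
  have : (2 * y (lastIdx n)) ^ (n - 2) / sphereArea n *
      (sphereArea n * ((2 * y (lastIdx n)) ^ (n - 2))⁻¹) = 1 := by field_simp
  rw [← mul_assoc] at this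
  rw [this, one_smul]

end BorelPompeiu

/-! ### From E and F to p and q -/

section Components

variable {n : ℕ} [NeZero n]

/-- The projection `P` as a continuous linear map. -/
def projP (n : ℕ) [NeZero n] : Cl n →L[ℝ] Cl n :=
  (1 / 2 : ℝ) • (ContinuousLinearMap.id ℝ (Cl n) + hatL n)

theorem projP_apply (A : Cl n) : projP n A = P A := rfl

/-- The projection `Q` as a continuous linear map. -/
def projQ (n : ℕ) [NeZero n] : Cl n →L[ℝ] Cl n :=
  -((1 / 2 : ℝ) • ((mulL n).flip (e n (lastIdx n))).comp (ContinuousLinearMap.id ℝ (Cl n) - hatL n))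

theorem projQ_apply (A : Cl n) : projQ n A = Q A := rfl

theorem smul_p_eq (hn : 2 < n) {x y : Vec n} (h1 : x ≠ y) (hx : 0 < x (lastIdx n))
    (hy : 0 < y (lastIdx n)) : (1 / x (lastIdx n) ^ (n - 2)) • p x y =
      (4 * y (lastIdx n)) ^ (n - 2) • (E x y - E x (reflect n y)) := by
  rw [p_eq hn h1 (ne_reflect hx hy), smul_smul]
  congr 1
  rw [mul_right_comm, mul_pow _ (x (lastIdx n))]
  field_simp

theorem P_p_mul (hn : 2 < n) {x y : Vec n} (h1 : x ≠ y) (hx : 0 < x (lastIdx n))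
    (hy : 0 < y (lastIdx n)) (A : Cl n) : P ((1 / x (lastIdx n) ^ (n - 2)) • (p x y * A)) =
      projP n ((4 * y (lastIdx n)) ^ (n - 2) • (E x y * A - E x (reflect n y) * A)) := by
  rw [← smul_mul_assoc, smul_p_eq hn h1 hx hy, smul_mul_assoc, sub_mul, projP_apply]

theorem Q_q_mul (hn : 2 < n) {x y : Vec n} (h1 : x ≠ y) (hx : 0 < x (lastIdx n))
    (hy : 0 < y (lastIdx n)) (A : Cl n) :
    Q (q x y * A) = projQ n ((1 / 2 : ℝ) • (E x y * A + E x (reflect n y) * A)) := by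
  rw [q_eq hn h1 (ne_reflect hx hy), smul_mul_assoc, add_mul, projQ_apply]

/-- Conjugation preserves P and changes the sign of Q. This is why p, paired with P, is a difference
of values of E while q, paired with Q, is a sum. -/
theorem sub_hat_eq_P_add_Q (A B : Cl n) :
    A - hat B = projP n (A - B) + projQ n (A + B) * e n (lastIdx n) := by
  conv_lhs => rw [(P_Q_spec (A - hat B)).2.2]
  rw [← projP_apply, ← projQ_apply, map_sub, map_sub, projP_apply (hat B), projQ_apply (hat B),
    P_hat, Q_hat, sub_neg_eq_add, ← projP_apply, ← projQ_apply, ← map_sub, ← map_add]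

theorem integral_clm_smul_sub {Y Z : Type*} [NormedAddCommGroup Y] [NormedSpace ℝ Y]
    [CompleteSpace Y] [NormedAddCommGroup Z] [NormedSpace ℝ Z] [CompleteSpace Z] {α : Type*}
    [MeasurableSpace α] {μ : Measure α} (L : Y →L[ℝ] Z) (c : ℝ) {A B : α → Y}
    (hA : Integrable A μ) (hB : Integrable B μ) :
    ∫ x, L (c • (A x - B x)) ∂μ = L (c • ((∫ x, A x ∂μ) - ∫ x, B x ∂μ)) := by
  rw [← integral_sub hA hB, ← integral_smul]
  exact L.integral_comp_comm ((hA.sub hB).smul c)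

theorem integral_clm_smul_add {Y Z : Type*} [NormedAddCommGroup Y] [NormedSpace ℝ Y]
    [CompleteSpace Y] [NormedAddCommGroup Z] [NormedSpace ℝ Z] [CompleteSpace Z] {α : Type*}
    [MeasurableSpace α] {μ : Measure α} (L : Y →L[ℝ] Z) (c : ℝ) {A B : α → Y}
    (hA : Integrable A μ) (hB : Integrable B μ) :
    ∫ x, L (c • (A x + B x)) ∂μ = L (c • ((∫ x, A x ∂μ) + ∫ x, B x ∂μ)) := by
  rw [← integral_add hA hB, ← integral_smul]
  exact L.integral_comp_comm ((hA.add hB).smul c)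

end Components

end HyperbolicClifford

end

/-! ### Assembly of both formulas -/

open HyperbolicClifford

theorem theorem12 (n : ℕ) [NeZero n] (hn : 2 < n)
    (K : Set (Vec n)) (hKo : IsOpen K) (hKb : Bornology.IsBounded K)
    (hKs : HasC1Boundary K) (hKu : closure K ⊆ upperHalfSpace n)
    (f : Vec n → Cl n) (hf : ContDiffOn ℝ 1 f K) (hfc : ContinuousOn f (closure K))
    (hMf : IntegrableOn (diracHodge f) K volume)
    (y : Vec n) (hy : y ∈ K) :
    -- all the integrals exist
    (Integrable (fun x => P ((1 / x (lastIdx n) ^ (n - 2)) •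
        (p x y * vec (outerNormal K x) * f x))) (surfaceMeasure K) ∧
      Integrable (fun x => Q (q x y * vec (outerNormal K x) * f x)) (surfaceMeasure K) ∧
      IntegrableOn (fun x => (1 / x (lastIdx n) ^ (n - 2)) • P (p x y * diracHodge f x)) K volume ∧
      IntegrableOn (fun x => Q (q x y * diracHodge f x)) K volume ∧
      Integrable (fun x => E x y * vec (outerNormal K x) * f x) (surfaceMeasure K) ∧
      Integrable (fun x => F x y * hat (vec (outerNormal K x)) * hat (f x)) (surfaceMeasure K) ∧
      IntegrableOn (fun x => E x y * diracHodge f x - F x y * hat (diracHodge f x)) K volume) ∧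
    -- the formula in terms of `P` and `Q`
    f y = (1 / (2 ^ (n - 2) * sphereArea n)) •
            ((∫ x, P ((1 / x (lastIdx n) ^ (n - 2)) •
                (p x y * vec (outerNormal K x) * f x)) ∂surfaceMeasure K) -
              ∫ x in K, (1 / x (lastIdx n) ^ (n - 2)) • P (p x y * diracHodge f x)) +
          ((2 * y (lastIdx n)) ^ (n - 1) / sphereArea n * (1 / y (lastIdx n))) •
            (((∫ x, Q (q x y * vec (outerNormal K x) * f x) ∂surfaceMeasure K) -
              ∫ x in K, Q (q x y * diracHodge f x)) * e n (lastIdx n)) ∧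
    -- the formula in terms of `E` and `F`
    f y = ((2 * y (lastIdx n)) ^ (n - 2) / sphereArea n) •
            ((∫ x, E x y * vec (outerNormal K x) * f x ∂surfaceMeasure K) -
              ∫ x, F x y * hat (vec (outerNormal K x)) * hat (f x) ∂surfaceMeasure K) -
          ((2 * y (lastIdx n)) ^ (n - 2) / sphereArea n) •
            ∫ x in K, (E x y * diracHodge f x - F x y * hat (diracHodge f x)) := by
  have hKu' : K ⊆ upperHalfSpace n := subset_closure.trans hKu
  have hyn : 0 < y (lastIdx n) := hKu' hy
  have hfK : ∀ x ∈ frontier K, 0 < x (lastIdx n) ∧ x ≠ y := fun x hx =>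
    ⟨hKu (frontier_subset_closure hx), by
      rintro rfl
      rw [frontier, hKo.interior_eq] at hx
      exact hx.2 hy⟩
  have hMc : ContinuousOn (diracHodge f) K :=
    continuousOn_diracHodge hKo (fun x hx => (hKu' hx).ne') hf
  have v1 := integrableOn_E_mul hn hKo hKu' hy hMc hMf
  have v2 := integrableOn_E_reflect_mul hn hKo hKu' hy hMc hMf
  have v3 := integrableOn_F_mul hn hKo hKu' hy hMc hMf
  have hnc : ContinuousOn (fun x => vec (outerNormal K x) * f x) (frontier K) :=
    continuousOn_cl_mul ((vecL n).continuous.comp_continuousOn (continuousOn_outerNormal hKo hKs))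
      (hfc.mono frontier_subset_closure)
  have s1 : Integrable (fun x => E x y * (vec (outerNormal K x) * f x)) (surfaceMeasure K) :=
    integrable_surfaceMeasure (by omega) hKo hKb hKs (continuousOn_cl_mul (fun x hx =>
      (continuousAt_E hn (hfK x hx).2 (ne_reflect (hfK x hx).1 hyn)).continuousWithinAt) hnc)
  have s2 : Integrable (fun x => E x (reflect n y) * (vec (outerNormal K x) * f x))
      (surfaceMeasure K) :=
    integrable_surfaceMeasure (by omega) hKo hKb hKs (continuousOn_cl_mul (fun x hx =>
      (continuousAt_E_reflect hn (hfK x hx).2 (ne_reflect (hfK x hx).1 hyn)).continuousWithinAt) hnc)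
  have s3 : Integrable (fun x => hat (E x (reflect n y) * (vec (outerNormal K x) * f x)))
      (surfaceMeasure K) := (hatL n).integrable_comp s2
  have hF : ∀ x, F x y * hat (vec (outerNormal K x)) * hat (f x) =
      hat (E x (reflect n y) * (vec (outerNormal K x) * f x)) := fun x => by
    rw [mul_assoc, ← map_mul, F_mul_hat]
  have hae : ∀ᵐ x ∂(volume.restrict K), x ≠ y ∧ x ∈ K := by
    have : Nonempty (Fin n) := ⟨lastIdx n⟩
    have : Nontrivial (Vec n) := by infer_instance
    exact (ae_restrict_of_ae (Measure.ae_ne volume y)).and (ae_restrict_mem hKo.measurableSet)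
  -- The weight x_n^(-(n-2)) cancels the power of x_n inside p, so every integrand becomes a fixed
  -- linear image of the integrands with E(x,y) and E(x,ŷ); the volume identities hold off the null
  -- set {y}.
  have eP : (fun x => P ((1 / x (lastIdx n) ^ (n - 2)) • (p x y * (vec (outerNormal K x) * f x))))
      =ᵐ[surfaceMeasure K] fun x => projP n ((4 * y (lastIdx n)) ^ (n - 2) •
        (E x y * (vec (outerNormal K x) * f x) -
          E x (reflect n y) * (vec (outerNormal K x) * f x))) := by
    filter_upwards [ae_surfaceMeasure_mem K] with x hx using
      P_p_mul hn (hfK x hx).2 (hfK x hx).1 hyn _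
  have eQ : (fun x => Q (q x y * (vec (outerNormal K x) * f x)))
      =ᵐ[surfaceMeasure K] fun x => projQ n ((1 / 2 : ℝ) •
        (E x y * (vec (outerNormal K x) * f x) +
          E x (reflect n y) * (vec (outerNormal K x) * f x))) := by
    filter_upwards [ae_surfaceMeasure_mem K] with x hx using
      Q_q_mul hn (hfK x hx).2 (hfK x hx).1 hyn _
  have vP : (fun x => (1 / x (lastIdx n) ^ (n - 2)) • P (p x y * diracHodge f x))
      =ᵐ[volume.restrict K] fun x => projP n ((4 * y (lastIdx n)) ^ (n - 2) •
        (E x y * diracHodge f x - E x (reflect n y) * diracHodge f x)) := by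
    filter_upwards [hae] with x hx
    rw [← P_p_mul hn hx.1 (hKu' hx.2) hyn, ← projP_apply, ← projP_apply, map_smul]
  have vQ : (fun x => Q (q x y * diracHodge f x))
      =ᵐ[volume.restrict K] fun x => projQ n ((1 / 2 : ℝ) •
        (E x y * diracHodge f x + E x (reflect n y) * diracHodge f x)) := by
    filter_upwards [hae] with x hx using Q_q_mul hn hx.1 (hKu' hx.2) hyn _
  have bp := borel_pompeiu hn hKo hKb hKs hKu hf hfc hMf hy
  simp only [cauchyField_apply, hF] at bp ⊢
  simp only [mul_assoc (E _ _), mul_assoc (p _ _), mul_assoc (q _ _)] at bp ⊢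
  rw [integral_sub s1 s3] at bp
  have i1 := (s1.sub s2).smul ((4 * y (lastIdx n)) ^ (n - 2))
  have i2 := (s1.add s2).smul (1 / 2 : ℝ)
  have i3 := (v1.sub v2).smul ((4 * y (lastIdx n)) ^ (n - 2))
  have i4 := (v1.add v2).smul (1 / 2 : ℝ)
  refine ⟨⟨((projP n).integrable_comp i1).congr eP.symm, ((projQ n).integrable_comp i2).congr eQ.symm,
    ((projP n).integrable_comp i3).congr vP.symm, ((projQ n).integrable_comp i4).congr vQ.symm,
    s1, s3, v1.sub v3⟩, ?_, by rw [← smul_sub]; exact bp⟩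
  have hh : ∫ x, hat (E x (reflect n y) * (vec (outerNormal K x) * f x)) ∂surfaceMeasure K =
      hat (∫ x, E x (reflect n y) * (vec (outerNormal K x) * f x) ∂surfaceMeasure K) :=
    (hatL n).integral_comp_comm s2
  have hh' : ∫ x in K, F x y * hat (diracHodge f x) =
      hat (∫ x in K, E x (reflect n y) * diracHodge f x) := by
    simp only [F_mul_hat]
    exact (hatL n).integral_comp_comm v2
  rw [integral_sub v1 v3, hh, hh'] at bp
  rw [integral_congr_ae eP, integral_congr_ae eQ, integral_congr_ae vP, integral_congr_ae vQ,
    integral_clm_smul_sub _ _ s1 s2, integral_clm_smul_add _ _ s1 s2,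
    integral_clm_smul_sub _ _ v1 v2, integral_clm_smul_add _ _ v1 v2, bp]
  set I₁ := ∫ x, E x y * (vec (outerNormal K x) * f x) ∂surfaceMeasure K
  set I₂ := ∫ x, E x (reflect n y) * (vec (outerNormal K x) * f x) ∂surfaceMeasure K
  set J₁ := ∫ x in K, E x y * diracHodge f x
  set J₂ := ∫ x in K, E x (reflect n y) * diracHodge f x
  have hs := (sphereArea_pos (show 0 < n by omega)).ne'
  have e1 : I₁ - hat I₂ - (J₁ - hat J₂) = (I₁ - J₁) - hat (I₂ - J₂) := by
    rw [map_sub]; abel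
  have e2 : I₁ - I₂ - (J₁ - J₂) = I₁ - J₁ - (I₂ - J₂) := by abel
  have e3 : I₁ + I₂ - (J₁ + J₂) = I₁ - J₁ + (I₂ - J₂) := by abel
  have c1 : 1 / (2 ^ (n - 2) * sphereArea n) * (4 * y (lastIdx n)) ^ (n - 2) =
      (2 * y (lastIdx n)) ^ (n - 2) / sphereArea n := by
    rw [show 4 * y (lastIdx n) = 2 * (2 * y (lastIdx n)) by ring, mul_pow 2 (2 * y (lastIdx n))]
    field_simp
  -- The 1/2 is the one in q; with 1 / y_n it removes one factor 2 y_n.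
  have c2 : (2 * y (lastIdx n)) ^ (n - 1) / sphereArea n * (1 / y (lastIdx n)) * (1 / 2) =
      (2 * y (lastIdx n)) ^ (n - 2) / sphereArea n := by
    rw [show n - 1 = n - 2 + 1 by omega, pow_succ]
    field_simp
  rw [e1, sub_hat_eq_P_add_Q, ← map_sub, ← map_sub, ← smul_sub, ← smul_sub, e2, e3, map_smul,
    map_smul, smul_mul_assoc, smul_smul, smul_smul, c1, c2, smul_add]
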